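/- **Conventions.** $[t]$ is the largest integer $\le t$. For functions $a,b$ write $a\prec b$ if $a(x)/b(x)\to0$ as $x\to\infty$. A *measure preserving system* $(X,\mu,T)$ is a compact metric space $X$ with a Borel probability measure $\mu$ and an invertible bimeasurable map $T:X\to X$ that preserves $\mu$; $Tf=f\circ T$; $\mathcal I(T)$ is the $\sigma$-algebra of $T$-invariant Borel sets. A *coupling* of $(X_1,\mu_1),\dots,(X_d,\mu_d)$ is a measure on $X_1\times\dots\times X_d$ with marginals $\mu_1,\dots,\mu_d$. *The class $\mathcal S$.* It consists of the real functions $a$ that are $C^3$ on some $(c,\infty)$, $c\ge0$ (with arbitrary real values elsewhere), such that $a(x)\prec x$, $1/a'(x)\prec x$ (so that $a'\neq0$ eventually), and such that the inverse function $b=a^{-1}$, defined near $+\infty$ if $a\to+\infty$ and near $-\infty$ if $a\to-\infty$ (one of these holds), lies in $M_1\cap D_0\cap D_1\cap(D_2\cup M_2)$. Here, with "eventually" and $\limsup$ referring to that end of the real line, $b\in M_k$ means that $b^{(k)}$ is eventually monotone, and $b\in D_k$ means $\limsup_x\sup_{|h|\le1}|b^{(k+1)}(x+h)/b^{(k)}(x)|<\infty$.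 *The class $\mathcal S^\ast$.* It consists of those $a\in\mathcal S$ for which $\lim_N\frac1N\sum_{n=0}^{N-1}f(T^{[a(n)]}x)$ exists for $\mu$-a.e. $x$, for every measure preserving system $(X,\mu,T)$ and every bounded measurable $f$. **Theorem.** Let $d\ge1$, let $(X_i,\mu_i,T_i)$, $1\le i\le d$, be measure preserving systems, let $a_1(x)=kx+\ell$ with $k,\ell\in\mathbb R$, $k\ne0$, let $a_2,\dots,a_d\in\mathcal S^\ast$, with $a_d\prec\dots\prec a_1$ and $a_d'\prec\dots\prec a_1'$, and let $\nu$ be any coupling of the spaces $(X_i,\mu_i)$. Then for all complex-valued $f_i\in L^\infty(\mu_i)$, $1\le i\le d$, the averages $$\frac1N\sum_{n=0}^{N-1}\prod_{i=1}^d f_i\big(T_i^{[a_i(n)]}x_i\big)$$ converge as $N\to\infty$ for $\nu$-a.e. $(x_1,\dots,x_d)$. Moreover: (i) If $k=p/q$ with $p\in\mathbb Z\setminus\{0\}$ and $q\in\mathbb N$, $q\ge1$, then for $\nu$-a.e. $(x_1,\dots,x_d)$ the limit equals $$\frac1q\sum_{j=0}^{q-1}\mathbb E\Big(T_1^{[\frac{pj}q+\ell]}f_1\,\Big|\,\mathcal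 I(T_1^p)\Big)(x_1)\;\prod_{i=2}^d\mathbb E(f_i\,|\,\mathcal I(T_i))(x_i).$$ (ii) If $k=\gamma$ is irrational, then for $\nu$-a.e. $(x_1,\dots,x_d)$ the limit equals $F(x_1)\prod_{i=2}^d\mathbb E(f_i|\mathcal I(T_i))(x_i)$, where $$F(x)=\sum_{m\in\mathbb Z}\exp\Big(2\pi i\frac{m\ell}\gamma\Big)\cdot\frac{\exp(-2\pi i\frac m\gamma)-1}{-2\pi i\frac m\gamma}\;\mathbb E(f_1\,|\,\mathcal I_{\gamma,m}(T_1))(x).$$ Here the quotient is read as $1$ for $m=0$, $\mathbb E(f_1|\mathcal I_{\gamma,m}(T_1))$ denotes (a version of) the orthogonal projection in $L^2(\mu_1)$ of $f_1$ to the eigenspace $\{g\in L^2(\mu_1): g\circ T_1=e^{2\pi i m/\gamma}g\}$, and the series converges absolutely at $x=x_1$ for $\nu$-a.e. $(x_1,\dots,x_d)$. -/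

import Mathlib

open MeasureTheory Filter Topology

universe u

noncomputable section

/-! Growth of functions, and the class of sublinear functions -/

/-- `a ≺ b`: the quotient `a x / b x` tends to `0` as `x → ∞`. -/
def Prec (a b : ℝ → ℝ) : Prop :=
  Tendsto (fun x => a x / b x) atTop (𝓝 0)

/-- `b` is the inverse function of `a` near infinity. Here `l` is the end of the real line
(`atTop` or `atBot`) to which `a x` tends as `x → ∞`. The germ of `b` at `l` is determined by `a`
when `a` is continuous near `∞`. -/
def IsInverseAtEnd (a b : ℝ → ℝ) (l : Filter ℝ) : Prop :=
  Tendsto a atTop l ∧ Tendsto b l atTop ∧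
    (∀ᶠ x in atTop, b (a x) = x) ∧ (∀ᶠ y in l, a (b y) = y)

/-- The condition `M_k` at the end `l`: the `k`-th derivative of `b` is eventually monotone
(nondecreasing or nonincreasing). -/
def CondM (k : ℕ) (b : ℝ → ℝ) (l : Filter ℝ) : Prop :=
  ∃ s ∈ l, MonotoneOn (iteratedDeriv k b) s ∨ AntitoneOn (iteratedDeriv k b) s

/-- The condition `D_k` at the end `l`: the limsup, as `x` tends to `l`, of
`sup_{h ∈ [-1,1]} |b^{(k+1)}(x+h) / b^{(k)}(x)|` is finite (in particular the quotients are
defined eventually). -/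
def CondD (k : ℕ) (b : ℝ → ℝ) (l : Filter ℝ) : Prop :=
  ∃ C : ℝ, ∀ᶠ x in l, iteratedDeriv k b x ≠ 0 ∧
    ∀ h ∈ Set.Icc (-1 : ℝ) 1, |iteratedDeriv (k + 1) b (x + h) / iteratedDeriv k b x| ≤ C

/-- The class `𝓢`: functions `a` of class `C³` on some half line `(c, ∞)`, `c ≥ 0` (the values of
`a` elsewhere are arbitrary), such that `a` and `1 / a'` are sublinear and the inverse function of
`a` lies in `M₁ ∩ D₀ ∩ D₁ ∩ (D₂ ∪ M₂)`. -/
def MemS (a : ℝ → ℝ) : Prop :=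
  (∃ c : ℝ, 0 ≤ c ∧ ContDiffOn ℝ 3 a (Set.Ioi c)) ∧
  Prec a (fun x => x) ∧
  (∀ᶠ x in atTop, deriv a x ≠ 0) ∧ Prec (fun x => 1 / deriv a x) (fun x => x) ∧
  ∃ (b : ℝ → ℝ) (l : Filter ℝ), (l = atTop ∨ l = atBot) ∧ IsInverseAtEnd a b l ∧
    CondM 1 b l ∧ CondD 0 b l ∧ CondD 1 b l ∧ (CondD 2 b l ∨ CondM 2 b l)

/-! Iterates, and the class of functions that are good for single pointwise averages -/

/-- The integer iterate `T ^ n`, for `n ∈ ℤ`, of an invertible bimeasurable map. -/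
def zIter {X : Type*} [MeasurableSpace X] (T : X ≃ᵐ X) (n : ℤ) : X → X :=
  ⇑((T.toEquiv : Equiv.Perm X) ^ n)

/-- The class `𝓢*`: functions `a` in `𝓢` such that the averages
`(1/N) ∑_{n < N} f (T^{[a n]} x)` converge for almost every `x`, for every invertible measure
preserving system on a compact metric probability space and every bounded measurable `f`. -/
def MemSStar (a : ℝ → ℝ) : Prop :=
  MemS a ∧
  ∀ (X : Type u) [MetricSpace X] [CompactSpace X] [MeasurableSpace X] [BorelSpace X]
    (μ : Measure X) [IsProbabilityMeasure μ] (T : X ≃ᵐ X), MeasurePreserving T μ μ →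
    ∀ f : X → ℂ, Measurable f → (∃ C : ℝ, ∀ x, ‖f x‖ ≤ C) →
      ∀ᵐ x ∂μ, ∃ L : ℂ,
        Tendsto (fun N : ℕ => (1 / (N : ℂ)) * ∑ n ∈ Finset.range N, f (zIter T ⌊a n⌋ x))
          atTop (𝓝 L)

/-! Couplings and multiple averages -/

/-- A coupling of the spaces `(X i, μ i)`: a measure on the product with marginals `μ i`. -/
def IsCoupling {ι : Type*} {X : ι → Type*} [∀ i, MeasurableSpace (X i)]
    (μ : ∀ i, Measure (X i)) (ν : Measure (∀ i, X i)) : Prop :=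
  ∀ i, ν.map (fun x => x i) = μ i

/-- The multiple average
`(1/N) ∑_{n < N} ∏ᵢ fᵢ (Tᵢ^{[aᵢ(n)]} xᵢ)`. -/
def multAvg {ι : Type*} [Fintype ι] {X : ι → Type*} [∀ i, MeasurableSpace (X i)]
    (T : ∀ i, X i ≃ᵐ X i) (a : ι → ℝ → ℝ) (f : ∀ i, X i → ℂ) (x : ∀ i, X i) (N : ℕ) : ℂ :=
  (1 / (N : ℂ)) * ∑ n ∈ Finset.range N, ∏ i, f i (zIter (T i) ⌊a i n⌋ (x i))

/-! Eigenspaces of the Koopman operator -/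

section Eigen

variable {X : Type*} [MeasurableSpace X] {μ : Measure X}

/-- The operator `g ↦ g ∘ T` on `L²(μ)`. -/
def koopman (T : X ≃ᵐ X) (hT : MeasurePreserving T μ μ) : Lp ℂ 2 μ →L[ℂ] Lp ℂ 2 μ :=
  (Lp.compMeasurePreservingₗᵢ ℂ (T : X → X) hT).toContinuousLinearMap

/-- The closed subspace of all `g ∈ L²(μ)` with `g ∘ T = exp (2πiθ) g`. -/
def eigenSub (T : X ≃ᵐ X) (hT : MeasurePreserving T μ μ) (θ : ℝ) : Submodule ℂ (Lp ℂ 2 μ) :=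
  (koopman T hT - Complex.exp (2 * Real.pi * Complex.I * θ) •
    ContinuousLinearMap.id ℂ (Lp ℂ 2 μ)).ker

instance (T : X ≃ᵐ X) (hT : MeasurePreserving T μ μ) (θ : ℝ) :
    CompleteSpace (eigenSub T hT θ) :=
  ContinuousLinearMap.completeSpace_ker _

/-- The conditional expectation of `f ∈ L²(μ)` onto the eigenspace with eigenvalue `exp (2πiθ)`,
that is, (a version of) its orthogonal projection to that eigenspace. -/
def eigenExp (T : X ≃ᵐ X) (hT : MeasurePreserving T μ μ) (θ : ℝ) (f : X → ℂ)
    (hf : MemLp f 2 μ) : X → ℂ :=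
  (((eigenSub T hT θ).starProjection (hf.toLp f) : Lp ℂ 2 μ) : X → ℂ)

end Eigen

/-- The coefficient
`exp (2πi mℓ/γ) * (exp (-2πi m/γ) - 1) / (-2πi m/γ)`, whose second factor is `1` for `m = 0`. -/
def eigenCoeff (γ ℓ : ℝ) (m : ℤ) : ℂ :=
  Complex.exp (2 * Real.pi * Complex.I * (m * ℓ / γ)) *
    if m = 0 then 1
    else (Complex.exp (-2 * Real.pi * Complex.I * (m / γ)) - 1) /
      (-2 * Real.pi * Complex.I * (m / γ))

end

/-! Put u_i(n) = f_i(T_i^{[a_i(n)]} x_i), let L_i be the expected limit of its averages and w_i = 1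
+ |1/a_i'|, the order of the time during which [a_i] stays constant. The factors are replaced by
their limits from the fastest to the slowest. For i < j the factor u_j changes only when [a_j]
jumps; the jumps weighted by w_j add up to O(N), and w_i = o(w_j), so u_j has w_i-weighted variation
o(N). Hence it suffices that u_i - L_i is `WNull` for w_i; `tendsto_avg_prod` then multiplies the
limits.

For sublinear a, von Neumann's splitting gives f - E(f|I) = g - g∘T + error, with g bounded and the
error small in L². Along [a(n)] the coboundary is constant on blocks of increasing lengths, so Abel
summation bounds its partial sums by the last length, which is O(w)
(`IsSlowIndex.wnull_coboundary`); the conditions on the inverse function control the lengths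
(`exists_isSlowIndex`). The class 𝓢* makes the averages of |error| converge, and Fatou and Markov
show that their limits are rarely large (`MemSStar.ae_wnull`).

For the linear function the partial sums are even bounded, up to a small Cesàro error (`BNull`):
coboundaries telescope and the maximal inequality controls the error, also after a twist by a
character (`ae_bnull_twisted`). A rational slope p/q reduces to T^p on residue classes mod q. For
irrational γ > 0 the average over n becomes an average over the values m of the floor, weighted by
their multiplicities; these equal 1/γ plus a difference of two sawtooths along the rotation by -1/γ
(`ceil_sub_ceil_eq`). Fourier expansion leaves twisted averages, whose coefficients combine to
`eigenCoeff`; Weyl equidistribution makes the truncation error small in mean. Bessel's inequality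
for the orthogonal eigenspaces gives absolute convergence. For γ < 0 the inverse map is used. -/

/-! ### Null sequences in Cesàro mean, tested against slowly varying multipliers. -/

open Finset in
theorem sum_range_mul_sub_by_parts (V c : ℕ → ℂ) (N : ℕ) :
    ∑ n ∈ range N, (V (n + 1) - V n) * c n =
      V N * c N - V 0 * c 0 - ∑ n ∈ range N, V (n + 1) * (c (n + 1) - c n) := by
  induction N with
  | zero => simp
  | succ N ih => rw [sum_range_succ, sum_range_succ, ih]; ring

/-- `v` is negligible in Cesàro mean against all multipliers whose variation, weighted by `w`,
is sublinear. -/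
def WNull (w : ℕ → ℝ) (v : ℕ → ℂ) : Prop :=
  ∀ ε : ℝ, 0 < ε → ∃ C : ℝ, 0 ≤ C ∧ ∀ (N : ℕ) (c : ℕ → ℂ), (∀ n, ‖c n‖ ≤ 1) →
    ‖∑ n ∈ Finset.range N, v n * c n‖ ≤
      ε * N + C * (1 + w N + ∑ n ∈ Finset.range N, w n * ‖c (n + 1) - c n‖)

/-- The Cesàro means of `‖v‖` are asymptotically at most `ε`. -/
def CesaroLE (v : ℕ → ℂ) (ε : ℝ) : Prop :=
  ∃ C : ℝ, 0 ≤ C ∧ ∀ N : ℕ, ∑ n ∈ Finset.range N, ‖v n‖ ≤ ε * N + C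

theorem CesaroLE.mono {v : ℕ → ℂ} {ε δ : ℝ} (h : CesaroLE v ε) (hle : ε ≤ δ) : CesaroLE v δ := by
  obtain ⟨C, hC, h⟩ := h
  exact ⟨C, hC, fun N => (h N).trans (by gcongr)⟩

theorem CesaroLE.of_norm_le {v v' : ℕ → ℂ} {ε : ℝ} (h : CesaroLE v ε) (hle : ∀ n, ‖v' n‖ ≤ ‖v n‖) :
    CesaroLE v' ε := by
  obtain ⟨C, hC, h⟩ := h
  exact ⟨C, hC, fun N => (Finset.sum_le_sum fun n _ => hle n).trans (h N)⟩

theorem CesaroLE.add {v v' : ℕ → ℂ} {ε ε' : ℝ} (h : CesaroLE v ε) (h' : CesaroLE v' ε') :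
    CesaroLE (fun n => v n + v' n) (ε + ε') := by
  obtain ⟨C, hC, h⟩ := h
  obtain ⟨C', hC', h'⟩ := h'
  refine ⟨C + C', by positivity, fun N => ?_⟩
  calc ∑ n ∈ Finset.range N, ‖v n + v' n‖ ≤ ∑ n ∈ Finset.range N, (‖v n‖ + ‖v' n‖) :=
        Finset.sum_le_sum fun n _ => norm_add_le _ _
    _ ≤ (ε + ε') * N + (C + C') := by
        rw [Finset.sum_add_distrib]; linarith [h N, h' N]

/-- An eventual bound on Cesàro means suffices. -/
theorem CesaroLE.of_eventually {v : ℕ → ℂ} {ε : ℝ}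
    (h : ∀ᶠ N : ℕ in atTop, ∑ n ∈ Finset.range N, ‖v n‖ ≤ ε * N) (hε : 0 ≤ ε) :
    CesaroLE v ε := by
  obtain ⟨N₀, hN₀⟩ := eventually_atTop.1 h
  refine ⟨∑ n ∈ Finset.range N₀, ‖v n‖, by positivity, fun N => ?_⟩
  rcases le_total N₀ N with hN | hN
  · exact (hN₀ N hN).trans (le_add_of_nonneg_right (by positivity))
  · calc ∑ n ∈ Finset.range N, ‖v n‖ ≤ ∑ n ∈ Finset.range N₀, ‖v n‖ :=
          Finset.sum_le_sum_of_subset_of_nonneg (Finset.range_mono hN) fun _ _ _ => norm_nonneg _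
      _ ≤ _ := le_add_of_nonneg_left (by positivity)

theorem CesaroLE.of_tendsto {v : ℕ → ℂ} {L ε : ℝ} (hL : L < ε)
    (h : Tendsto (fun N : ℕ => (1 / (N : ℝ)) * ∑ n ∈ Finset.range N, ‖v n‖) atTop (𝓝 L)) :
    CesaroLE v ε := by
  have hL0 : 0 ≤ L := ge_of_tendsto' h fun N => by positivity
  refine CesaroLE.of_eventually ?_ (hL0.trans hL.le)
  filter_upwards [h.eventually (gt_mem_nhds hL), eventually_gt_atTop 0] with N hN hN0
  have : (0 : ℝ) < N := by exact_mod_cast hN0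
  rw [one_div, inv_mul_lt_iff₀ this] at hN
  linarith

namespace WNull

variable {w : ℕ → ℝ} {v : ℕ → ℂ}

theorem variation_nonneg (hw : ∀ n, 0 ≤ w n) (N : ℕ) (c : ℕ → ℂ) :
    0 ≤ 1 + w N + ∑ n ∈ Finset.range N, w n * ‖c (n + 1) - c n‖ := by
  have := hw N
  have : 0 ≤ ∑ n ∈ Finset.range N, w n * ‖c (n + 1) - c n‖ :=
    Finset.sum_nonneg fun n _ => mul_nonneg (hw n) (norm_nonneg _)
  positivity

theorem of_approx (hw : ∀ n, 0 ≤ w n)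
    (h : ∀ ε : ℝ, 0 < ε → ∃ v' : ℕ → ℂ, WNull w v' ∧ CesaroLE (fun n => v n - v' n) ε) :
    WNull w v := by
  intro ε hε
  obtain ⟨v', h1, C', hC', h2⟩ := h (ε / 2) (by positivity)
  obtain ⟨C, hC, h1⟩ := h1 (ε / 2) (by positivity)
  refine ⟨C + C', by positivity, fun N c hc => ?_⟩
  have e : ∑ n ∈ Finset.range N, v n * c n = ∑ n ∈ Finset.range N, v' n * c n +
      ∑ n ∈ Finset.range N, (v n - v' n) * c n := by
    rw [← Finset.sum_add_distrib]; exact Finset.sum_congr rfl fun n _ => by ring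
  have h3 : ‖∑ n ∈ Finset.range N, (v n - v' n) * c n‖ ≤ ε / 2 * N + C' := by
    refine (norm_sum_le _ _).trans ((Finset.sum_le_sum fun n _ => ?_).trans (h2 N))
    rw [norm_mul]
    exact mul_le_of_le_one_right (norm_nonneg _) (hc n)
  have h4 := variation_nonneg hw N c
  -- The summand 1 in the bracket lets `C` absorb the additive constant of a Cesàro bound.
  have h5 : (1 : ℝ) ≤ 1 + w N + ∑ n ∈ Finset.range N, w n * ‖c (n + 1) - c n‖ := by
    have := hw N
    have : 0 ≤ ∑ n ∈ Finset.range N, w n * ‖c (n + 1) - c n‖ :=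
      Finset.sum_nonneg fun n _ => mul_nonneg (hw n) (norm_nonneg _)
    linarith
  rw [e]
  refine (norm_add_le _ _).trans ((add_le_add (h1 N c hc) h3).trans ?_)
  nlinarith [mul_le_mul_of_nonneg_left h5 hC']

/-- Summation by parts moves the difference onto `c`. The boundary term is the reason for `w N` in
the definition of `WNull`; the interior terms pair `V (n + 1)` with `w n`, whence the second bound.
-/
theorem of_primitive (hw : ∀ n, 0 ≤ w n) {V : ℕ → ℂ} {K : ℝ} (hK : 0 ≤ K)
    (hV : ∀ n, ‖V n‖ ≤ K * w n) (hV' : ∀ n, ‖V (n + 1)‖ ≤ K * w n) :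
    WNull w (fun n => V (n + 1) - V n) := by
  intro ε hε
  refine ⟨K + ‖V 0‖, by positivity, fun N c hc => ?_⟩
  rw [sum_range_mul_sub_by_parts]
  have h1 : ‖V N * c N‖ ≤ K * w N := by
    rw [norm_mul]
    exact (mul_le_of_le_one_right (norm_nonneg _) (hc N)).trans (hV N)
  have h2 : ‖V 0 * c 0‖ ≤ ‖V 0‖ := by
    rw [norm_mul]
    exact mul_le_of_le_one_right (norm_nonneg _) (hc 0)
  have h3 : ‖∑ n ∈ Finset.range N, V (n + 1) * (c (n + 1) - c n)‖ ≤
      K * ∑ n ∈ Finset.range N, w n * ‖c (n + 1) - c n‖ := by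
    rw [Finset.mul_sum]
    refine (norm_sum_le _ _).trans (Finset.sum_le_sum fun n _ => ?_)
    rw [norm_mul, ← mul_assoc]
    gcongr
    exact hV' n
  have h4 : 0 ≤ ∑ n ∈ Finset.range N, w n * ‖c (n + 1) - c n‖ :=
    Finset.sum_nonneg fun n _ => mul_nonneg (hw n) (norm_nonneg _)
  have h5 := norm_nonneg (V 0)
  have h6 := hw N
  have h7 : 0 ≤ ε * N := by positivity
  refine (norm_sub_le _ _).trans ((add_le_add (norm_sub_le _ _) le_rfl).trans ?_)
  nlinarith [mul_nonneg h5 h4, mul_nonneg h5 h6]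

theorem tendsto_avg_mul (h : WNull w v)
    (hwN : Tendsto (fun N : ℕ => w N / N) atTop (𝓝 0)) {c : ℕ → ℂ} {K : ℝ}
    (hc : ∀ n, ‖c n‖ ≤ K)
    (hvar : Tendsto (fun N : ℕ => (∑ n ∈ Finset.range N, w n * ‖c (n + 1) - c n‖) / N)
      atTop (𝓝 0)) :
    Tendsto (fun N : ℕ => (1 / (N : ℂ)) * ∑ n ∈ Finset.range N, v n * c n) atTop (𝓝 0) := by
  have hK : 0 ≤ K := (norm_nonneg _).trans (hc 0)
  -- Multipliers must be scaled into the unit disc; `K + 1` is positive even if `K = 0`.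
  set K' := K + 1 with hK'
  have hK'0 : (0 : ℝ) < K' := by positivity
  rw [Metric.tendsto_atTop']
  intro ε hε
  obtain ⟨C, hC, h⟩ := h (ε / (2 * K')) (by positivity)
  have h1 : Tendsto (fun N : ℕ => K' * (C * (1 / (N : ℝ) + w N / N)) +
      C * ((∑ n ∈ Finset.range N, w n * ‖c (n + 1) - c n‖) / N)) atTop (𝓝 0) := by
    have := (((tendsto_one_div_atTop_nhds_zero_nat (𝕜 := ℝ)).add hwN).const_mul C).const_mul K'
    simpa using this.add (hvar.const_mul C)
  obtain ⟨N₀, hN₀⟩ := eventually_atTop.1 (h1.eventually (gt_mem_nhds (half_pos hε)))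
  refine ⟨N₀, fun N hN => ?_⟩
  have hN0 : (0 : ℝ) < N := by exact_mod_cast (Nat.zero_le _).trans_lt hN
  have h2 := h N (fun n => (K' : ℂ)⁻¹ * c n) (fun n => by
    rw [norm_mul, norm_inv, Complex.norm_real, Real.norm_of_nonneg hK'0.le,
      inv_mul_le_iff₀ hK'0]
    linarith [hc n])
  have e1 : ∑ n ∈ Finset.range N, v n * ((K' : ℂ)⁻¹ * c n) =
      (K' : ℂ)⁻¹ * ∑ n ∈ Finset.range N, v n * c n := by
    rw [Finset.mul_sum]; exact Finset.sum_congr rfl fun n _ => by ring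
  have e2 : ∑ n ∈ Finset.range N, w n * ‖(K' : ℂ)⁻¹ * c (n + 1) - (K' : ℂ)⁻¹ * c n‖ =
      K'⁻¹ * ∑ n ∈ Finset.range N, w n * ‖c (n + 1) - c n‖ := by
    rw [Finset.mul_sum]
    refine Finset.sum_congr rfl fun n _ => ?_
    rw [← mul_sub, norm_mul, norm_inv, Complex.norm_real, Real.norm_of_nonneg hK'0.le]; ring
  rw [e1, e2, norm_mul, norm_inv, Complex.norm_real, Real.norm_of_nonneg hK'0.le,
    inv_mul_le_iff₀ hK'0] at h2
  have h3 := hN₀ N hN.le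
  set S := ∑ n ∈ Finset.range N, w n * ‖c (n + 1) - c n‖
  rw [dist_zero_right, norm_mul, norm_div, norm_one, Complex.norm_natCast, one_div,
    inv_mul_lt_iff₀ hN0]
  have e3 : K' * (ε / (2 * K') * N + C * (1 + w N + K'⁻¹ * S)) =
      N * (ε / 2 + (K' * (C * (1 / (N : ℝ) + w N / N)) + C * (S / N))) := by
    field_simp
  rw [e3] at h2
  refine h2.trans_lt ?_
  gcongr
  linarith

end WNull

/-! ### Averages of products. -/

theorem norm_prod_le_pow_card {ι : Type*} (s : Finset ι) {x : ι → ℂ} {K : ℝ}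
    (hx : ∀ i ∈ s, ‖x i‖ ≤ K) : ‖∏ i ∈ s, x i‖ ≤ K ^ s.card := by
  rw [norm_prod, ← Finset.prod_const]
  exact Finset.prod_le_prod (fun _ _ => norm_nonneg _) hx

/-- The factors are exchanged one at a time; `1 ≤ K` permits the slightly wasteful exponent
`s.card`. -/
theorem norm_prod_sub_prod_le {ι : Type*} (s : Finset ι) {x y : ι → ℂ} {K : ℝ} (hK : 1 ≤ K)
    (hx : ∀ i ∈ s, ‖x i‖ ≤ K) (hy : ∀ i ∈ s, ‖y i‖ ≤ K) :
    ‖∏ i ∈ s, x i - ∏ i ∈ s, y i‖ ≤ K ^ s.card * ∑ i ∈ s, ‖x i - y i‖ := by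
  classical
  induction s using Finset.induction_on with
  | empty => simp
  | insert i s hi ih =>
    rw [Finset.prod_insert hi, Finset.prod_insert hi, Finset.sum_insert hi,
      Finset.card_insert_of_notMem hi]
    have ih' := ih (fun j hj => hx j (Finset.mem_insert_of_mem hj))
      (fun j hj => hy j (Finset.mem_insert_of_mem hj))
    have e : x i * ∏ j ∈ s, x j - y i * ∏ j ∈ s, y j =
        (x i - y i) * ∏ j ∈ s, x j + y i * (∏ j ∈ s, x j - ∏ j ∈ s, y j) := by ring
    have hp : ‖∏ j ∈ s, x j‖ ≤ K ^ s.card :=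
      norm_prod_le_pow_card s fun j hj => hx j (Finset.mem_insert_of_mem hj)
    have hyi := hy i (Finset.mem_insert_self _ _)
    have hK0 : 0 ≤ K := by linarith
    have hKp : K ^ s.card ≤ K ^ (s.card + 1) := pow_le_pow_right₀ hK (Nat.le_succ _)
    rw [e]
    refine (norm_add_le _ _).trans ?_
    rw [norm_mul, norm_mul, mul_add]
    refine add_le_add ?_ ?_
    · rw [mul_comm]
      gcongr
      exact hp.trans hKp
    · calc ‖y i‖ * ‖∏ j ∈ s, x j - ∏ j ∈ s, y j‖
          ≤ K * (K ^ s.card * ∑ j ∈ s, ‖x j - y j‖) := by gcongr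
        _ = _ := by ring

/-- Averages of products of bounded sequences factor, if each factor is constant up to a null
sequence for a weight which is dominated by the slowness of the subsequent factors. -/
theorem tendsto_avg_prod {d : ℕ} (u : Fin d → ℕ → ℂ) (L : Fin d → ℂ) (w : Fin d → ℕ → ℝ)
    {K : ℝ} (hK : 1 ≤ K) (hu : ∀ i n, ‖u i n‖ ≤ K) (hw : ∀ i n, 0 ≤ w i n)
    (hwN : ∀ i, Tendsto (fun N : ℕ => w i N / N) atTop (𝓝 0))
    (hnull : ∀ i, WNull (w i) (fun n => u i n - L i))
    (hvar : ∀ i j, i < j →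
      Tendsto (fun N : ℕ => (∑ n ∈ Finset.range N, w i n * ‖u j (n + 1) - u j n‖) / N)
        atTop (𝓝 0)) :
    Tendsto (fun N : ℕ => (1 / (N : ℂ)) * ∑ n ∈ Finset.range N, ∏ i, u i n) atTop
      (𝓝 (∏ i, L i)) := by
  induction d with
  | zero =>
    simp only [Finset.univ_eq_empty, Finset.prod_empty, Finset.sum_const, Finset.card_range,
      nsmul_eq_mul, mul_one]
    refine tendsto_const_nhds.congr' ?_
    filter_upwards [eventually_gt_atTop 0] with N hN
    have : (N : ℂ) ≠ 0 := by exact_mod_cast hN.ne'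
    field_simp
  | succ d ih =>
    have ih' := ih (fun i => u i.succ) (fun i => L i.succ) (fun i => w i.succ)
      (fun i n => hu _ n) (fun i n => hw _ n) (fun i => hwN _) (fun i => hnull _)
      (fun i j hij => hvar _ _ (Fin.succ_lt_succ_iff.2 hij))
    -- The product of the remaining factors is the multiplier. Its variation is at most a constant
    -- times the sum of theirs, each negligible against the weight `w 0`.
    have h0 := (hnull 0).tendsto_avg_mul (hwN 0) (c := fun n => ∏ i : Fin d, u i.succ n)
      (K := K ^ d) (fun n => by
        simpa using norm_prod_le_pow_card Finset.univ fun i _ => hu (Fin.succ i) n) (by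
        have hs := tendsto_finsetSum (Finset.univ : Finset (Fin d)) fun i _ =>
          hvar 0 i.succ (Fin.succ_pos i)
        have hs' := hs.const_mul (K ^ d)
        simp only [Finset.sum_const_zero, mul_zero] at hs'
        refine squeeze_zero (fun N => ?_) (fun N => ?_) hs'
        · exact div_nonneg (Finset.sum_nonneg fun n _ => mul_nonneg (hw 0 n) (norm_nonneg _))
            (Nat.cast_nonneg _)
        · rw [← Finset.sum_div, mul_div_assoc', Finset.sum_comm]
          gcongr
          rw [Finset.mul_sum]
          refine Finset.sum_le_sum fun n _ => ?_
          have := norm_prod_sub_prod_le (Finset.univ : Finset (Fin d)) hK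
            (fun i _ => hu i.succ (n + 1)) (fun i _ => hu i.succ n)
          rw [← Finset.mul_sum]
          calc _ ≤ w 0 n * _ := mul_le_mul_of_nonneg_left this (hw 0 n)
            _ = _ := by simp; ring)
    have h1 := h0.add (ih'.const_mul (L 0))
    rw [Fin.prod_univ_succ, ← zero_add (L 0 * _)]
    refine h1.congr fun N => ?_
    rw [mul_left_comm (L 0), ← mul_add, Finset.mul_sum, ← Finset.sum_add_distrib]
    congr 1
    refine Finset.sum_congr rfl fun n _ => ?_
    rw [Fin.prod_univ_succ]
    ring

/-! ### Slow indices: jumps and coboundaries. -/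

/-- A slowly growing index `M n`: it equals `k` on an interval of integers with endpoints `B k` and
`B (k + 1)`, the lengths of these intervals increase, and they are comparable to the weight `w`. -/
structure IsSlowIndex (w : ℕ → ℝ) (M : ℕ → ℕ) (B : ℕ → ℝ) (n₀ : ℕ) (K : ℝ) : Prop where
  one_le_weight : ∀ n, 1 ≤ w n
  const_nonneg : 0 ≤ K
  one_lt_length : ∀ k, 1 < B (k + 1) - B k
  length_mono : Monotone fun k => B (k + 1) - B k
  left_le : ∀ n ≥ n₀, B (M n) ≤ n
  le_right : ∀ n ≥ n₀, n ≤ B (M n + 1)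
  length_le : ∀ n ≥ n₀, B (M n + 1) - B (M n) ≤ K * w n
  weight_le : ∀ n ≥ n₀, w n ≤ K * (B (M n + 1) - B (M n))
  sublinear : Tendsto (fun n : ℕ => (M n : ℝ) / n) atTop (𝓝 0)

namespace IsSlowIndex

variable {w : ℕ → ℝ} {M : ℕ → ℕ} {B : ℕ → ℝ} {n₀ : ℕ} {K : ℝ}

theorem strictMono (h : IsSlowIndex w M B n₀ K) : StrictMono B :=
  strictMono_nat_of_lt_succ fun k => by linarith [h.one_lt_length k]

/-- Blocks are longer than 1, so a unit step crosses at most one endpoint. -/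
theorem succ_eq (h : IsSlowIndex w M B n₀ K) {n : ℕ} (hn : n₀ ≤ n) :
    M (n + 1) = M n ∨ M (n + 1) = M n + 1 := by
  have h1 : M n < M (n + 1) + 1 := by
    have h2 := h.left_le n hn
    have h3 := h.le_right (n + 1) (by omega)
    push_cast at h3
    exact h.strictMono.lt_iff_lt.1 (by linarith)
  have h2 : M (n + 1) < M n + 2 := by
    have h2 := h.le_right n hn
    have h3 := h.left_le (n + 1) (by omega)
    have h4 := h.one_lt_length (M n + 1)
    push_cast at h3
    exact h.strictMono.lt_iff_lt.1 (by linarith)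
  omega

/-- A jump at `n` ends the block `M n`, whose length is at least `w n / K`; the lengths telescope.
-/
theorem sum_jumps_le (h : IsSlowIndex w M B n₀ K) {N : ℕ} (hN : n₀ ≤ N) :
    ∑ n ∈ Finset.Ico n₀ N, w n * (if M (n + 1) = M n then 0 else 1) ≤
      K * (B (M N) - B (M n₀)) := by
  induction N, hN using Nat.le_induction with
  | base => simp
  | succ N hN ih =>
    rw [Finset.sum_Ico_succ_top hN]
    rcases h.succ_eq hN with e | e
    · simpa [e] using ih
    · rw [e, if_neg (by omega)]
      linarith [h.weight_le N hN]

theorem sum_jumps_le' (h : IsSlowIndex w M B n₀ K) :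
    ∃ C, 0 ≤ C ∧ ∀ N : ℕ, ∑ n ∈ Finset.range N, w n * (if M (n + 1) = M n then 0 else 1) ≤
      K * N + C := by
  have hpos : ∀ n, 0 ≤ w n * (if M (n + 1) = M n then 0 else 1) := fun n => by
    have := h.one_le_weight n
    split_ifs <;> simp; linarith
  refine ⟨∑ n ∈ Finset.range n₀, w n * (if M (n + 1) = M n then 0 else 1) + K * |B (M n₀)|,
    add_nonneg (Finset.sum_nonneg fun n _ => hpos n) (mul_nonneg h.const_nonneg (abs_nonneg _)),
    fun N => ?_⟩
  have hK := h.const_nonneg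
  rcases le_total n₀ N with hN | hN
  · rw [← Finset.sum_range_add_sum_Ico _ hN]
    have h1 := h.sum_jumps_le hN
    have h2 := h.left_le N hN
    have h3 : K * (B (M N) - B (M n₀)) ≤ K * (N + |B (M n₀)|) := by
      gcongr
      linarith [neg_abs_le (B (M n₀))]
    linarith
  · have := Finset.sum_le_sum_of_subset_of_nonneg (Finset.range_mono hN) fun n _ _ => hpos n
    have : 0 ≤ K * |B (M n₀)| := by positivity
    have : 0 ≤ K * N := by positivity
    linarith

/-- Each jump raises `M` by one. The times before `n₀`, where nothing is known, are counted as
exceptional too. -/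
theorem count_jumps_le (h : IsSlowIndex w M B n₀ K) (N : ℕ) :
    ∑ n ∈ Finset.range N, (if n < n₀ ∨ M (n + 1) ≠ M n then (1 : ℝ) else 0) ≤ n₀ + M N := by
  rcases le_total n₀ N with hN | hN
  · induction N, hN using Nat.le_induction with
    | base =>
      have : ∑ n ∈ Finset.range n₀, (if n < n₀ ∨ M (n + 1) ≠ M n then (1 : ℝ) else 0) ≤
          ∑ n ∈ Finset.range n₀, (1 : ℝ) := Finset.sum_le_sum fun n _ => by split_ifs <;> simp
      simp only [Finset.sum_const, Finset.card_range, nsmul_eq_mul, mul_one] at this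
      have h0 : (0 : ℝ) ≤ M n₀ := Nat.cast_nonneg _
      linarith
    | succ N hN ih =>
      rw [Finset.sum_range_succ]
      rcases h.succ_eq hN with e | e
      · rw [if_neg (by simp [e, hN])]
        simpa [e] using ih
      · rw [e]
        have : (if N < n₀ ∨ M N + 1 ≠ M N then (1 : ℝ) else 0) ≤ 1 := by split_ifs <;> simp
        push_cast
        linarith
  · have : ∑ n ∈ Finset.range N, (if n < n₀ ∨ M (n + 1) ≠ M n then (1 : ℝ) else 0) ≤
        ∑ n ∈ Finset.range N, (1 : ℝ) := Finset.sum_le_sum fun n _ => by split_ifs <;> simp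
    simp only [Finset.sum_const, Finset.card_range, nsmul_eq_mul, mul_one] at this
    have h0 : (0 : ℝ) ≤ M N := Nat.cast_nonneg _
    have : (N : ℝ) ≤ n₀ := by exact_mod_cast hN
    linarith

/-- Since `M n / n → 0`, the exceptional times have density zero. -/
theorem cesaroLE_of_jumps (h : IsSlowIndex w M B n₀ K) {v : ℕ → ℂ} {D : ℝ} (hD : 0 ≤ D)
    (hv : ∀ n, ‖v n‖ ≤ D * if n < n₀ ∨ M (n + 1) ≠ M n then (1 : ℝ) else 0) {ε : ℝ}
    (hε : 0 < ε) : CesaroLE v ε := by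
  refine CesaroLE.of_eventually ?_ hε.le
  have h1 : Tendsto (fun N : ℕ => D * (n₀ * (1 / (N : ℝ)) + M N / N)) atTop (𝓝 0) := by
    simpa using (((tendsto_one_div_atTop_nhds_zero_nat (𝕜 := ℝ)).const_mul (n₀ : ℝ)).add
      h.sublinear).const_mul D
  filter_upwards [h1.eventually (gt_mem_nhds hε), eventually_gt_atTop 0] with N hN hN0
  have hN0 : (0 : ℝ) < N := by exact_mod_cast hN0
  calc ∑ n ∈ Finset.range N, ‖v n‖ ≤ D * (n₀ + M N) := by
        refine (Finset.sum_le_sum fun n _ => hv n).trans ?_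
        rw [← Finset.mul_sum]
        exact mul_le_mul_of_nonneg_left (h.count_jumps_le N) hD
    _ = D * (n₀ * (1 / (N : ℝ)) + M N / N) * N := by field_simp
    _ ≤ ε * N := by gcongr

/-- Abel summation puts the differences on the lengths β_k. These increase, so their variation
telescopes: R β_m + R β_0 + R (β_m - β_0) = 2 R β_m. -/
theorem norm_sum_length_mul_le (h : IsSlowIndex w M B n₀ K) {g : ℕ → ℂ} {R : ℝ}
    (hg : ∀ k, ‖g k‖ ≤ R) (m : ℕ) :
    ‖∑ k ∈ Finset.range m, ((B (k + 1) - B k : ℝ) : ℂ) * (g k - g (k + 1))‖ ≤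
      2 * R * (B (m + 1) - B m) := by
  have hR : 0 ≤ R := (norm_nonneg _).trans (hg 0)
  have e := sum_range_mul_sub_by_parts g (fun k => ((B (k + 1) - B k : ℝ) : ℂ)) m
  have e' : ∑ k ∈ Finset.range m, ((B (k + 1) - B k : ℝ) : ℂ) * (g k - g (k + 1)) =
      -∑ k ∈ Finset.range m, (g (k + 1) - g k) * ((B (k + 1) - B k : ℝ) : ℂ) := by
    rw [← Finset.sum_neg_distrib]; exact Finset.sum_congr rfl fun k _ => by ring
  rw [e', norm_neg, e]
  have hβ : ∀ k, ‖((B (k + 1) - B k : ℝ) : ℂ)‖ = B (k + 1) - B k := fun k => by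
    rw [Complex.norm_real, Real.norm_of_nonneg (by linarith [h.one_lt_length k])]
  have h1 : ‖g m * ((B (m + 1) - B m : ℝ) : ℂ)‖ ≤ R * (B (m + 1) - B m) := by
    rw [norm_mul, hβ]
    exact mul_le_mul_of_nonneg_right (hg m) (by linarith [h.one_lt_length m])
  have h2 : ‖g 0 * ((B (0 + 1) - B 0 : ℝ) : ℂ)‖ ≤ R * (B (0 + 1) - B 0) := by
    rw [norm_mul, hβ]
    exact mul_le_mul_of_nonneg_right (hg 0) (by linarith [h.one_lt_length 0])
  have h3 : ‖∑ k ∈ Finset.range m, g (k + 1) *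
      (((B (k + 1 + 1) - B (k + 1) : ℝ) : ℂ) - ((B (k + 1) - B k : ℝ) : ℂ))‖ ≤
      R * (B (m + 1) - B m) - R * (B (0 + 1) - B 0) := by
    rw [← mul_sub, ← Finset.sum_range_sub (fun k => B (k + 1) - B k), Finset.mul_sum]
    refine (norm_sum_le _ _).trans (Finset.sum_le_sum fun k _ => ?_)
    rw [norm_mul, ← Complex.ofReal_sub, Complex.norm_real,
      Real.norm_of_nonneg (sub_nonneg.2 (h.length_mono (Nat.le_succ k)))]
    exact mul_le_mul_of_nonneg_right (hg _) (sub_nonneg.2 (h.length_mono (Nat.le_succ k)))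
  refine (norm_sub_le _ _).trans ((add_le_add (norm_sub_le _ _) le_rfl).trans ?_)
  linarith

/-- The sequence is constant on blocks, and its primitive is at most a multiple of the current block
length, hence of `w`, so `WNull.of_primitive` applies. -/
theorem wnull_coboundary (h : IsSlowIndex w M B n₀ K) {g : ℕ → ℂ} {R : ℝ}
    (hg : ∀ k, ‖g k‖ ≤ R) : WNull w (fun n => g (M n) - g (M n + 1)) := by
  have hR : 0 ≤ R := (norm_nonneg _).trans (hg 0)
  have hw0 : ∀ n, 0 ≤ w n := fun n => by linarith [h.one_le_weight n]
  have hG : ∀ k, ‖g k - g (k + 1)‖ ≤ 2 * R := fun k =>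
    (norm_sub_le _ _).trans (by linarith [hg k, hg (k + 1)])
  -- The integral of the block function up to time `n`: all completed blocks, then the elapsed part
  -- of the current one. Its increments are the given sequence except at jumps.
  let P : ℕ → ℂ := fun n => ∑ k ∈ Finset.range (M n), ((B (k + 1) - B k : ℝ) : ℂ) *
      (g k - g (k + 1)) + ((n - B (M n) : ℝ) : ℂ) * (g (M n) - g (M n + 1))
  let V : ℕ → ℂ := fun n => if n₀ ≤ n then P n else 0
  have hP1 : ∀ n ≥ n₀, ‖P n‖ ≤ 4 * R * K * w n := fun n hn => by
    have h1 := h.norm_sum_length_mul_le hg (M n)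
    have h2 : ‖((n - B (M n) : ℝ) : ℂ) * (g (M n) - g (M n + 1))‖ ≤
        (B (M n + 1) - B (M n)) * (2 * R) := by
      rw [norm_mul, Complex.norm_real, Real.norm_of_nonneg (sub_nonneg.2 (h.left_le n hn))]
      exact mul_le_mul (by linarith [h.le_right n hn]) (hG _) (norm_nonneg _)
        (by linarith [h.one_lt_length (M n)])
    have h3 : 4 * R * (B (M n + 1) - B (M n)) ≤ 4 * R * (K * w n) :=
      mul_le_mul_of_nonneg_left (h.length_le n hn) (by positivity)
    refine (norm_add_le _ _).trans ?_
    linarith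
  have hP2 : ∀ n ≥ n₀, M (n + 1) = M n → P (n + 1) - P n = g (M n) - g (M n + 1) := by
    intro n hn e
    simp only [P, e]
    push_cast
    ring
  have hP3 : ∀ n ≥ n₀, ‖P (n + 1) - P n‖ ≤ 2 * R := by
    intro n hn
    rcases h.succ_eq hn with e | e
    · rw [hP2 n hn e]; exact hG _
    · have h1 := h.le_right n hn
      have h2 := h.left_le (n + 1) (by omega)
      rw [e] at h2
      push_cast at h2
      -- A step across an endpoint is split there; the two parts have total length 1.
      have e1 : P (n + 1) - P n = ((B (M n + 1) - n : ℝ) : ℂ) * (g (M n) - g (M n + 1)) +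
          ((n + 1 - B (M n + 1) : ℝ) : ℂ) * (g (M n + 1) - g (M n + 1 + 1)) := by
        simp only [P, e, Finset.sum_range_succ]
        push_cast
        ring
      rw [e1]
      refine (norm_add_le _ _).trans ?_
      rw [norm_mul, norm_mul, Complex.norm_real, Complex.norm_real,
        Real.norm_of_nonneg (by linarith), Real.norm_of_nonneg (by linarith)]
      calc _ ≤ (B (M n + 1) - n) * (2 * R) + (n + 1 - B (M n + 1)) * (2 * R) :=
            add_le_add (mul_le_mul_of_nonneg_left (hG _) (by linarith))
              (mul_le_mul_of_nonneg_left (hG _) (by linarith))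
        _ = 2 * R := by ring
  -- `V` vanishes before `n₀`, where the block inequalities may fail; `A` bounds its one artificial
  -- jump, at `n₀`.
  set A := ‖P n₀‖ with hA
  have hA0 : 0 ≤ A := norm_nonneg _
  have hK := h.const_nonneg
  have hV1 : WNull w (fun n => V (n + 1) - V n) := by
    refine WNull.of_primitive hw0 (K := 4 * R * K + 2 * R + A) (by positivity) (fun n => ?_)
      fun n => ?_
    · by_cases hn : n₀ ≤ n
      · simp only [V, hn, if_true]
        refine (hP1 n hn).trans ?_
        have := hw0 n
        gcongr
        linarith
      · simp only [V, hn, if_false, norm_zero]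
        have := hw0 n
        positivity
    · have hw1 := h.one_le_weight n
      by_cases hn : n₀ ≤ n
      · simp only [V, show n₀ ≤ n + 1 by omega, if_true]
        have h1 : ‖P (n + 1)‖ ≤ ‖P n‖ + ‖P (n + 1) - P n‖ := by
          simpa using norm_add_le (P n) (P (n + 1) - P n)
        have h2 := hP1 n hn
        have h3 := hP3 n hn
        have h4 : 2 * R * 1 ≤ 2 * R * w n := mul_le_mul_of_nonneg_left hw1 (by positivity)
        have h5 : 0 ≤ A * w n := mul_nonneg hA0 (hw0 n)
        linarith
      · by_cases hn' : n₀ = n + 1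
        · simp only [V, ← hn', le_refl, if_true]
          have h5 : A * 1 ≤ A * w n := mul_le_mul_of_nonneg_left hw1 hA0
          have h6 : 0 ≤ (4 * R * K + 2 * R) * w n := mul_nonneg (by positivity) (hw0 n)
          linarith
        · simp only [V, show ¬ n₀ ≤ n + 1 by omega, if_false, norm_zero]
          have := hw0 n
          positivity
  refine WNull.of_approx hw0 fun ε hε => ⟨_, hV1, ?_⟩
  refine h.cesaroLE_of_jumps (D := 4 * R + A) (by positivity) (fun n => ?_) hε
  by_cases hn : n₀ ≤ n
  · by_cases e : M (n + 1) = M n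
    · simp only [V, hn, show n₀ ≤ n + 1 by omega, if_true, hP2 n hn e]
      simp [e, hn.not_gt]
    · rw [if_pos (Or.inr e), mul_one]
      simp only [V, hn, show n₀ ≤ n + 1 by omega, if_true]
      refine (norm_sub_le _ _).trans ?_
      linarith [hP3 n hn, hG (M n)]
  · rw [if_pos (Or.inl (not_le.1 hn)), mul_one]
    have h1 : ‖V (n + 1) - V n‖ ≤ A := by
      by_cases hn' : n₀ = n + 1
      · simp [V, ← hn', hn, hA]
      · simp [V, show ¬ n₀ ≤ n + 1 by omega, hn, hA0]
    refine (norm_sub_le _ _).trans ?_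
    linarith [hG (M n)]

end IsSlowIndex

/-! Derivatives of inverse functions -/

theorem deriv_comp_mul_deriv_eventually {a b : ℝ → ℝ} (ha : Tendsto a atTop atTop)
    (hba : ∀ᶠ x in atTop, b (a x) = x) (ha' : ∀ᶠ x in atTop, deriv a x ≠ 0)
    (hb' : ∀ᶠ y in atTop, deriv b y ≠ 0) :
    ∀ᶠ x in atTop, deriv b (a x) * deriv a x = 1 := by
  obtain ⟨x₀, hx₀⟩ := eventually_atTop.1 hba
  filter_upwards [ha.eventually hb', ha', eventually_gt_atTop x₀] with x h1 h2 h3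
  have d1 := (differentiableAt_of_deriv_ne_zero h1).hasDerivAt
  have d2 := (differentiableAt_of_deriv_ne_zero h2).hasDerivAt
  have d3 := d1.comp x d2
  have d4 : HasDerivAt (b ∘ a) 1 x := by
    refine (hasDerivAt_id x).congr_of_eventuallyEq ?_
    filter_upwards [lt_mem_nhds h3] with z hz using hx₀ z hz.le
  exact d3.unique d4

/-- As b' = 1 / (a' ∘ b) and a' → 0, |b'| tends to infinity. Monotonicity of b' together with b → ∞
makes b' positive and increasing, and the mean value theorem turns the bound on b'' into b'(y + 1) ≤
K b'(y). -/
theorem exists_ray_deriv_inverse {a b : ℝ → ℝ} {c : ℝ} (ha : Tendsto a atTop atTop)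
    (hb : Tendsto b atTop atTop) (hba : ∀ᶠ x in atTop, b (a x) = x)
    (hab : ∀ᶠ y in atTop, a (b y) = y) (hc : ContDiffOn ℝ 3 a (Set.Ioi c))
    (ha' : ∀ᶠ x in atTop, deriv a x ≠ 0) (ha0 : Tendsto (deriv a) atTop (𝓝 0))
    (hM : ∃ s ∈ (atTop : Filter ℝ), MonotoneOn (deriv b) s ∨ AntitoneOn (deriv b) s)
    (hD : ∃ C : ℝ, ∀ᶠ y in atTop, deriv b y ≠ 0 ∧
      ∀ h ∈ Set.Icc (-1 : ℝ) 1, |deriv (deriv b) (y + h) / deriv b y| ≤ C) :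
    ∃ y₀ K : ℝ, 1 ≤ K ∧ (∀ y ≥ y₀, DifferentiableAt ℝ b y ∧ 1 < deriv b y) ∧
      MonotoneOn (deriv b) (Set.Ici y₀) ∧
      ∀ y ≥ y₀, deriv b (y + 1) ≤ K * deriv b y := by
  obtain ⟨C, hD⟩ := hD
  have hb' : ∀ᶠ y in atTop, deriv b y ≠ 0 := hD.mono fun y h => h.1
  have h1 : ∀ᶠ y in atTop, deriv b y = (deriv a (b y))⁻¹ := by
    filter_upwards [hb.eventually (deriv_comp_mul_deriv_eventually ha hba ha' hb'), hab]
      with y h1 h2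
    rw [h2] at h1
    exact eq_inv_of_mul_eq_one_left h1
  -- A bound on `deriv (deriv b)` does not give differentiability, since `deriv` is 0 where there is
  -- none. The regularity of b' is read off from the formula and the smoothness of `a`.
  have hd2 : ∀ᶠ y in atTop, DifferentiableAt ℝ (deriv b) y := by
    obtain ⟨y₁, hy₁⟩ := eventually_atTop.1 h1
    filter_upwards [hb', hb.eventually ha', eventually_gt_atTop y₁,
      hb.eventually (eventually_gt_atTop c)] with y h2 h3 h4 h5
    have d1 : DifferentiableAt ℝ (deriv a) (b y) := by
      have h5' : ContDiffOn ℝ (2 + 1) a (Set.Ioi c) := hc.of_le (le_of_eq (by norm_num))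
      have h6 : ContDiffOn ℝ 2 (deriv a) (Set.Ioi c) :=
        ((contDiffOn_succ_iff_deriv_of_isOpen isOpen_Ioi).1 h5').2.2
      exact (h6.contDiffAt (Ioi_mem_nhds h5)).differentiableAt (by norm_num)
    have d2 : DifferentiableAt ℝ (fun y => (deriv a (b y))⁻¹) y :=
      (d1.comp y (differentiableAt_of_deriv_ne_zero h2)).inv h3
    refine d2.congr_of_eventuallyEq ?_
    filter_upwards [lt_mem_nhds h4] with z hz using hy₁ z hz.le
  have habs : Tendsto (fun y => |deriv b y|) atTop atTop := by
    have h2 : Tendsto (fun y => |deriv a (b y)|) atTop (𝓝[>] 0) := by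
      refine tendsto_nhdsWithin_iff.2 ⟨by simpa using (ha0.comp hb).abs, ?_⟩
      filter_upwards [hb.eventually ha'] with y hy using abs_pos.2 hy
    refine h2.inv_tendsto_nhdsGT_zero.congr' ?_
    filter_upwards [h1] with y hy
    simp [hy, abs_inv]
  have hmono : ∃ y₁, MonotoneOn (deriv b) (Set.Ici y₁) ∧ ∀ y ≥ y₁, 1 < deriv b y := by
    obtain ⟨s, hs, hM⟩ := hM
    obtain ⟨y₁, hy₁⟩ := mem_atTop_sets.1 hs
    have hsub : Set.Ici y₁ ⊆ s := hy₁
    rcases hM with hM | hM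
    -- b' stays above b'(y₁) while |b'| exceeds 1 + |b'(y₁)|, which leaves only large positive
    -- values.
    · have hM := hM.mono hsub
      obtain ⟨y₂, hy₂⟩ := eventually_atTop.1
        (habs.eventually (eventually_gt_atTop (1 + |deriv b y₁|)))
      refine ⟨max y₁ y₂, hM.mono (Set.Ici_subset_Ici.2 (le_max_left _ _)), fun y hy => ?_⟩
      have h2 := hy₂ y ((le_max_right _ _).trans hy)
      have h3 : y₁ ≤ y := (le_max_left _ _).trans hy
      have h4 := hM (Set.self_mem_Ici) h3 h3
      rcases abs_cases (deriv b y) with h | h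
      · have := abs_nonneg (deriv b y₁); linarith
      · have := neg_abs_le (deriv b y₁); linarith
    -- In the nonincreasing case the same comparison makes b' negative, so b decreases, against b →
    -- ∞.
    · exfalso
      have hM := hM.mono hsub
      obtain ⟨y₂, hy₂⟩ := eventually_atTop.1
        ((habs.eventually (eventually_gt_atTop (1 + |deriv b y₁|))).and hb')
      have hneg : ∀ y ≥ max y₁ y₂, deriv b y < 0 := fun y hy => by
        have h2 := (hy₂ y ((le_max_right _ _).trans hy)).1
        have h3 : y₁ ≤ y := (le_max_left _ _).trans hy
        have h4 := hM (Set.self_mem_Ici) h3 h3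
        rcases abs_cases (deriv b y) with h | h
        · have := le_abs_self (deriv b y₁); linarith
        · linarith
      have hanti : AntitoneOn b (Set.Ici (max y₁ y₂)) := by
        have hdiff : DifferentiableOn ℝ b (Set.Ici (max y₁ y₂)) := fun y hy =>
          (differentiableAt_of_deriv_ne_zero (hneg y hy).ne).differentiableWithinAt
        refine antitoneOn_of_deriv_nonpos (convex_Ici _) hdiff.continuousOn
          (hdiff.mono interior_subset) fun y hy => (hneg y (interior_subset hy)).le
      obtain ⟨y, hy, hy'⟩ := ((hb.eventually (eventually_gt_atTop (b (max y₁ y₂)))).and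
        (eventually_ge_atTop (max y₁ y₂))).exists
      exact absurd (hanti Set.self_mem_Ici hy' hy') (not_le.2 hy)
  obtain ⟨y₁, hm1, hm2⟩ := hmono
  obtain ⟨y₂, hy₂⟩ := eventually_atTop.1 (hD.and hd2)
  refine ⟨max y₁ y₂, 1 + |C|, by simp, fun y hy => ?_, ?_, fun y hy => ?_⟩
  · exact ⟨differentiableAt_of_deriv_ne_zero (hy₂ y ((le_max_right _ _).trans hy)).1.1,
      hm2 y ((le_max_left _ _).trans hy)⟩
  · exact hm1.mono (Set.Ici_subset_Ici.2 (le_max_left _ _))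
  · have hy2 : y₂ ≤ y := (le_max_right _ _).trans hy
    have hpos : 0 < deriv b y := by linarith [hm2 y ((le_max_left _ _).trans hy)]
    have hdiff : DifferentiableOn ℝ (deriv b) (Set.Icc y (y + 1)) := fun z hz =>
      (hy₂ z (hy2.trans hz.1)).2.differentiableWithinAt
    obtain ⟨ξ, hξ, e⟩ := exists_deriv_eq_slope (deriv b) (show y < y + 1 by linarith)
      hdiff.continuousOn (hdiff.mono Set.Ioo_subset_Icc_self)
    have h3 := (hy₂ y hy2).1.2 (ξ - y) ⟨by linarith [hξ.1], by linarith [hξ.2]⟩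
    rw [add_sub_cancel, abs_div, abs_of_pos hpos, div_le_iff₀ hpos] at h3
    rw [add_sub_cancel_left, div_one] at e
    have h4 := (le_abs_self _).trans h3
    have h5 : C * deriv b y ≤ |C| * deriv b y :=
      mul_le_mul_of_nonneg_right (le_abs_self C) hpos.le
    linarith

/-- The endpoints b(m₀ + k) are the times at which `a` crosses integers. By the mean value theorem
the k-th length lies between b'(m₀ + k) and b'(m₀ + k + 1), which are comparable with each other and
with b'(a(n)) = 1 / a'(n) inside the block. The sequence `s` is only required to satisfy weak
inequalities so that floors of `a` and reflected floors of `-a` both qualify. -/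
theorem exists_isSlowIndex {a b : ℝ → ℝ} {c : ℝ} (ha : Tendsto a atTop atTop)
    (hb : Tendsto b atTop atTop) (hba : ∀ᶠ x in atTop, b (a x) = x)
    (hab : ∀ᶠ y in atTop, a (b y) = y) (hc : ContDiffOn ℝ 3 a (Set.Ioi c))
    (ha' : ∀ᶠ x in atTop, deriv a x ≠ 0) (ha0 : Tendsto (deriv a) atTop (𝓝 0))
    (hM : ∃ s ∈ (atTop : Filter ℝ), MonotoneOn (deriv b) s ∨ AntitoneOn (deriv b) s)
    (hD : ∃ C : ℝ, ∀ᶠ y in atTop, deriv b y ≠ 0 ∧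
      ∀ h ∈ Set.Icc (-1 : ℝ) 1, |deriv (deriv b) (y + h) / deriv b y| ≤ C)
    (hlin : Prec a (fun x => x)) {s : ℕ → ℤ} (hs : ∀ n : ℕ, s n ≤ a n ∧ a n ≤ s n + 1) :
    ∃ (M : ℕ → ℕ) (B : ℕ → ℝ) (n₀ : ℕ) (K : ℝ) (m₀ : ℤ),
      IsSlowIndex (fun n : ℕ => 1 + |1 / deriv a n|) M B n₀ K ∧ ∀ n ≥ n₀, s n = m₀ + M n := by
  obtain ⟨y₀, K, hK, hb1, hb2, hb3⟩ :=
    exists_ray_deriv_inverse ha hb hba hab hc ha' ha0 hM hD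
  have hdiff : DifferentiableOn ℝ b (Set.Ici y₀) := fun y hy =>
    (hb1 y hy).1.differentiableWithinAt
  have hmono : MonotoneOn b (Set.Ici y₀) :=
    monotoneOn_of_deriv_nonneg (convex_Ici _) hdiff.continuousOn (hdiff.mono interior_subset)
      fun y hy => by linarith [(hb1 y (interior_subset hy)).2]
  have hslope : ∀ y ≥ y₀, deriv b y ≤ b (y + 1) - b y ∧ b (y + 1) - b y ≤ deriv b (y + 1) := by
    intro y hy
    have hsub : Set.Icc y (y + 1) ⊆ Set.Ici y₀ := fun z hz => le_trans hy hz.1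
    obtain ⟨ξ, hξ, e⟩ := exists_deriv_eq_slope b (show y < y + 1 by linarith)
      (hdiff.continuousOn.mono hsub) (hdiff.mono (Set.Ioo_subset_Icc_self.trans hsub))
    rw [add_sub_cancel_left, div_one] at e
    rw [← e]
    exact ⟨hb2 hy (hsub ⟨hξ.1.le, hξ.2.le⟩) hξ.1.le,
      hb2 (hsub ⟨hξ.1.le, hξ.2.le⟩) (show y₀ ≤ y + 1 by linarith) hξ.2.le⟩
  set m₀ : ℤ := ⌈y₀⌉
  have hm₀ : y₀ ≤ m₀ := Int.le_ceil y₀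
  have hk : ∀ k : ℕ, y₀ ≤ m₀ + k := fun k => le_add_of_le_of_nonneg hm₀ (Nat.cast_nonneg k)
  have hev : ∀ᶠ n : ℕ in atTop, b (a n) = n ∧ deriv b (a n) * deriv a n = 1 ∧
      (m₀ : ℝ) + 1 ≤ a n := by
    have := hba.and ((deriv_comp_mul_deriv_eventually ha hba ha' (by
      obtain ⟨C, hD⟩ := hD
      exact hD.mono fun y h => h.1)).and (ha.eventually (eventually_ge_atTop ((m₀ : ℝ) + 1))))
    exact tendsto_natCast_atTop_atTop.eventually this
  obtain ⟨n₀, hn₀⟩ := eventually_atTop.1 hev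
  let M : ℕ → ℕ := fun n => (s n - m₀).toNat
  have hMs : ∀ n ≥ n₀, s n = m₀ + M n := fun n hn => by
    have h1 := (hn₀ n hn).2.2
    have h2 := (hs n).2
    have : m₀ ≤ s n := by exact_mod_cast (show (m₀ : ℝ) ≤ s n by linarith)
    simp only [M]
    omega
  have hMs' : ∀ n ≥ n₀, (s n : ℝ) = m₀ + M n := fun n hn => by exact_mod_cast hMs n hn
  have hw : ∀ n ≥ n₀, |1 / deriv a n| = deriv b (a n) := fun n hn => by
    have h1 := (hn₀ n hn).2.1
    have h2 : y₀ ≤ a n := by linarith [(hn₀ n hn).2.2]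
    rw [one_div, ← eq_inv_of_mul_eq_one_left h1, abs_of_pos (by linarith [(hb1 _ h2).2])]
  have hcmp : ∀ n ≥ n₀, deriv b (m₀ + M n) ≤ deriv b (a n) ∧
      deriv b (a n) ≤ deriv b (m₀ + M n + 1) := fun n hn => by
    have h1 := hs n
    rw [hMs' n hn] at h1
    have h2 : y₀ ≤ a n := (hk (M n)).trans h1.1
    exact ⟨hb2 (hk _) h2 h1.1, hb2 h2 (h2.trans h1.2) h1.2⟩
  -- The factor 2 pays for the summand 1 in the weight: 1 < b', hence 1 + b' ≤ 2 b'.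
  refine ⟨M, fun k => b (m₀ + k), n₀, 2 * K, m₀, ?_, hMs⟩
  have hlen : ∀ k : ℕ, deriv b (m₀ + k) ≤ b (m₀ + (k + 1 : ℕ)) - b (m₀ + k) ∧
      b (m₀ + (k + 1 : ℕ)) - b (m₀ + k) ≤ deriv b (m₀ + k + 1) := fun k => by
    have := hslope (m₀ + k) (hk k)
    push_cast
    rwa [← add_assoc]
  constructor
  · intro n; simp
  · positivity
  · intro k; linarith [hlen k, (hb1 _ (hk k)).2]
  · refine monotone_nat_of_le_succ fun k => (hlen k).2.trans ?_
    refine le_trans (le_of_eq ?_) (hlen (k + 1)).1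
    push_cast
    rw [add_assoc]
  · intro n hn
    have h1 := (hs n).1
    rw [hMs' n hn] at h1
    have := hmono (hk (M n)) ((hk (M n)).trans h1) h1
    rwa [(hn₀ n hn).1] at this
  · intro n hn
    have h1 := hs n
    rw [hMs' n hn] at h1
    have h2 : y₀ ≤ a n := (hk (M n)).trans h1.1
    have := hmono h2 (h2.trans h1.2) h1.2
    rw [(hn₀ n hn).1] at this
    push_cast
    rwa [← add_assoc]
  · intro n hn
    have h1 := hb3 _ (hk (M n))
    have h2 := (hb1 _ (hk (M n))).2
    have h3 : K * deriv b (m₀ + M n) ≤ K * (1 + |1 / deriv a n|) := by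
      rw [hw n hn]
      have := (hcmp n hn).1
      gcongr
      linarith
    have h4 : 0 ≤ K * (1 + |1 / deriv a n|) := by positivity
    linarith [(hlen (M n)).2]
  · intro n hn
    have h1 := hb3 _ (hk (M n))
    have h2 := (hb1 _ (show y₀ ≤ m₀ + M n + 1 by linarith [hk (M n)])).2
    have h3 : K * deriv b (m₀ + M n) ≤ K * (b (m₀ + (M n + 1 : ℕ)) - b (m₀ + M n)) :=
      mul_le_mul_of_nonneg_left (hlen (M n)).1 (by linarith)
    rw [hw n hn]
    linarith [(hcmp n hn).2]
  · have h1 : Tendsto (fun n : ℕ => a n / n - m₀ * (1 / (n : ℝ))) atTop (𝓝 0) := by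
      simpa using (hlin.comp tendsto_natCast_atTop_atTop).sub
        ((tendsto_one_div_atTop_nhds_zero_nat (𝕜 := ℝ)).const_mul (m₀ : ℝ))
    refine squeeze_zero' (Eventually.of_forall fun n => by positivity) ?_ h1
    filter_upwards [eventually_ge_atTop n₀] with n hn
    have h2 := (hs n).1
    rw [hMs' n hn] at h2
    rw [mul_one_div, ← sub_div]
    gcongr
    linarith

/-! ### Functions of the class 𝓢 as slow indices. -/

theorem MemS.exists_isSlowIndex {a : ℝ → ℝ} (ha : MemS a) (ha0 : Tendsto (deriv a) atTop (𝓝 0)) :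
    ∃ (M : ℕ → ℕ) (B : ℕ → ℝ) (n₀ : ℕ) (K : ℝ) (m₀ : ℤ),
      IsSlowIndex (fun n : ℕ => 1 + |1 / deriv a n|) M B n₀ K ∧
      ((∀ n ≥ n₀, ⌊a n⌋ = m₀ + M n) ∨ ∀ n ≥ n₀, ⌊a n⌋ = m₀ - M n) := by
  obtain ⟨⟨c, -, hc⟩, hlin, ha', -, b, l, hl, ⟨h1, h2, h3, h4⟩, hM, -, hD, -⟩ := ha
  simp only [CondM, CondD, iteratedDeriv_succ, iteratedDeriv_zero] at hM hD
  rcases hl with rfl | rfl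
  · obtain ⟨M, B, n₀, K, m₀, h, e⟩ := _root_.exists_isSlowIndex h1 h2 h3 h4 hc ha' ha0 hM hD hlin
      (s := fun n => ⌊a n⌋) fun n => ⟨Int.floor_le _, (Int.lt_floor_add_one _).le⟩
    exact ⟨M, B, n₀, K, m₀, h, Or.inl e⟩
  -- If a → -∞, both functions are reflected. Then -⌊a⌋ - 1 ≤ -a ≤ -⌊a⌋, with equality possible on
  -- the right.
  · have d1 : ∀ x, deriv (fun x => -a x) x = -deriv a x := fun x => deriv.fun_neg
    have d2 : deriv (fun y => b (-y)) = fun y => -deriv b (-y) := by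
      ext y; exact deriv_comp_neg (f := b) y
    have d3 : ∀ y, deriv (fun y => -deriv b (-y)) y = deriv (deriv b) (-y) := fun y => by
      rw [deriv.fun_neg, deriv_comp_neg (f := deriv b), neg_neg]
    obtain ⟨M, B, n₀, K, m₀, h, e⟩ := _root_.exists_isSlowIndex (a := fun x => -a x)
      (b := fun y => b (-y)) (c := c) (s := fun n => -⌊a n⌋ - 1)
      (tendsto_neg_atBot_atTop.comp h1) (h2.comp tendsto_neg_atTop_atBot)
      (by simpa using h3)
      (by
        filter_upwards [tendsto_neg_atTop_atBot.eventually h4] with y hy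
        rw [hy, neg_neg])
      hc.neg (by simpa [d1] using ha')
      (by
        have : deriv (fun x => -a x) = fun x => -deriv a x := funext d1
        rw [this]
        simpa using ha0.neg)
      (by
        obtain ⟨s, hs, hM⟩ := hM
        refine ⟨Neg.neg ⁻¹' s, tendsto_neg_atTop_atBot hs, ?_⟩
        rw [d2]
        rcases hM with hM | hM
        · exact Or.inl fun x hx y hy hxy => neg_le_neg (hM hy hx (neg_le_neg hxy))
        · exact Or.inr fun x hx y hy hxy => neg_le_neg (hM hy hx (neg_le_neg hxy)))
      (by
        obtain ⟨C, hD⟩ := hD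
        refine ⟨C, ?_⟩
        filter_upwards [tendsto_neg_atTop_atBot.eventually hD] with y hy
        rw [d2]
        refine ⟨neg_ne_zero.2 hy.1, fun h hh => ?_⟩
        have := hy.2 (-h) ⟨by linarith [hh.2], by linarith [hh.1]⟩
        rwa [d3, div_neg, abs_neg, neg_add])
      (by
        have := Tendsto.neg hlin
        simp only [neg_zero] at this
        exact this.congr fun x => by ring)
      (fun n => by
        push_cast
        constructor <;> linarith [Int.floor_le (a n), Int.lt_floor_add_one (a n)])
    refine ⟨M, B, n₀, K, -1 - m₀, ?_, Or.inr fun n hn => by have := e n hn; omega⟩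
    convert h using 3 with n
    simp only [d1, div_neg, abs_neg]

theorem MemS.sum_jumps_le {a : ℝ → ℝ} (ha : MemS a) (ha0 : Tendsto (deriv a) atTop (𝓝 0)) :
    ∃ K C : ℝ, 0 ≤ K ∧ 0 ≤ C ∧ ∀ N : ℕ, ∑ n ∈ Finset.range N, (1 + |1 / deriv a n|) *
      (if ⌊a (n + 1 : ℕ)⌋ = ⌊a n⌋ then 0 else 1) ≤ K * N + C := by
  obtain ⟨M, B, n₀, K, m₀, h, e⟩ := ha.exists_isSlowIndex ha0
  obtain ⟨C, hC, hs⟩ := h.sum_jumps_le'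
  refine ⟨K, C + ∑ n ∈ Finset.range n₀, (1 + |1 / deriv a n|), h.const_nonneg,
    by positivity, fun N => ?_⟩
  have h1 : ∀ n : ℕ, (1 + |1 / deriv a n|) * (if ⌊a (n + 1 : ℕ)⌋ = ⌊a n⌋ then (0 : ℝ) else 1) ≤
      (1 + |1 / deriv a n|) * (if M (n + 1) = M n then 0 else 1) +
        if n < n₀ then (1 + |1 / deriv a n|) else 0 := fun n => by
    have hw : 0 ≤ (1 + |1 / deriv a n|) := by positivity
    by_cases hn : n < n₀
    · rw [if_pos hn]
      split_ifs <;> simp <;> positivity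
    · rw [if_neg hn, add_zero]
      have : ⌊a (n + 1 : ℕ)⌋ = ⌊a n⌋ ↔ M (n + 1) = M n := by
        rcases e with e | e <;> rw [e n (by omega), e (n + 1) (by omega)] <;> omega
      simp only [this, le_refl]
  have h2 : ∑ n ∈ Finset.range N, (if n < n₀ then (1 + |1 / deriv a n|) else 0) ≤
      ∑ n ∈ Finset.range n₀, (1 + |1 / deriv a n|) := by
    rw [← Finset.sum_filter]
    exact Finset.sum_le_sum_of_subset_of_nonneg (fun n hn => by simp at hn ⊢; exact hn.2)
      fun n _ _ => by positivity
  calc _ ≤ _ := Finset.sum_le_sum fun n _ => h1 n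
    _ ≤ _ := by rw [Finset.sum_add_distrib]; linarith [hs N]

theorem MemS.wnull_coboundary {a : ℝ → ℝ} (ha : MemS a) (ha0 : Tendsto (deriv a) atTop (𝓝 0))
    {g : ℤ → ℂ} {R : ℝ} (hg : ∀ m, ‖g m‖ ≤ R) :
    WNull (fun n : ℕ => 1 + |1 / deriv a n|) (fun n => g ⌊a n⌋ - g (⌊a n⌋ + 1)) := by
  obtain ⟨M, B, n₀, K, m₀, h, e⟩ := ha.exists_isSlowIndex ha0
  have hR : 0 ≤ R := (norm_nonneg _).trans (hg 0)
  have key : ∀ g' : ℕ → ℂ, (∀ k, ‖g' k‖ ≤ R) →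
      (∀ n ≥ n₀, g ⌊a n⌋ - g (⌊a n⌋ + 1) = g' (M n) - g' (M n + 1)) →
      WNull (fun n : ℕ => 1 + |1 / deriv a n|) (fun n => g ⌊a n⌋ - g (⌊a n⌋ + 1)) := by
    intro g' hg' hgg'
    refine WNull.of_approx (fun n => by positivity) fun ε hε =>
      ⟨_, h.wnull_coboundary hg', h.cesaroLE_of_jumps (D := 4 * R) (by positivity) (fun n => ?_) hε⟩
    by_cases hn : n < n₀
    · rw [if_pos (Or.inl hn), mul_one]
      refine (norm_sub_le _ _).trans
        ((add_le_add (norm_sub_le _ _) (norm_sub_le _ _)).trans ?_)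
      linarith [hg ⌊a n⌋, hg (⌊a n⌋ + 1), hg' (M n), hg' (M n + 1)]
    · rw [hgg' n (by omega), sub_self, norm_zero]
      positivity
  rcases e with e | e
  · refine key (fun k => g (m₀ + k)) (fun k => hg _) fun n hn => ?_
    rw [e n hn]
    push_cast
    rw [add_assoc]
  -- For a decreasing index the sign and the shift by one turn the coboundary in `m` into one in
  -- `k`.
  · refine key (fun k => -g (m₀ - k + 1)) (fun k => by simpa using hg _) fun n hn => ?_
    rw [e n hn]
    push_cast
    rw [show m₀ - ((M n : ℤ) + 1) + 1 = m₀ - M n by ring]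
    ring

/-! ### Integer iterates and invariant functions. -/

section ZIter

variable {X : Type*} [MeasurableSpace X] (T : X ≃ᵐ X)

theorem zIter_zero (x : X) : zIter T 0 x = x := by simp [zIter]

theorem zIter_one (x : X) : zIter T 1 x = T x := by simp [zIter]

theorem zIter_add (m n : ℤ) (x : X) : zIter T (m + n) x = zIter T m (zIter T n x) := by
  simp only [zIter, zpow_add, Equiv.Perm.coe_mul, Function.comp_apply]

theorem zIter_succ (m : ℤ) (x : X) : zIter T (m + 1) x = T (zIter T m x) := by
  rw [add_comm, zIter_add, zIter_one]

theorem zIter_neg_zIter (m : ℤ) (x : X) : zIter T (-m) (zIter T m x) = x := by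
  rw [← zIter_add, neg_add_cancel, zIter_zero]

theorem zIter_zIter_neg (m : ℤ) (x : X) : zIter T m (zIter T (-m) x) = x := by
  rw [← zIter_add, add_neg_cancel, zIter_zero]

theorem zIter_neg_one (x : X) : zIter T (-1) x = T.symm x := by
  apply T.injective
  rw [← zIter_succ, T.apply_symm_apply, neg_add_cancel, zIter_zero]

theorem zIter_natCast (n : ℕ) : zIter T n = T^[n] := by
  induction n with
  | zero => ext x; simp [zIter_zero]
  | succ n ih =>
    ext x
    rw [Nat.cast_succ, zIter_succ, ih, Function.iterate_succ_apply']

theorem measurable_zIter (m : ℤ) : Measurable (zIter T m) := by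
  induction m with
  | zero =>
    have : zIter T 0 = id := funext (zIter_zero T)
    rw [this]; exact measurable_id
  | succ n ih =>
    have : zIter T (n + 1) = T ∘ zIter T n := funext (zIter_succ T n)
    rw [this]; exact T.measurable.comp ih
  | pred n ih =>
    have : zIter T (-(n : ℤ) - 1) = T.symm ∘ zIter T (-(n : ℤ)) := funext fun x => by
      rw [Function.comp_apply, ← zIter_neg_one, ← zIter_add]
      congr 1; ring
    rw [this]; exact T.symm.measurable.comp ih

/-- The iterate `T ^ m` as a measurable equivalence. -/
def zIterEquiv (m : ℤ) : X ≃ᵐ X where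
  toFun := zIter T m
  invFun := zIter T (-m)
  left_inv := zIter_neg_zIter T m
  right_inv := zIter_zIter_neg T m
  measurable_toFun := measurable_zIter T m
  measurable_invFun := measurable_zIter T (-m)

@[simp] theorem coe_zIterEquiv (m : ℤ) : ⇑(zIterEquiv T m) = zIter T m := rfl

theorem zIter_zIterEquiv (p m : ℤ) (x : X) : zIter (zIterEquiv T p) m x = zIter T (p * m) x := by
  induction m with
  | zero => simp [zIter_zero]
  | succ n ih =>
    rw [zIter_succ, ih, coe_zIterEquiv, ← zIter_add]; congr 1; ring
  | pred n ih =>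
    have h := zIter_succ (zIterEquiv T p) (-(n : ℤ) - 1) x
    rw [sub_add_cancel, ih, coe_zIterEquiv] at h
    rw [← zIter_neg_zIter T p (zIter (zIterEquiv T p) (-(n : ℤ) - 1) x), ← h, ← zIter_add]
    congr 1; ring

theorem zIter_symm (m : ℤ) (x : X) : zIter T.symm m x = zIter T (-m) x := by
  have : zIterEquiv T (-1) = T.symm := by
    ext x; exact zIter_neg_one T x
  rw [← this, zIter_zIterEquiv]; congr 1; ring

variable {μ : Measure X} {T}

theorem measurePreserving_zIter (hT : MeasurePreserving T μ μ) (m : ℤ) :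
    MeasurePreserving (zIter T m) μ μ := by
  induction m with
  | zero =>
    have : zIter T 0 = id := funext (zIter_zero T)
    rw [this]; exact MeasurePreserving.id μ
  | succ n ih =>
    have : zIter T (n + 1) = T ∘ zIter T n := funext (zIter_succ T n)
    rw [this]; exact hT.comp ih
  | pred n ih =>
    have : zIter T (-(n : ℤ) - 1) = T.symm ∘ zIter T (-(n : ℤ)) := funext fun x => by
      rw [Function.comp_apply, ← zIter_neg_one, ← zIter_add]
      congr 1; ring
    rw [this]; exact (hT.symm T).comp ih

theorem ae_forall_zIter (hT : MeasurePreserving T μ μ) {p : X → Prop} (hp : ∀ᵐ x ∂μ, p x) :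
    ∀ᵐ x ∂μ, ∀ m : ℤ, p (zIter T m x) :=
  ae_all_iff.2 fun m => (measurePreserving_zIter hT m).quasiMeasurePreserving.ae hp

theorem measurePreserving_zIterEquiv (hT : MeasurePreserving T μ μ) (m : ℤ) :
    MeasurePreserving (zIterEquiv T m) μ μ := measurePreserving_zIter hT m

/-- A function which is almost everywhere equal to its translate is measurable with respect to the
invariant sets, up to a null set. -/
theorem aestronglyMeasurable_invariants (hT : MeasurePreserving T μ μ) {h : X → ℂ}
    (hh : AEStronglyMeasurable h μ) (hinv : ∀ᵐ x ∂μ, h (T x) = h x) :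
    AEStronglyMeasurable[MeasurableSpace.invariants T] h μ := by
  classical
  let h' := hh.mk h
  have hm : Measurable h' := hh.stronglyMeasurable_mk.measurable
  have e : ∀ᵐ x ∂μ, h x = h' x := hh.ae_eq_mk
  -- On this set the measurable version is constant along whole two-sided orbits. The set is
  -- strictly invariant, so cutting off outside it gives an exactly invariant function.
  let A : Set X := {x | ∀ m : ℤ, h' (zIter T m x) = h' x}
  have hA : MeasurableSet A := by
    have : A = ⋂ m : ℤ, {x | h' (zIter T m x) = h' x} := by ext; simp [A]
    rw [this]
    exact MeasurableSet.iInter fun m =>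
      measurableSet_eq_fun (hm.comp (measurable_zIter T m)) hm
  have hinv' : ∀ᵐ x ∂μ, h' (T x) = h' x := by
    filter_upwards [hinv, e, hT.quasiMeasurePreserving.ae e] with x h1 h2 h3
    rw [← h2, ← h3, h1]
  have hAe : ∀ᵐ x ∂μ, x ∈ A := by
    filter_upwards [ae_forall_zIter hT hinv'] with x hx m
    induction m with
    | zero => rw [zIter_zero]
    | succ n ih => rw [zIter_succ, hx, ih]
    | pred n ih =>
      rw [← ih, ← hx (-(n : ℤ) - 1), ← zIter_succ, sub_add_cancel]
  have hTA : ∀ x, T x ∈ A ↔ x ∈ A := by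
    intro x
    constructor
    · intro hx m
      have h1 := hx (m - 1)
      have h2 := hx (-1)
      rw [← zIter_one T x, ← zIter_add] at h1 h2
      rw [sub_add_cancel] at h1
      rw [neg_add_cancel, zIter_zero] at h2
      rw [h1, h2]
    · intro hx m
      rw [← zIter_one T x, ← zIter_add, hx, hx]
  refine ⟨A.indicator h', ?_, ?_⟩
  · have h1 : Measurable (A.indicator h') := hm.indicator hA
    have h2 : A.indicator h' ∘ T = A.indicator h' := by
      ext x
      simp only [Function.comp_apply, Set.indicator_apply, hTA]
      split_ifs with hx
      · rw [← zIter_one T x]; exact hx 1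
      · rfl
    have h3 : Measurable[MeasurableSpace.invariants T] (A.indicator h') :=
      MeasurableSpace.measurable_invariants_dom.2 ⟨h1, fun s _ => by rw [h2]⟩
    exact h3.stronglyMeasurable
  · filter_upwards [e, hAe] with x h1 h2
    rw [Set.indicator_of_mem h2, h1]

end ZIter

/-! ### The maximal ergodic inequality. -/

section Maximal

variable {X : Type*}

/-- The maximum of `0` and the first `N` Birkhoff sums of `φ`. -/
noncomputable def maxBirkhoff (T : X → X) (φ : X → ℝ) : ℕ → X → ℝ
  | 0 => fun _ => 0
  | N + 1 => fun x => max 0 (φ x + maxBirkhoff T φ N (T x))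

theorem maxBirkhoff_nonneg (T : X → X) (φ : X → ℝ) (N : ℕ) (x : X) : 0 ≤ maxBirkhoff T φ N x := by
  cases N with
  | zero => exact le_rfl
  | succ N => exact le_max_left _ _

theorem maxBirkhoff_le_succ (T : X → X) (φ : X → ℝ) (N : ℕ) (x : X) :
    maxBirkhoff T φ N x ≤ maxBirkhoff T φ (N + 1) x := by
  induction N generalizing x with
  | zero => exact maxBirkhoff_nonneg T φ 1 x
  | succ N ih => exact max_le_max le_rfl (add_le_add le_rfl (ih (T x)))

theorem sum_le_maxBirkhoff (T : X → X) (φ : X → ℝ) (N : ℕ) (x : X) :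
    ∑ n ∈ Finset.range N, φ (T^[n] x) ≤ maxBirkhoff T φ N x := by
  induction N generalizing x with
  | zero => simp [maxBirkhoff]
  | succ N ih =>
    rw [Finset.sum_range_succ']
    refine le_trans ?_ (le_max_right _ _)
    have := ih (T x)
    simp only [Function.iterate_succ_apply, Function.iterate_zero, id] at this ⊢
    linarith

variable [MeasurableSpace X] {μ : Measure X}

theorem measurable_maxBirkhoff {T : X → X} (hT : Measurable T) {φ : X → ℝ} (hφ : Measurable φ)
    (N : ℕ) : Measurable (maxBirkhoff T φ N) := by
  induction N with
  | zero => exact measurable_const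
  | succ N ih => exact measurable_const.max (hφ.add (ih.comp hT))

theorem integrable_maxBirkhoff {T : X → X} (hT : MeasurePreserving T μ μ) {φ : X → ℝ}
    (hφ : Integrable φ μ) (N : ℕ) : Integrable (maxBirkhoff T φ N) μ := by
  induction N with
  | zero => exact integrable_zero X ℝ μ
  | succ N ih =>
    exact (integrable_zero X ℝ μ).sup (hφ.add (hT.integrable_comp_of_integrable ih))

/-- Garsia's argument: where F = `maxBirkhoff T φ N` is positive, F ≤ φ + F∘T. Integrating over that
set, F keeps its full integral, F∘T contributes at most its own, and the two full integrals agree.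
-/
theorem setIntegral_nonneg_of_maxBirkhoff {T : X → X} (hT : MeasurePreserving T μ μ) {φ : X → ℝ}
    (hφ : Integrable φ μ) (hφm : Measurable φ) (N : ℕ) :
    0 ≤ ∫ x in {x | 0 < maxBirkhoff T φ N x}, φ x ∂μ := by
  set F := maxBirkhoff T φ N
  set A := {x | 0 < F x}
  have hFm : Measurable F := measurable_maxBirkhoff hT.measurable hφm N
  have hA : MeasurableSet A := measurableSet_lt measurable_const hFm
  have hF : Integrable F μ := integrable_maxBirkhoff hT hφ N
  have hFT : Integrable (fun x => F (T x)) μ := hT.integrable_comp_of_integrable hF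
  have h1 : ∀ x ∈ A, F x - F (T x) ≤ φ x := by
    intro x hx
    cases N with
    | zero => exact (lt_irrefl (0 : ℝ) hx).elim
    | succ N =>
      have h2 : F x = max 0 (φ x + maxBirkhoff T φ N (T x)) := rfl
      have h3 : 0 < F x := hx
      have h4 := maxBirkhoff_le_succ T φ N (T x)
      rcases max_cases 0 (φ x + maxBirkhoff T φ N (T x)) with h | h
      · linarith
      · show F x - maxBirkhoff T φ (N + 1) (T x) ≤ φ x
        linarith
  have h2 : ∫ x in A, F x ∂μ = ∫ x, F x ∂μ := by
    refine setIntegral_eq_integral_of_forall_compl_eq_zero fun x hx => ?_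
    exact le_antisymm (not_lt.1 hx) (maxBirkhoff_nonneg T φ N x)
  have h3 : ∫ x in A, F (T x) ∂μ ≤ ∫ x, F (T x) ∂μ :=
    setIntegral_le_integral hFT (Eventually.of_forall fun x => maxBirkhoff_nonneg T φ N _)
  have h4 : ∫ x, F (T x) ∂μ = ∫ x, F x ∂μ := by
    conv_rhs => rw [← hT.map_eq]
    rw [integral_map hT.measurable.aemeasurable hFm.aestronglyMeasurable]
  calc 0 ≤ ∫ x in A, (F x - F (T x)) ∂μ := by
        rw [integral_sub hF.integrableOn hFT.integrableOn]; linarith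
    _ ≤ ∫ x in A, φ x ∂μ := setIntegral_mono_on (hF.integrableOn.sub hFT.integrableOn)
        hφ.integrableOn hA h1

/-- The maximal ergodic inequality. -/
theorem maximal_ergodic [IsFiniteMeasure μ] {T : X → X} (hT : MeasurePreserving T μ μ) {h : X → ℝ}
    (hi : Integrable h μ) (hm : Measurable h) (h0 : ∀ x, 0 ≤ h x) {t : ℝ} (ht : 0 < t) :
    μ {x | ∃ N : ℕ, t * N < ∑ n ∈ Finset.range N, h (T^[n] x)} ≤
      ENNReal.ofReal ((∫ x, h x ∂μ) / t) := by
  set φ : X → ℝ := fun x => h x - t with hφ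
  have hφi : Integrable φ μ := hi.sub (integrable_const t)
  have hφm : Measurable φ := hm.sub_const t
  let A : ℕ → Set X := fun N => {x | 0 < maxBirkhoff T φ N x}
  have hA : ∀ N, MeasurableSet (A N) := fun N =>
    measurableSet_lt measurable_const (measurable_maxBirkhoff hT.measurable hφm N)
  have hsub : {x | ∃ N : ℕ, t * N < ∑ n ∈ Finset.range N, h (T^[n] x)} ⊆ ⋃ N, A N := by
    rintro x ⟨N, hN⟩
    refine Set.mem_iUnion.2 ⟨N, lt_of_lt_of_le ?_ (sum_le_maxBirkhoff T φ N x)⟩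
    simp only [hφ, Finset.sum_sub_distrib, Finset.sum_const, Finset.card_range, nsmul_eq_mul]
    linarith
  have hmono : Monotone A := monotone_nat_of_le_succ fun N x hx =>
    lt_of_lt_of_le hx (maxBirkhoff_le_succ T φ N x)
  refine (measure_mono hsub).trans ?_
  rw [hmono.measure_iUnion]
  refine iSup_le fun N => ?_
  have h1 := setIntegral_nonneg_of_maxBirkhoff hT hφi hφm N
  have h2 : ∫ x in A N, φ x ∂μ = ∫ x in A N, h x ∂μ - μ.real (A N) * t := by
    rw [hφ, integral_sub hi.integrableOn (integrable_const t).integrableOn]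
    simp
  have h3 : ∫ x in A N, h x ∂μ ≤ ∫ x, h x ∂μ :=
    setIntegral_le_integral hi (Eventually.of_forall h0)
  rw [← ENNReal.ofReal_toReal (measure_ne_top μ (A N))]
  refine ENNReal.ofReal_le_ofReal ?_
  rw [le_div_iff₀ ht]
  change μ.real (A N) * t ≤ _
  have h1' : 0 ≤ ∫ x in A N, φ x ∂μ := h1
  linarith

end Maximal

/-! ### Sequences with bounded partial sums up to small Cesàro errors. -/

theorem CesaroLE.of_summable_bound {v : ℕ → ℂ} {C ε : ℝ} (hε : 0 ≤ ε)
    (h : ∀ N : ℕ, ∑ n ∈ Finset.range N, ‖v n‖ ≤ C) : CesaroLE v ε :=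
  ⟨C, by simpa using h 0, fun N => (h N).trans (le_add_of_nonneg_left (by positivity))⟩

/-- Up to a sequence of small Cesàro means, the partial sums of `v` are bounded. -/
def BNull (v : ℕ → ℂ) : Prop :=
  ∀ ε : ℝ, 0 < ε → ∃ e : ℕ → ℂ, CesaroLE e ε ∧
    ∃ K : ℝ, ∀ N : ℕ, ‖∑ n ∈ Finset.range N, (v n - e n)‖ ≤ K

namespace BNull

variable {v v' : ℕ → ℂ}

theorem of_bounded {K : ℝ} (h : ∀ N : ℕ, ‖∑ n ∈ Finset.range N, v n‖ ≤ K) : BNull v :=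
  fun _ hε => ⟨fun _ => 0, .of_summable_bound (C := 0) hε.le (by simp), K, by simpa using h⟩

theorem zero : BNull fun _ => 0 := of_bounded (K := 0) (by simp)

theorem add (h : BNull v) (h' : BNull v') : BNull fun n => v n + v' n := by
  intro ε hε
  obtain ⟨e, he, K, hK⟩ := h (ε / 2) (by positivity)
  obtain ⟨e', he', K', hK'⟩ := h' (ε / 2) (by positivity)
  refine ⟨fun n => e n + e' n, (he.add he').mono (by linarith), K + K', fun N => ?_⟩
  have : ∑ n ∈ Finset.range N, (v n + v' n - (e n + e' n)) =
      ∑ n ∈ Finset.range N, (v n - e n) + ∑ n ∈ Finset.range N, (v' n - e' n) := by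
    rw [← Finset.sum_add_distrib]; exact Finset.sum_congr rfl fun n _ => by ring
  rw [this]
  exact (norm_add_le _ _).trans (add_le_add (hK N) (hK' N))

theorem const_mul (h : BNull v) (a : ℂ) : BNull fun n => a * v n := by
  intro ε hε
  obtain ⟨e, ⟨C, hC, he⟩, K, hK⟩ := h (ε / (‖a‖ + 1)) (by positivity)
  refine ⟨fun n => a * e n, ⟨‖a‖ * C, by positivity, fun N => ?_⟩, ‖a‖ * K, fun N => ?_⟩
  · simp only [norm_mul]
    rw [← Finset.mul_sum]
    have h1 : ‖a‖ * (ε / (‖a‖ + 1)) ≤ ε := by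
      rw [mul_div_assoc', div_le_iff₀ (by positivity)]
      nlinarith [norm_nonneg a]
    calc _ ≤ ‖a‖ * (ε / (‖a‖ + 1) * N + C) := by gcongr; exact he N
      _ = ‖a‖ * (ε / (‖a‖ + 1)) * N + ‖a‖ * C := by ring
      _ ≤ _ := by gcongr
  · simp only [← mul_sub]
    rw [← Finset.mul_sum, norm_mul]
    gcongr
    exact hK N

theorem sum {ι : Type*} (s : Finset ι) {v : ι → ℕ → ℂ} (h : ∀ i ∈ s, BNull (v i)) :
    BNull fun n => ∑ i ∈ s, v i n := by
  classical
  induction s using Finset.induction_on with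
  | empty => simpa using zero
  | insert i s hi ih =>
    simp only [Finset.sum_insert hi]
    exact (h i (Finset.mem_insert_self _ _)).add (ih fun j hj => h j (Finset.mem_insert_of_mem hj))

theorem of_approx (h : ∀ ε : ℝ, 0 < ε → ∃ v' : ℕ → ℂ, BNull v' ∧
    CesaroLE (fun n => v n - v' n) ε) : BNull v := by
  intro ε hε
  obtain ⟨v', h1, h2⟩ := h (ε / 2) (by positivity)
  obtain ⟨e, he, K, hK⟩ := h1 (ε / 2) (by positivity)
  refine ⟨fun n => e n + (v n - v' n), (he.add h2).mono (by linarith), K, fun N => ?_⟩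
  convert hK N using 3
  ring

theorem of_eventuallyEq (h : BNull v) (he : ∀ᶠ n in atTop, v' n = v n) : BNull v' := by
  obtain ⟨n₀, hn₀⟩ := eventually_atTop.1 he
  refine of_approx fun ε hε => ⟨v, h, .of_summable_bound
    (C := ∑ n ∈ Finset.range n₀, ‖v' n - v n‖) hε.le fun N => ?_⟩
  rcases le_total n₀ N with hN | hN
  · rw [← Finset.sum_range_add_sum_Ico _ hN, Finset.sum_eq_zero (s := Finset.Ico n₀ N), add_zero]
    intro n hn
    rw [hn₀ n (Finset.mem_Ico.1 hn).1, sub_self, norm_zero]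
  · exact Finset.sum_le_sum_of_subset_of_nonneg (Finset.range_mono hN) fun _ _ _ => norm_nonneg _

theorem shift (h : BNull v) : BNull fun n => v (n + 1) := by
  intro ε hε
  obtain ⟨e, ⟨C, hC, he⟩, K, hK⟩ := h ε hε
  refine ⟨fun n => e (n + 1), ⟨ε + C, by positivity, fun N => ?_⟩, K + ‖v 0 - e 0‖, fun N => ?_⟩
  · have h1 := he (N + 1)
    rw [Finset.sum_range_succ'] at h1
    push_cast at h1
    linarith [norm_nonneg (e 0)]
  · have h1 := hK (N + 1)
    rw [Finset.sum_range_succ'] at h1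
    have h2 := norm_sub_le (∑ n ∈ Finset.range N, (v (n + 1) - e (n + 1)) + (v 0 - e 0)) (v 0 - e 0)
    rw [add_sub_cancel_right] at h2
    linarith

/-- Once the error is removed, a bounded primitive is in particular bounded by a multiple of any
weight `w ≥ 1`. -/
theorem wnull (h : BNull v) {w : ℕ → ℝ} (hw : ∀ n, 1 ≤ w n) : WNull w v := by
  have hw0 : ∀ n, 0 ≤ w n := fun n => zero_le_one.trans (hw n)
  refine WNull.of_approx hw0 fun ε hε => ?_
  obtain ⟨e, he, K, hK⟩ := h ε hε
  have hK0 : 0 ≤ K := (norm_nonneg _).trans (hK 0)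
  refine ⟨fun n => v n - e n, ?_, by simpa using he⟩
  have h1 : ∀ n, K ≤ K * w n := fun n => le_mul_of_one_le_right hK0 (hw n)
  have h2 := WNull.of_primitive hw0 hK0 (V := fun n => ∑ i ∈ Finset.range n, (v i - e i))
    (fun n => (hK n).trans (h1 n)) (fun n => (hK (n + 1)).trans (h1 n))
  simpa only [Finset.sum_range_succ, add_sub_cancel_left] using h2

/-- Summing along one residue class visits an initial segment of `F`, so bounds for all partial sums
carry over. -/
theorem sum_ite_mod_eq {E : Type*} [AddCommMonoid E] {q j : ℕ} (hj : j < q) (F : ℕ → E) (N : ℕ) :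
    ∑ n ∈ Finset.range N, (if n % q = j then F (n / q) else 0) =
      ∑ m ∈ Finset.range (N / q + if j < N % q then 1 else 0), F m := by
  induction N with
  | zero => simp
  | succ N ih =>
    rw [Finset.sum_range_succ, ih]
    have hq : 0 < q := by omega
    have hr := Nat.mod_lt N hq
    have hN := Nat.div_add_mod N q
    by_cases h : N % q + 1 = q
    · have h1 : (N + 1) / q = N / q + 1 := by
        have : N + 1 = q * (N / q + 1) := by rw [mul_add]; omega
        rw [this, Nat.mul_div_cancel_left _ hq]
      have h2 : (N + 1) % q = 0 := by
        have : N + 1 = q * (N / q + 1) := by rw [mul_add]; omega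
        rw [this, Nat.mul_mod_right]
      rw [h1, h2, if_neg (Nat.not_lt_zero j), add_zero]
      by_cases h3 : N % q = j
      · rw [if_pos h3, if_neg (by omega), add_zero, Finset.sum_range_succ]
      · rw [if_neg h3, if_pos (by omega), add_zero]
    · have h0 : N + 1 = N % q + 1 + q * (N / q) := by omega
      have h1 : (N + 1) / q = N / q := by
        rw [h0, Nat.add_mul_div_left _ _ hq, Nat.div_eq_of_lt (by omega), zero_add]
      have h2 : (N + 1) % q = N % q + 1 := by
        rw [h0, Nat.add_mul_mod_self_left, Nat.mod_eq_of_lt (by omega)]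
      rw [h1, h2]
      by_cases h3 : N % q = j
      · rw [if_pos h3, if_neg (by omega), if_pos (by omega), add_zero, Finset.sum_range_succ]
      · rw [if_neg h3, add_zero]
        have : j < N % q ↔ j < N % q + 1 := by omega
        simp only [this]

theorem abs_count_mod_sub_le {q j : ℕ} (hq : 0 < q) (N : ℕ) :
    |((N / q + if j < N % q then 1 else 0 : ℕ) : ℝ) - N / q| ≤ 1 := by
  have hN : (q : ℝ) * (N / q : ℕ) + (N % q : ℕ) = N := by exact_mod_cast Nat.div_add_mod N q
  have hr : ((N % q : ℕ) : ℝ) ≤ q := by exact_mod_cast (Nat.mod_lt N hq).le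
  have hq' : (0 : ℝ) < q := by exact_mod_cast hq
  have h1 : (N : ℝ) / q = (N / q : ℕ) + (N % q : ℕ) / q := by
    rw [← hN]; field_simp
  have h2 : ((N % q : ℕ) : ℝ) / q ≤ 1 := (div_le_one hq').2 hr
  have h3 : 0 ≤ ((N % q : ℕ) : ℝ) / q := by positivity
  rw [h1, abs_le]
  split_ifs <;> push_cast <;> constructor <;> linarith

theorem ite_mod (h : BNull v) {q j : ℕ} (hj : j < q) :
    BNull fun n => if n % q = j then v (n / q) else 0 := by
  have hq : 0 < q := by omega
  intro ε hε
  obtain ⟨e, ⟨C, hC, he⟩, K, hK⟩ := h ε hε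
  refine ⟨fun n => if n % q = j then e (n / q) else 0, ⟨ε + C, by positivity, fun N => ?_⟩, K,
    fun N => ?_⟩
  · have h1 : ∀ n, ‖if n % q = j then e (n / q) else 0‖ = if n % q = j then ‖e (n / q)‖ else 0 :=
      fun n => by split_ifs <;> simp
    simp only [h1]
    rw [sum_ite_mod_eq hj fun m => ‖e m‖]
    refine (he _).trans ?_
    have h2 : (N / q + if j < N % q then 1 else 0 : ℕ) ≤ N + 1 :=
      add_le_add (Nat.div_le_self _ _) (by split_ifs <;> simp)
    have h3 : ((N / q + if j < N % q then 1 else 0 : ℕ) : ℝ) ≤ N + 1 := by exact_mod_cast h2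
    nlinarith
  · have h1 : ∀ n, ((if n % q = j then v (n / q) else 0) - if n % q = j then e (n / q) else 0) =
        if n % q = j then v (n / q) - e (n / q) else 0 := fun n => by split_ifs <;> simp
    simp only [h1]
    rw [sum_ite_mod_eq hj fun m => v m - e m]
    exact hK _

theorem ite_mod_const {q j : ℕ} (hj : j < q) (L : ℂ) :
    BNull fun n => (if n % q = j then L else 0) - 1 / q * L := by
  have hq : 0 < q := by omega
  refine of_bounded (K := ‖L‖) fun N => ?_
  rw [Finset.sum_sub_distrib, sum_ite_mod_eq hj fun _ => L]
  simp only [Finset.sum_const, Finset.card_range, nsmul_eq_mul]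
  have h1 := abs_count_mod_sub_le (j := j) hq N
  set c := (N / q + if j < N % q then 1 else 0 : ℕ)
  have h2 : (c : ℂ) * L - N * (1 / q * L) = (((c : ℝ) - N / q : ℝ) : ℂ) * L := by
    push_cast; ring
  rw [h2, norm_mul, Complex.norm_real]
  exact mul_le_of_le_one_left (norm_nonneg _) h1

/-- A sequence is null up to the mean of the limits along the residue classes. -/
theorem of_mod {q : ℕ} (hq : 0 < q) {u : ℕ → ℂ} {v : ℕ → ℕ → ℂ} {L : ℕ → ℂ}
    (hu : ∀ m, ∀ j < q, u (q * m + j) = v j m) (hv : ∀ j < q, BNull fun m => v j m - L j) :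
    BNull fun n => u n - 1 / q * ∑ j ∈ Finset.range q, L j := by
  have h1 := (sum (Finset.range q) fun j hj => (hv j (Finset.mem_range.1 hj)).ite_mod
    (Finset.mem_range.1 hj)).add
    (sum (Finset.range q) fun j hj => ite_mod_const (Finset.mem_range.1 hj) (L j))
  refine h1.of_eventuallyEq (Eventually.of_forall fun n => ?_)
  have hn := Nat.mod_lt n hq
  rw [Finset.sum_sub_distrib, Finset.sum_ite_eq, Finset.sum_ite_eq,
    if_pos (Finset.mem_range.2 hn), if_pos (Finset.mem_range.2 hn), ← Finset.mul_sum,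
    ← hu _ _ hn, Nat.div_add_mod]
  ring

end BNull

/-! ### Eigenspace projections and the twisted ergodic theorem. -/

/-- Von Neumann: if y is orthogonal to the range of 1 - U, then ⟨Uy, y⟩ = ‖y‖² although ‖Uy‖ ≤ ‖y‖,
which forces Uy = y. Thus the orthogonal complement of the range lies in `S`; then pass to
complements. -/
theorem sub_starProjection_mem_closure_range {E : Type*} [NormedAddCommGroup E]
    [InnerProductSpace ℂ E] [CompleteSpace E] (U : E →L[ℂ] E) (hU : ∀ x, ‖U x‖ ≤ ‖x‖)
    (S : Submodule ℂ E) [S.HasOrthogonalProjection] (hS : ∀ x, x ∈ S ↔ U x = x) (x : E) :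
    x - S.starProjection x ∈ closure (Set.range fun y => y - U y) := by
  let R : Submodule ℂ E := (ContinuousLinearMap.id ℂ E - U).range
  have hR : (R : Set E) = Set.range fun y => y - U y := by ext; simp [R]
  have h1 : Rᗮ ≤ S := fun y hy => by
    rw [hS]
    refine eq_of_norm_le_re_inner_eq_norm_sq (𝕜 := ℂ) (hU y) ?_
    have h2 : inner ℂ (y - U y) y = 0 :=
      (Submodule.mem_orthogonal _ _).1 hy _ ⟨y, by simp⟩
    rw [inner_sub_left, sub_eq_zero] at h2
    rw [← h2, inner_self_eq_norm_sq]
  have h3 : x - S.starProjection x ∈ Rᗮᗮ :=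
    Submodule.orthogonal_le h1 (S.sub_starProjection_mem_orthogonal x)
  rw [Submodule.orthogonal_orthogonal_eq_closure] at h3
  rw [← hR]
  exact h3

section Koopman

variable {X : Type*} [MeasurableSpace X] {μ : Measure X} {T : X ≃ᵐ X}

theorem koopman_coe (hT : MeasurePreserving T μ μ) (g : Lp ℂ 2 μ) :
    koopman T hT g =ᵐ[μ] fun x => g (T x) :=
  Lp.coeFn_compMeasurePreserving g hT

theorem norm_koopman (hT : MeasurePreserving T μ μ) (g : Lp ℂ 2 μ) :
    ‖koopman T hT g‖ = ‖g‖ :=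
  (Lp.compMeasurePreservingₗᵢ ℂ (T : X → X) hT).norm_map g

/-- The complex number `exp (2πiθ)`. -/
noncomputable def eTwoPi (θ : ℝ) : ℂ := Complex.exp (2 * Real.pi * Complex.I * θ)

theorem norm_eTwoPi (θ : ℝ) : ‖eTwoPi θ‖ = 1 := by
  rw [eTwoPi, show 2 * Real.pi * Complex.I * (θ : ℂ) = ((2 * Real.pi * θ : ℝ) : ℂ) * Complex.I by
    push_cast; ring, Complex.norm_exp_ofReal_mul_I]

theorem eTwoPi_add (s t : ℝ) : eTwoPi (s + t) = eTwoPi s * eTwoPi t := by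
  rw [eTwoPi, eTwoPi, eTwoPi, ← Complex.exp_add]; congr 1; push_cast; ring

theorem eTwoPi_zero : eTwoPi 0 = 1 := by simp [eTwoPi]

theorem eTwoPi_neg_mul (t : ℝ) : eTwoPi (-t) * eTwoPi t = 1 := by
  rw [← eTwoPi_add, neg_add_cancel, eTwoPi_zero]

theorem mem_eigenSub (hT : MeasurePreserving T μ μ) (θ : ℝ) (g : Lp ℂ 2 μ) :
    g ∈ eigenSub T hT θ ↔ koopman T hT g = eTwoPi θ • g := by
  rw [eigenSub, LinearMap.mem_ker]
  simp [sub_eq_zero, eTwoPi]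

theorem mem_eigenSub_iff_ae (hT : MeasurePreserving T μ μ) (θ : ℝ) (g : Lp ℂ 2 μ) :
    g ∈ eigenSub T hT θ ↔ ∀ᵐ x ∂μ, g (T x) = eTwoPi θ * g x := by
  rw [mem_eigenSub, Lp.ext_iff]
  constructor
  · intro h
    filter_upwards [h, koopman_coe hT g, Lp.coeFn_smul (eTwoPi θ) g] with x h1 h2 h3
    rw [← h2, h1, h3, Pi.smul_apply, smul_eq_mul]
  · intro h
    filter_upwards [h, koopman_coe hT g, Lp.coeFn_smul (eTwoPi θ) g] with x h1 h2 h3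
    rw [h2, h1, h3, Pi.smul_apply, smul_eq_mul]

theorem measurable_eigenExp (hT : MeasurePreserving T μ μ) (θ : ℝ) {f : X → ℂ}
    (hf : MemLp f 2 μ) : Measurable (eigenExp T hT θ f hf) :=
  (Lp.stronglyMeasurable _).measurable

theorem memLp_eigenExp (hT : MeasurePreserving T μ μ) (θ : ℝ) {f : X → ℂ}
    (hf : MemLp f 2 μ) : MemLp (eigenExp T hT θ f hf) 2 μ := Lp.memLp _

theorem eigenExp_comp (hT : MeasurePreserving T μ μ) (θ : ℝ) {f : X → ℂ}
    (hf : MemLp f 2 μ) :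
    ∀ᵐ x ∂μ, eigenExp T hT θ f hf (T x) = eTwoPi θ * eigenExp T hT θ f hf x :=
  (mem_eigenSub_iff_ae hT θ _).1 (Submodule.starProjection_apply_mem _ _)

theorem eigenExp_congr (hT : MeasurePreserving T μ μ) (θ : ℝ) {f f' : X → ℂ}
    (hf : MemLp f 2 μ) (hf' : MemLp f' 2 μ) (h : f =ᵐ[μ] f') :
    eigenExp T hT θ f hf = eigenExp T hT θ f' hf' := by
  rw [eigenExp, eigenExp, MemLp.toLp_congr hf hf' h]

/-- Up to a small error, `f` is the sum of its projection to an eigenspace and a twisted coboundary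
of a bounded function. -/
theorem exists_coboundary_approx (hT : MeasurePreserving T μ μ) (θ : ℝ) {f : X → ℂ}
    (hf : MemLp f 2 μ) {ε : ℝ} (hε : 0 < ε) :
    ∃ g : X → ℂ, Measurable g ∧ (∃ R : ℝ, ∀ x, ‖g x‖ ≤ R) ∧
      eLpNorm (fun x => f x - eigenExp T hT θ f hf x - (g x - eTwoPi (-θ) * g (T x))) 2 μ ≤
        ENNReal.ofReal ε := by
  -- The twist turns the eigenvectors of the Koopman operator into fixed vectors of `U`.
  let U : Lp ℂ 2 μ →L[ℂ] Lp ℂ 2 μ := eTwoPi (-θ) • koopman T hT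
  have hU : ∀ x, ‖U x‖ = ‖x‖ := fun x => by
    simp only [U, _root_.smul_apply, norm_smul, norm_eTwoPi, norm_koopman, one_mul]
  have hS : ∀ x, x ∈ eigenSub T hT θ ↔ U x = x := fun x => by
    rw [mem_eigenSub]
    constructor
    · intro h
      simp only [U, _root_.smul_apply, h, smul_smul, eTwoPi_neg_mul, one_smul]
    · intro h
      conv_rhs => rw [← h]
      simp only [U, _root_.smul_apply, smul_smul]
      rw [mul_comm, eTwoPi_neg_mul, one_smul]
  have h1 := sub_starProjection_mem_closure_range U (fun x => (hU x).le) (eigenSub T hT θ) hS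
    (hf.toLp f)
  obtain ⟨_, ⟨G, rfl⟩, hG⟩ := Metric.mem_closure_iff.1 h1 (ε / 2) (by positivity)
  rw [dist_eq_norm] at hG
  -- A simple function is bounded. As `U` is an isometry, replacing `G` costs at most twice ε/4.
  obtain ⟨g, hg, hg2⟩ := (Lp.memLp G).exists_simpleFunc_eLpNorm_sub_lt (by norm_num)
    (ε := ENNReal.ofReal (ε / 4)) (by simpa using hε)
  have hGg : ‖G - hg2.toLp g‖ ≤ ε / 4 := by
    rw [Lp.norm_def]
    refine ENNReal.toReal_le_of_le_ofReal (by positivity) (le_trans (le_of_eq ?_) hg.le)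
    refine eLpNorm_congr_ae ?_
    filter_upwards [Lp.coeFn_sub G (hg2.toLp g), hg2.coeFn_toLp] with x h1 h2
    rw [h1, Pi.sub_apply, Pi.sub_apply, h2]
  refine ⟨g, g.measurable, ?_, ?_⟩
  · obtain ⟨R, hR⟩ := g.exists_forall_norm_le
    exact ⟨R, hR⟩
  · set P := (eigenSub T hT θ).starProjection (hf.toLp f)
    set G' := hg2.toLp g
    have hfin : ‖hf.toLp f - P - (G' - U G')‖ ≤ ε := by
      have e : hf.toLp f - P - (G' - U G') =
          (hf.toLp f - P - (G - U G)) + ((G - G') - U (G - G')) := by rw [map_sub]; abel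
      rw [e]
      refine (norm_add_le _ _).trans ?_
      have := norm_sub_le (G - G') (U (G - G'))
      rw [hU] at this
      linarith
    refine le_trans (le_of_eq ?_) (ENNReal.ofReal_le_ofReal hfin)
    rw [Lp.norm_def, ENNReal.ofReal_toReal (Lp.eLpNorm_ne_top _)]
    refine eLpNorm_congr_ae ?_
    have hk := koopman_coe hT G'
    filter_upwards [Lp.coeFn_sub (hf.toLp f - P) (G' - U G'), Lp.coeFn_sub (hf.toLp f) P,
      Lp.coeFn_sub G' (U G'), Lp.coeFn_smul (eTwoPi (-θ)) (koopman T hT G'), hk,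
      hf.coeFn_toLp, hg2.coeFn_toLp, hT.quasiMeasurePreserving.ae hg2.coeFn_toLp]
      with x h1 h2 h3 h4 h5 h6 h7 h8
    have h4' : (U G') x = eTwoPi (-θ) * g (T x) := by
      rw [← h8, ← h5]; exact h4
    rw [h1, Pi.sub_apply, h2, h3, Pi.sub_apply, Pi.sub_apply, h6, h4', h7]
    rfl

theorem integral_norm_le_of_eLpNorm_two_le [IsProbabilityMeasure μ] {e : X → ℂ} (he : Measurable e)
    {ε : ℝ} (hε : 0 ≤ ε) (h : eLpNorm e 2 μ ≤ ENNReal.ofReal ε) :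
    Integrable e μ ∧ ∫ x, ‖e x‖ ∂μ ≤ ε := by
  have h1 : eLpNorm e 1 μ ≤ ENNReal.ofReal ε :=
    (eLpNorm_le_eLpNorm_of_exponent_le (by norm_num) he.aestronglyMeasurable).trans h
  have h2 : MemLp e 1 μ := ⟨he.aestronglyMeasurable, h1.trans_lt ENNReal.ofReal_lt_top⟩
  refine ⟨memLp_one_iff_integrable.1 h2, ?_⟩
  rw [integral_norm_eq_lintegral_enorm he.aestronglyMeasurable, ← eLpNorm_one_eq_lintegral_enorm]
  exact ENNReal.toReal_le_of_le_ofReal hε h1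

/-- The projection to the invariant functions is the conditional expectation on the invariant
sets. -/
theorem eigenExp_zero_ae_eq [IsProbabilityMeasure μ] (hT : MeasurePreserving T μ μ) {f : X → ℂ}
    (hf : MemLp f 2 μ) :
    eigenExp T hT 0 f hf =ᵐ[μ] μ[f | MeasurableSpace.invariants T] := by
  have hP := memLp_eigenExp hT 0 hf
  refine ae_eq_condExp_of_forall_setIntegral_eq (MeasurableSpace.invariants_le T)
    (hf.integrable (by norm_num)) (fun s _ _ => (hP.integrable (by norm_num)).integrableOn)
    (fun s hs _ => ?_) ?_
  · have hs' : MeasurableSet s := hs.1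
    -- The indicator of an invariant set lies in the eigenspace, so pairing with it gives the
    -- integrals over `s`.
    have hind : indicatorConstLp 2 hs' (measure_ne_top μ s) (1 : ℂ) ∈ eigenSub T hT 0 := by
      rw [mem_eigenSub_iff_ae]
      have h1 := indicatorConstLp_coeFn (p := 2) (hs := hs') (hμs := measure_ne_top μ s)
        (c := (1 : ℂ))
      filter_upwards [h1, hT.quasiMeasurePreserving.ae h1] with x h2 h3
      rw [h2, h3, eTwoPi_zero, one_mul]
      have : T x ∈ s ↔ x ∈ s := by
        conv_rhs => rw [← hs.2]
        rfl
      by_cases hx : x ∈ s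
      · rw [Set.indicator_of_mem hx, Set.indicator_of_mem (this.2 hx)]
      · rw [Set.indicator_of_notMem hx, Set.indicator_of_notMem (mt this.1 hx)]
    have h2 := (Submodule.mem_orthogonal _ _).1
      ((eigenSub T hT 0).sub_starProjection_mem_orthogonal (hf.toLp f)) _ hind
    rw [inner_sub_right, sub_eq_zero, L2.inner_indicatorConstLp_one,
      L2.inner_indicatorConstLp_one] at h2
    rw [setIntegral_congr_ae hs' (hf.coeFn_toLp.mono fun x hx _ => hx)] at h2
    exact h2.symm
  · refine aestronglyMeasurable_invariants hT hP.1 ?_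
    filter_upwards [eigenExp_comp hT 0 hf] with x hx
    rw [hx, eTwoPi_zero, one_mul]

theorem eTwoPi_succ_mul (θ : ℝ) (m : ℕ) :
    eTwoPi (-((m + 1 : ℕ) * θ)) = eTwoPi (-(m * θ)) * eTwoPi (-θ) := by
  rw [← eTwoPi_add]; congr 1; push_cast; ring

/-- The twisted pointwise ergodic theorem. -/
theorem ae_bnull_twisted [IsProbabilityMeasure μ] (hT : MeasurePreserving T μ μ) (θ : ℝ)
    {f : X → ℂ} (hfm : Measurable f) (hf : MemLp f 2 μ) :
    ∀ᵐ x ∂μ, BNull (fun m : ℕ => eTwoPi (-(m * θ)) * f (zIter T m x) -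
      eigenExp T hT θ f hf x) := by
  set P := eigenExp T hT θ f hf
  have hPm : Measurable P := measurable_eigenExp hT θ hf
  have hPinv : ∀ᵐ x ∂μ, ∀ m : ℕ, eTwoPi (-(m * θ)) * P (zIter T m x) = P x := by
    filter_upwards [ae_forall_zIter hT (eigenExp_comp hT θ hf)] with x hx m
    induction m with
    | zero => simp [eTwoPi_zero, zIter_zero]
    | succ m ih =>
      have h1 : P (T (zIter T m x)) = eTwoPi θ * P (zIter T m x) := hx m
      rw [eTwoPi_succ_mul, Nat.cast_succ, zIter_succ, h1, mul_assoc, ← mul_assoc (eTwoPi (-θ)),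
        eTwoPi_neg_mul, one_mul, ih]
  -- For fixed `t` the exceptional set has measure at most δ for every δ: choose the coboundary with
  -- an L² error of at most δt and apply the maximal inequality.
  have key : ∀ t : ℝ, 0 < t → ∀ᵐ x ∂μ, ∃ v' : ℕ → ℂ, BNull v' ∧
      CesaroLE (fun m => eTwoPi (-(m * θ)) * f (zIter T m x) - P x - v' m) t := by
    intro t ht
    rw [ae_iff]
    refine le_antisymm (ENNReal.le_of_forall_pos_le_add fun δ hδ _ => ?_) zero_le
    rw [zero_add]
    have hε : (0 : ℝ) < δ * t := by positivity
    obtain ⟨g, hgm, ⟨R, hR⟩, hg⟩ := exists_coboundary_approx hT θ hf hε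
    set e : X → ℂ := fun x => f x - P x - (g x - eTwoPi (-θ) * g (T x)) with he
    have hem : Measurable e := (hfm.sub hPm).sub
      (hgm.sub ((hgm.comp T.measurable).const_mul _))
    obtain ⟨hei, hint⟩ := integral_norm_le_of_eLpNorm_two_le hem hε.le hg
    have hmax := maximal_ergodic hT hei.norm hem.norm (fun x => norm_nonneg _) ht
    have hbound : ENNReal.ofReal ((∫ x, ‖e x‖ ∂μ) / t) ≤ δ := by
      rw [← ENNReal.ofReal_coe_nnreal]
      refine ENNReal.ofReal_le_ofReal ?_
      rwa [div_le_iff₀ ht]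
    refine le_trans (measure_mono_ae ?_) (hmax.trans hbound)
    filter_upwards [hPinv] with x hx hbad
    by_contra hgood
    -- Along the orbit the twisted coboundary is a difference of consecutive terms, so its sums
    -- telescope.
    refine hbad ⟨fun m => -(eTwoPi (-((m + 1 : ℕ) * θ)) * g (zIter T (m + 1 : ℕ) x)) -
      -(eTwoPi (-(m * θ)) * g (zIter T m x)), ?_, ?_⟩
    · have hR0 : 0 ≤ R := (norm_nonneg _).trans (hR x)
      refine BNull.of_bounded (K := R + R) fun N => ?_
      rw [Finset.sum_range_sub (fun m : ℕ => -(eTwoPi (-(m * θ)) * g (zIter T m x)))]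
      refine (norm_sub_le _ _).trans (add_le_add ?_ ?_) <;>
      · rw [norm_neg, norm_mul, norm_eTwoPi, one_mul]; exact hR _
    · refine ⟨0, le_rfl, fun N => ?_⟩
      have h1 : ¬ ∃ N : ℕ, t * N < ∑ n ∈ Finset.range N, ‖e (T^[n] x)‖ := hgood
      push Not at h1
      rw [add_zero]
      refine le_trans (le_of_eq (Finset.sum_congr rfl fun m _ => ?_)) (h1 N)
      rw [← zIter_natCast]
      have e1 : eTwoPi (-(m * θ)) * f (zIter T m x) - P x -
          (-(eTwoPi (-((m + 1 : ℕ) * θ)) * g (zIter T (m + 1 : ℕ) x)) -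
            -(eTwoPi (-(m * θ)) * g (zIter T m x))) =
          eTwoPi (-(m * θ)) * e (zIter T m x) := by
        rw [← hx m, he, eTwoPi_succ_mul, Nat.cast_succ, zIter_succ]
        ring
      exact (congrArg norm e1).trans (by rw [norm_mul, norm_eTwoPi, one_mul])
  have key' : ∀ᵐ x ∂μ, ∀ k : ℕ, ∃ v' : ℕ → ℂ, BNull v' ∧
      CesaroLE (fun m => eTwoPi (-(m * θ)) * f (zIter T m x) - P x - v' m) (1 / ((k : ℝ) + 1)) :=
    ae_all_iff.2 fun k => key _ (by positivity)
  filter_upwards [key'] with x hx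
  refine BNull.of_approx fun ε hε => ?_
  obtain ⟨k, hk⟩ := exists_nat_one_div_lt hε
  obtain ⟨v', h1, h2⟩ := hx k
  exact ⟨v', h1, h2.mono hk.le⟩

end Koopman

/-! ### Single averages along the class 𝓢*. -/

/-- An eventual lower bound for limits of averages along an orbit has small measure. -/
theorem measure_le_of_avg_tendsto {X : Type*} [MeasurableSpace X] {μ : Measure X}
    [IsProbabilityMeasure μ] {S : ℕ → X → X} (hS : ∀ n, MeasurePreserving (S n) μ μ)
    {h : X → ℝ} (hm : Measurable h) (hi : Integrable h μ) (h0 : ∀ x, 0 ≤ h x)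
    {t : ℝ} (ht : 0 < t) :
    μ {x | ∃ L : ℝ, t ≤ L ∧ Tendsto (fun N : ℕ => (1 / (N : ℝ)) * ∑ n ∈ Finset.range N, h (S n x))
      atTop (𝓝 L)} ≤ ENNReal.ofReal ((∫ x, h x ∂μ) / t) := by
  let A : ℕ → X → ℝ := fun N x => (1 / (N : ℝ)) * ∑ n ∈ Finset.range N, h (S n x)
  have hA0 : ∀ N x, 0 ≤ A N x := fun N x =>
    mul_nonneg (by positivity) (Finset.sum_nonneg fun n _ => h0 _)
  have hAm : ∀ N, Measurable (A N) := fun N =>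
    (Finset.measurable_sum _ fun n _ => hm.comp (hS n).measurable).const_mul _
  have hSi : ∀ n, Integrable (fun x => h (S n x)) μ := fun n => (hS n).integrable_comp_of_integrable hi
  have hSint : ∀ n, ∫ x, h (S n x) ∂μ = ∫ x, h x ∂μ := fun n => by
    conv_rhs => rw [← (hS n).map_eq]
    rw [integral_map (hS n).measurable.aemeasurable hm.aestronglyMeasurable]
  have hAi : ∀ N, Integrable (A N) μ := fun N => (integrable_finsetSum _ fun n _ => hSi n).const_mul _
  have hAint : ∀ N, ∫ x, A N x ∂μ ≤ ∫ x, h x ∂μ := fun N => by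
    simp only [A]
    rw [integral_const_mul, integral_finsetSum _ fun n _ => hSi n]
    simp only [hSint, Finset.sum_const, Finset.card_range, nsmul_eq_mul]
    rcases Nat.eq_zero_or_pos N with rfl | hN
    · simpa using integral_nonneg h0
    · have : (N : ℝ) ≠ 0 := by positivity
      rw [← mul_assoc, one_div_mul_cancel this, one_mul]
  -- No maximal inequality along `S n` is needed: where the averages converge, their limit equals
  -- the lower limit, and Fatou bounds its integral.
  have hfatou : ∫⁻ x, liminf (fun N => ENNReal.ofReal (A N x)) atTop ∂μ ≤
      ENNReal.ofReal (∫ x, h x ∂μ) := by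
    refine (lintegral_liminf_le fun N => (hAm N).ennreal_ofReal).trans ?_
    refine liminf_le_of_frequently_le' (Frequently.of_forall fun N => ?_)
    rw [← ofReal_integral_eq_lintegral_ofReal (hAi N) (Eventually.of_forall (hA0 N))]
    exact ENNReal.ofReal_le_ofReal (hAint N)
  have hmarkov := mul_meas_ge_le_lintegral (μ := μ)
    (Measurable.liminf fun N => (hAm N).ennreal_ofReal) (ENNReal.ofReal t)
  have hsub : {x | ∃ L : ℝ, t ≤ L ∧ Tendsto (fun N => A N x) atTop (𝓝 L)} ⊆
      {x | ENNReal.ofReal t ≤ liminf (fun N => ENNReal.ofReal (A N x)) atTop} := by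
    rintro x ⟨L, hL, hT⟩
    have : Tendsto (fun N => ENNReal.ofReal (A N x)) atTop (𝓝 (ENNReal.ofReal L)) :=
      ENNReal.tendsto_ofReal hT
    rw [Set.mem_ofPred_eq, this.liminf_eq]
    exact ENNReal.ofReal_le_ofReal hL
  refine (measure_mono hsub).trans ?_
  rw [ENNReal.ofReal_div_of_pos ht, ENNReal.le_div_iff_mul_le
    (Or.inl (by simpa using ht)) (Or.inl ENNReal.ofReal_ne_top), mul_comm]
  exact hmarkov.trans hfatou

theorem exists_bounded_version {X : Type*} [MeasurableSpace X] {μ : Measure X}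
    {f : X → ℂ} (hf : MemLp f ⊤ μ) :
    ∃ f' : X → ℂ, Measurable f' ∧ f =ᵐ[μ] f' ∧ ∃ R : ℝ, 0 ≤ R ∧ ∀ x, ‖f' x‖ ≤ R := by
  obtain ⟨R, hR0, hR⟩ : ∃ R : ℝ, 0 ≤ R ∧ ∀ᵐ x ∂μ, ‖f x‖ ≤ R := by
    refine ⟨(eLpNormEssSup f μ).toReal, ENNReal.toReal_nonneg, ?_⟩
    have hfin : eLpNormEssSup f μ ≠ ⊤ := by
      have := hf.2
      rw [eLpNorm_exponent_top] at this
      exact this.ne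
    filter_upwards [ae_le_eLpNormEssSup (f := f) (μ := μ)] with x hx
    rw [← toReal_enorm]
    exact ENNReal.toReal_mono hfin hx
  have hm : Measurable (hf.1.mk f) := hf.1.stronglyMeasurable_mk.measurable
  let s : Set X := {x | ‖hf.1.mk f x‖ ≤ R}
  have hs : MeasurableSet s := measurableSet_le hm.norm measurable_const
  refine ⟨s.indicator (hf.1.mk f), hm.indicator hs, ?_, R, hR0, fun x => ?_⟩
  · filter_upwards [hf.1.ae_eq_mk, hR] with x h1 h2
    rw [Set.indicator_of_mem (show x ∈ s by rw [h1] at h2; exact h2), h1]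
  · by_cases hx : x ∈ s
    · rw [Set.indicator_of_mem hx]; exact hx
    · rw [Set.indicator_of_notMem hx, norm_zero]; exact hR0

/-- Along a function of the class `𝓢*` the values of `f` are constant up to a null sequence. -/
theorem MemSStar.ae_wnull {a : ℝ → ℝ} (ha : MemSStar.{u} a) (ha0 : Tendsto (deriv a) atTop (𝓝 0))
    {X : Type u} [MetricSpace X] [CompactSpace X] [MeasurableSpace X] [BorelSpace X]
    {μ : Measure X} [IsProbabilityMeasure μ] {T : X ≃ᵐ X} (hT : MeasurePreserving T μ μ)
    {f : X → ℂ} (hfm : Measurable f) {R : ℝ} (hfR : ∀ x, ‖f x‖ ≤ R) :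
    ∀ᵐ x ∂μ, WNull (fun n : ℕ => 1 + |1 / deriv a n|) (fun n : ℕ => f (zIter T ⌊a n⌋ x) -
      (μ[f | MeasurableSpace.invariants T]) x) := by
  have hf : MemLp f ⊤ μ := memLp_top_of_bound hfm.aestronglyMeasurable R (Eventually.of_forall hfR)
  have hf2 : MemLp f 2 μ := hf.mono_exponent le_top
  set P := eigenExp T hT 0 f hf2
  have hPE : P =ᵐ[μ] μ[f | MeasurableSpace.invariants T] := eigenExp_zero_ae_eq hT hf2
  have hPtop : MemLp P ⊤ μ := memLp_top_of_bound
    (measurable_eigenExp hT 0 hf2).aestronglyMeasurable R (by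
      have hb := ae_bdd_norm_condExp_of_ae_bdd_norm (m := MeasurableSpace.invariants T)
        (Eventually.of_forall hfR : ∀ᵐ x ∂μ, ‖f x‖ ≤ R)
      filter_upwards [hPE, hb] with x h1 h2
      rwa [h1])
  -- The projection is replaced by an everywhere bounded version, so that the error `e` is bounded
  -- and the defining property of 𝓢* applies to it.
  obtain ⟨Q, hQm, hPQ, RQ, -, hRQ⟩ := exists_bounded_version hPtop
  have hQinv : ∀ᵐ x ∂μ, ∀ m : ℤ, Q (zIter T m x) = Q x := by
    have h1 : ∀ᵐ x ∂μ, Q (T x) = Q x := by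
      filter_upwards [eigenExp_comp hT 0 hf2, hPQ, hT.quasiMeasurePreserving.ae hPQ]
        with x h1 h2 h3
      rw [← h2, ← h3]
      simpa [eTwoPi_zero] using h1
    filter_upwards [ae_forall_zIter hT h1] with x hx m
    induction m with
    | zero => rw [zIter_zero]
    | succ n ih => rw [zIter_succ, hx, ih]
    | pred n ih => rw [← ih, ← hx (-(n : ℤ) - 1), ← zIter_succ, sub_add_cancel]
  have key : ∀ t : ℝ, 0 < t → ∀ᵐ x ∂μ, ∃ v' : ℕ → ℂ,
      WNull (fun n : ℕ => 1 + |1 / deriv a n|) v' ∧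
      CesaroLE (fun n : ℕ => f (zIter T ⌊a n⌋ x) - Q x - v' n) t := by
    intro t ht
    rw [ae_iff]
    refine le_antisymm (ENNReal.le_of_forall_pos_le_add fun δ hδ _ => ?_) zero_le
    rw [zero_add]
    have hε : (0 : ℝ) < δ * t := by positivity
    obtain ⟨g, hgm, ⟨Rg, hRg⟩, hg⟩ := exists_coboundary_approx hT 0 hf2 hε
    set e : X → ℂ := fun x => f x - Q x - (g x - g (T x)) with he
    have hem : Measurable e := (hfm.sub hQm).sub (hgm.sub (hgm.comp T.measurable))
    have hg' : eLpNorm e 2 μ ≤ ENNReal.ofReal (δ * t) := by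
      refine le_trans (le_of_eq (eLpNorm_congr_ae ?_)) hg
      filter_upwards [hPQ] with x hx
      have hx' : eigenExp T hT 0 f hf2 x = Q x := hx
      rw [hx']
      simp [he, eTwoPi_zero]
    obtain ⟨hei, hint⟩ := integral_norm_le_of_eLpNorm_two_le hem hε.le hg'
    have heb : ∀ x, ‖e x‖ ≤ R + RQ + (Rg + Rg) := fun x =>
      (norm_sub_le _ _).trans (add_le_add ((norm_sub_le _ _).trans (add_le_add (hfR x) (hRQ x)))
        ((norm_sub_le _ _).trans (add_le_add (hRg x) (hRg _))))
    have hmeas := measure_le_of_avg_tendsto (S := fun n : ℕ => zIter T ⌊a n⌋)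
      (fun n => measurePreserving_zIter hT _) hem.norm hei.norm (fun x => norm_nonneg _) ht
    have hbound : ENNReal.ofReal ((∫ x, ‖e x‖ ∂μ) / t) ≤ δ := by
      rw [← ENNReal.ofReal_coe_nnreal]
      refine ENNReal.ofReal_le_ofReal ?_
      rwa [div_le_iff₀ ht]
    -- The convergence hypothesis is applied to |e|, not to `f`.
    have hlim := ha.2 X μ T hT (fun x => ((‖e x‖ : ℝ) : ℂ))
      (Complex.measurable_ofReal.comp hem.norm)
      ⟨R + RQ + (Rg + Rg), fun x => by simpa using heb x⟩
    refine le_trans (measure_mono_ae ?_) (hmeas.trans hbound)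
    filter_upwards [hQinv, hlim] with x hx ⟨L, hL⟩ hbad
    have hL' : Tendsto (fun N : ℕ => (1 / (N : ℝ)) *
        ∑ n ∈ Finset.range N, ‖e (zIter T ⌊a n⌋ x)‖) atTop (𝓝 L.re) := by
      refine ((Complex.continuous_re.tendsto L).comp hL).congr fun N => ?_
      have : (1 / (N : ℂ)) * ∑ n ∈ Finset.range N, ((‖e (zIter T ⌊a n⌋ x)‖ : ℝ) : ℂ) =
          (((1 / (N : ℝ)) * ∑ n ∈ Finset.range N, ‖e (zIter T ⌊a n⌋ x)‖ : ℝ) : ℂ) := by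
        push_cast; rfl
      rw [Function.comp_apply, this, Complex.ofReal_re]
    refine ⟨L.re, ?_, hL'⟩
    -- A limit below `t` makes the Cesàro means of the error at most `t`, and the coboundary is then
    -- an admissible approximation.
    by_contra hlt
    refine hbad ⟨_, ha.1.wnull_coboundary ha0 (g := fun m => g (zIter T m x)) (fun m => hRg _), ?_⟩
    refine (CesaroLE.of_tendsto (v := fun n : ℕ => e (zIter T ⌊a n⌋ x)) (not_le.1 hlt)
      hL').of_norm_le fun n => le_of_eq (congrArg norm ?_)
    simp only [he, zIter_succ, hx]
  have key' : ∀ᵐ x ∂μ, ∀ k : ℕ, ∃ v' : ℕ → ℂ, WNull (fun n : ℕ => 1 + |1 / deriv a n|) v' ∧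
      CesaroLE (fun n : ℕ => f (zIter T ⌊a n⌋ x) - Q x - v' n) (1 / ((k : ℝ) + 1)) :=
    ae_all_iff.2 fun k => key _ (by positivity)
  filter_upwards [key', hPE, hPQ] with x hx h1 h2
  rw [← h1, h2]
  refine WNull.of_approx (fun n => by positivity) fun ε hε => ?_
  obtain ⟨k, hk⟩ := exists_nat_one_div_lt hε
  obtain ⟨v', h1, h2⟩ := hx k
  exact ⟨v', h1, h2.mono hk.le⟩

/-! ### Rational slope. -/

/-- For n = qm + j one has ⌊pn/q + ℓ⌋ = pm + ⌊pj/q + ℓ⌋, so each residue class follows an orbit of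
T^p. -/
theorem ae_bnull_rational {X : Type*} [MeasurableSpace X] {μ : Measure X} [IsProbabilityMeasure μ]
    {T : X ≃ᵐ X} (hT : MeasurePreserving T μ μ) {f : X → ℂ} (hfm : Measurable f)
    (hf : MemLp f 2 μ) (p : ℤ) {q : ℕ} (hq : 0 < q) (ℓ : ℝ) :
    ∀ᵐ x ∂μ, BNull fun n : ℕ => f (zIter T ⌊(p : ℝ) / q * n + ℓ⌋ x) - 1 / q *
      ∑ j ∈ Finset.range q, (μ[fun y => f (zIter T ⌊(p : ℝ) * j / q + ℓ⌋ y) |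
        MeasurableSpace.invariants (zIter T p)]) x := by
  let S := zIterEquiv T p
  have hS : MeasurePreserving S μ μ := measurePreserving_zIterEquiv hT p
  let F : ℕ → X → ℂ := fun j y => f (zIter T ⌊(p : ℝ) * j / q + ℓ⌋ y)
  have hFm : ∀ j, Measurable (F j) := fun j => hfm.comp (measurable_zIter T _)
  have hF : ∀ j, MemLp (F j) 2 μ := fun j =>
    hf.comp_measurePreserving (measurePreserving_zIter hT _)
  have h1 : ∀ᵐ x ∂μ, ∀ j, BNull fun m : ℕ => F j (zIter S m x) -
      (μ[F j | MeasurableSpace.invariants S]) x := by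
    refine ae_all_iff.2 fun j => ?_
    filter_upwards [ae_bnull_twisted hS 0 (hFm j) (hF j), eigenExp_zero_ae_eq hS (hF j)]
      with x h1 h2
    rw [← h2]
    simpa [eTwoPi_zero] using h1
  filter_upwards [h1] with x hx
  refine BNull.of_mod hq (v := fun j m => F j (zIter S m x)) (fun m j _ => ?_) fun j _ => hx j
  have hq' : (q : ℝ) ≠ 0 := by positivity
  simp only [F, S]
  rw [zIter_zIterEquiv, ← zIter_add]
  congr 2
  rw [← Int.floor_add_intCast]
  congr 1
  push_cast
  field_simp
  ring

/-! ### Equidistribution of irrational rotations. -/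

theorem fourier_coe_eq_eTwoPi (n : ℤ) (x : ℝ) : fourier n (x : AddCircle (1 : ℝ)) = eTwoPi (n * x) := by
  rw [fourier_coe_apply, eTwoPi]; congr 1; push_cast; ring

theorem eTwoPi_ne_one {θ : ℝ} (hθ : Irrational θ) {n : ℤ} (hn : n ≠ 0) : eTwoPi (n * θ) ≠ 1 := by
  rw [eTwoPi, Ne, Complex.exp_eq_one_iff]
  rintro ⟨m, hm⟩
  have hpi : (2 * Real.pi * Complex.I : ℂ) ≠ 0 := by simp [Real.pi_ne_zero]
  have h1 : ((n * θ : ℝ) : ℂ) = m := by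
    rw [mul_comm (m : ℂ)] at hm
    exact mul_left_cancel₀ hpi hm
  have h2 : (n * θ : ℝ) = m := by exact_mod_cast h1
  exact (hθ.intCast_mul hn).ne_int m h2

theorem integral_fourier_eq_zero {n : ℤ} (hn : n ≠ 0) :
    ∫ z, fourier n z ∂(AddCircle.haarAddCircle (T := (1 : ℝ))) = 0 := by
  have h := congrFun (fourierCoeff_fourier (T := 1) n) 0
  rw [Pi.single_eq_of_ne hn.symm] at h
  simpa [fourierCoeff] using h

/-- Weyl equidistribution of the orbits of an irrational rotation. -/
theorem tendsto_avg_rotation {θ : ℝ} (hθ : Irrational θ) (y : ℝ) (ψ : C(AddCircle (1 : ℝ), ℂ)) :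
    Tendsto (fun N : ℕ => (1 / (N : ℂ)) * ∑ m ∈ Finset.range N, ψ ((y + m * θ : ℝ) : AddCircle (1 : ℝ)))
      atTop (𝓝 (∫ z, ψ z ∂AddCircle.haarAddCircle)) := by
  have hmono : ∀ n : ℤ, Tendsto (fun N : ℕ => (1 / (N : ℂ)) * ∑ m ∈ Finset.range N,
      fourier n ((y + m * θ : ℝ) : AddCircle (1 : ℝ))) atTop
      (𝓝 (∫ z, fourier n z ∂(AddCircle.haarAddCircle (T := (1 : ℝ))))) := by
    intro n
    rcases eq_or_ne n 0 with rfl | hn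
    · simp only [fourier_zero, integral_const, probReal_univ, one_smul, Finset.sum_const,
        Finset.card_range, nsmul_eq_mul, mul_one]
      refine tendsto_const_nhds.congr' ?_
      filter_upwards [eventually_gt_atTop 0] with N hN
      have : (N : ℂ) ≠ 0 := by exact_mod_cast hN.ne'
      field_simp
    · rw [integral_fourier_eq_zero hn]
      have hr := eTwoPi_ne_one hθ hn
      -- A geometric sum with ratio different from 1 is bounded uniformly in N.
      have hbound : ∀ N : ℕ, ‖∑ m ∈ Finset.range N, fourier n ((y + m * θ : ℝ) : AddCircle (1 : ℝ))‖ ≤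
          2 / ‖eTwoPi (n * θ) - 1‖ := fun N => by
        have e : ∀ m : ℕ, fourier n ((y + m * θ : ℝ) : AddCircle (1 : ℝ)) =
            eTwoPi (n * y) * eTwoPi (n * θ) ^ m := fun m => by
          rw [fourier_coe_eq_eTwoPi]
          induction m with
          | zero => simp
          | succ m ih =>
            rw [pow_succ, ← mul_assoc, ← ih, ← eTwoPi_add]; congr 1; push_cast; ring
        simp only [e]
        rw [← Finset.mul_sum, geom_sum_eq hr, norm_mul, norm_eTwoPi, one_mul, norm_div]
        gcongr
        refine (norm_sub_le _ _).trans ?_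
        rw [norm_pow, norm_eTwoPi]
        norm_num
      refine squeeze_zero_norm (a := fun N : ℕ => (2 / ‖eTwoPi (n * θ) - 1‖) * (1 / (N : ℝ)))
        (fun N => ?_) ?_
      · rw [norm_mul, norm_div, norm_one, Complex.norm_natCast, mul_comm]
        gcongr
        exact hbound N
      · simpa using (tendsto_one_div_atTop_nhds_zero_nat (𝕜 := ℝ)).const_mul
          (2 / ‖eTwoPi (n * θ) - 1‖)
  have hint : ∀ φ : C(AddCircle (1 : ℝ), ℂ), Integrable φ AddCircle.haarAddCircle := fun φ =>
    φ.continuous.integrable_of_hasCompactSupport (HasCompactSupport.of_compactSpace _)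
  have hspan : ∀ φ ∈ Submodule.span ℂ (Set.range (@fourier (1 : ℝ))),
      Tendsto (fun N : ℕ => (1 / (N : ℂ)) * ∑ m ∈ Finset.range N,
        φ ((y + m * θ : ℝ) : AddCircle (1 : ℝ))) atTop
        (𝓝 (∫ z, φ z ∂AddCircle.haarAddCircle)) := by
    intro φ hφ
    induction hφ using Submodule.span_induction with
    | mem φ hφ => obtain ⟨n, rfl⟩ := hφ; exact hmono n
    | zero => simp
    | add φ φ' _ _ h h' =>
      simp only [ContinuousMap.add_apply]
      rw [integral_add (hint φ) (hint φ')]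
      simpa only [Finset.sum_add_distrib, mul_add] using h.add h'
    | smul a φ _ h =>
      simp only [ContinuousMap.smul_apply, smul_eq_mul]
      rw [integral_const_mul]
      simpa only [← Finset.mul_sum, mul_left_comm _ a] using h.const_mul a
  rw [Metric.tendsto_atTop']
  intro ε hε
  have hdense : ψ ∈ (Submodule.span ℂ (Set.range (@fourier (1 : ℝ)))).topologicalClosure := by
    rw [span_fourier_closure_eq_top]; trivial
  obtain ⟨φ, hφ, hψφ⟩ := Metric.mem_closure_iff.1 hdense (ε / 3) (by positivity)
  rw [dist_eq_norm] at hψφ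
  obtain ⟨N₀, hN₀⟩ := Metric.tendsto_atTop'.1 (hspan φ hφ) (ε / 3) (by positivity)
  refine ⟨N₀, fun N hN => ?_⟩
  have hN0 : (0 : ℝ) < N := by exact_mod_cast (Nat.zero_le _).trans_lt hN
  have h1 := hN₀ N hN
  have hpt : ∀ z, ‖ψ z - φ z‖ ≤ ‖ψ - φ‖ := fun z => (ψ - φ).norm_coe_le_norm z
  have h2 : ‖(1 / (N : ℂ)) * ∑ m ∈ Finset.range N, ψ ((y + m * θ : ℝ) : AddCircle (1 : ℝ)) -
      (1 / (N : ℂ)) * ∑ m ∈ Finset.range N, φ ((y + m * θ : ℝ) : AddCircle (1 : ℝ))‖ ≤ ‖ψ - φ‖ := by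
    rw [← mul_sub, ← Finset.sum_sub_distrib, norm_mul, norm_div, norm_one, Complex.norm_natCast,
      one_div, inv_mul_le_iff₀ hN0]
    refine (norm_sum_le _ _).trans ((Finset.sum_le_sum fun m _ => hpt _).trans ?_)
    simp
  have h3 : ‖(∫ z, φ z ∂AddCircle.haarAddCircle) - ∫ z, ψ z ∂AddCircle.haarAddCircle‖ ≤ ‖ψ - φ‖ := by
    rw [← integral_sub (hint φ) (hint ψ)]
    refine (norm_integral_le_of_norm_le_const (C := ‖ψ - φ‖) (Eventually.of_forall fun z => ?_)).trans
      (by simp)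
    rw [norm_sub_rev]; exact hpt z
  rw [dist_eq_norm] at h1 ⊢
  have h4 := norm_add₃_le (a := (1 / (N : ℂ)) * ∑ m ∈ Finset.range N, ψ ((y + m * θ : ℝ) : AddCircle (1 : ℝ)) -
      (1 / (N : ℂ)) * ∑ m ∈ Finset.range N, φ ((y + m * θ : ℝ) : AddCircle (1 : ℝ)))
    (b := (1 / (N : ℂ)) * ∑ m ∈ Finset.range N, φ ((y + m * θ : ℝ) : AddCircle (1 : ℝ)) -
      ∫ z, φ z ∂AddCircle.haarAddCircle)
    (c := (∫ z, φ z ∂AddCircle.haarAddCircle) - ∫ z, ψ z ∂AddCircle.haarAddCircle)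
  rw [sub_add_sub_cancel, sub_add_sub_cancel] at h4
  linarith

theorem cesaroLE_rotation {θ : ℝ} (hθ : Irrational θ) (y : ℝ) (ψ : C(AddCircle (1 : ℝ), ℂ)) {η : ℝ}
    (hη : ∫ z, ‖ψ z‖ ∂AddCircle.haarAddCircle < η) :
    CesaroLE (fun m : ℕ => ψ ((y + m * θ : ℝ) : AddCircle (1 : ℝ))) η := by
  let ψ' : C(AddCircle (1 : ℝ), ℂ) := ⟨fun z => ((‖ψ z‖ : ℝ) : ℂ), by fun_prop⟩
  refine CesaroLE.of_tendsto hη ?_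
  have h := (Complex.continuous_re.tendsto _).comp (tendsto_avg_rotation hθ y ψ')
  have e : (∫ z, ψ' z ∂AddCircle.haarAddCircle).re = ∫ z, ‖ψ z‖ ∂AddCircle.haarAddCircle := by
    simp only [ψ', ContinuousMap.coe_mk]
    rw [integral_complex_ofReal, Complex.ofReal_re]
  rw [e] at h
  refine h.congr fun N => ?_
  have e2 : (1 / (N : ℂ)) * ∑ m ∈ Finset.range N, ψ' ((y + m * θ : ℝ) : AddCircle (1 : ℝ)) =
      (((1 / (N : ℝ)) * ∑ m ∈ Finset.range N, ‖ψ ((y + m * θ : ℝ) : AddCircle (1 : ℝ))‖ : ℝ) : ℂ) := by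
    simp only [ψ', ContinuousMap.coe_mk]
    push_cast; rfl
  rw [Function.comp_apply, e2, Complex.ofReal_re]

/-! The sawtooth function and its Fourier series -/

theorem periodizedBernoulli_one_coe (x : ℝ) :
    periodizedBernoulli 1 (x : AddCircle (1 : ℝ)) = Int.fract x - 1 / 2 := by
  have h1 : (x : AddCircle (1 : ℝ)) = (Int.fract x : ℝ) := by
    conv_lhs => rw [← Int.fract_add_floor x]
    rw [AddCircle.coe_add, add_eq_left, AddCircle.coe_eq_zero_iff]
    exact ⟨⌊x⌋, by simp⟩
  rw [h1, periodizedBernoulli, AddCircle.liftIco_coe_apply ⟨Int.fract_nonneg x, by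
    simpa using Int.fract_lt_one x⟩, bernoulliFun_one]

theorem abs_periodizedBernoulli_one_le (z : AddCircle (1 : ℝ)) :
    |periodizedBernoulli 1 z| ≤ 1 / 2 := by
  induction z using QuotientAddGroup.induction_on with
  | H x =>
    have h := periodizedBernoulli_one_coe x
    have h1 := Int.fract_nonneg x
    have h2 := (Int.fract_lt_one x).le
    change |periodizedBernoulli 1 (x : AddCircle (1 : ℝ))| ≤ 1 / 2
    rw [h, abs_le]
    constructor <;> linarith

theorem measurable_periodizedBernoulli_one : Measurable (periodizedBernoulli 1) := by
  have : periodizedBernoulli 1 =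
      fun z => bernoulliFun 1 (AddCircle.measurableEquivIco (1 : ℝ) 0 z : ℝ) := rfl
  rw [this]
  exact (continuous_bernoulliFun 1).measurable.comp
    (measurable_subtype_coe.comp (AddCircle.measurableEquivIco (1 : ℝ) 0).measurable)

theorem continuousAt_periodizedBernoulli_one {z : AddCircle (1 : ℝ)} (hz : z ≠ 0) :
    ContinuousAt (periodizedBernoulli 1) z := by
  have : periodizedBernoulli 1 =
      fun z => bernoulliFun 1 (AddCircle.equivIco (1 : ℝ) 0 z : ℝ) := rfl
  rw [this]
  exact (continuous_bernoulliFun 1).continuousAt.comp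
    (continuousAt_subtype_val.comp (AddCircle.continuousAt_equivIco 1 0 hz))

/-- A continuous bump at the origin of the circle with small support. -/
noncomputable def circleBump (δ : ℝ) (z : AddCircle (1 : ℝ)) : ℝ := max 0 (1 - ‖z‖ / δ)

theorem continuous_circleBump (δ : ℝ) : Continuous (circleBump δ) := by
  unfold circleBump; fun_prop

theorem circleBump_nonneg (δ : ℝ) (z : AddCircle (1 : ℝ)) : 0 ≤ circleBump δ z := le_max_left _ _

theorem circleBump_le_one {δ : ℝ} (hδ : 0 < δ) (z : AddCircle (1 : ℝ)) : circleBump δ z ≤ 1 :=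
  max_le zero_le_one (by have : 0 ≤ ‖z‖ / δ := by positivity
                         linarith)

theorem integral_circleBump_le {δ : ℝ} (hδ : 0 < δ) :
    ∫ z, circleBump δ z ∂AddCircle.haarAddCircle ≤ 2 * δ := by
  have h1 : ∫ z, circleBump δ z ∂AddCircle.haarAddCircle ≤
      ∫ z, (Metric.closedBall (0 : AddCircle (1 : ℝ)) δ).indicator (fun _ => (1 : ℝ)) z
        ∂AddCircle.haarAddCircle := by
    refine integral_mono ((continuous_circleBump δ).integrable_of_hasCompactSupport
      (HasCompactSupport.of_compactSpace _))
      ((integrable_const _).indicator Metric.isClosed_closedBall.measurableSet) fun z => ?_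
    by_cases hz : z ∈ Metric.closedBall (0 : AddCircle (1 : ℝ)) δ
    · rw [Set.indicator_of_mem hz]; exact circleBump_le_one hδ z
    · rw [Set.indicator_of_notMem hz]
      rw [mem_closedBall_zero_iff, not_le] at hz
      refine max_le le_rfl ?_
      rw [sub_nonpos, le_div_iff₀ hδ]
      linarith
  refine h1.trans ?_
  rw [AddCircle.integral_haarAddCircle, inv_one, one_smul,
    integral_indicator_const _ Metric.isClosed_closedBall.measurableSet, smul_eq_mul, mul_one,
    measureReal_def, AddCircle.volume_closedBall, ENNReal.toReal_ofReal (by positivity)]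
  exact min_le_right _ _

/-- The Fourier coefficients of the sawtooth function. -/
noncomputable def sawCoeff (n : ℤ) : ℂ := -1 / (2 * Real.pi * Complex.I * n)

theorem memLp_periodizedBernoulli_one :
    MemLp (fun z : AddCircle (1 : ℝ) => (periodizedBernoulli 1 z : ℂ)) 2 AddCircle.haarAddCircle :=
  MemLp.of_bound (Complex.measurable_ofReal.comp
    measurable_periodizedBernoulli_one).aestronglyMeasurable (1 / 2)
    (Eventually.of_forall fun z => by
      rw [Complex.norm_real]; exact abs_periodizedBernoulli_one_le z)

theorem fourierCoeff_toLp_periodizedBernoulli (n : ℤ) :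
    fourierCoeff (memLp_periodizedBernoulli_one.toLp) n = sawCoeff n := by
  rw [fourierCoeff_congr_ae memLp_periodizedBernoulli_one.coeFn_toLp]
  have := fourierCoeff_bernoulli_eq one_ne_zero n
  rw [Nat.factorial_one, Nat.cast_one, pow_one] at this
  exact this

theorem summable_sq_sawCoeff : Summable fun n : ℤ => ‖sawCoeff n‖ ^ 2 := by
  have := (hasSum_sq_fourierCoeff memLp_periodizedBernoulli_one.toLp).summable
  simpa only [fourierCoeff_toLp_periodizedBernoulli] using this

/-- The error of a Fourier partial sum of the sawtooth function. -/
noncomputable def sawError (s : Finset ℤ) (z : AddCircle (1 : ℝ)) : ℂ :=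
  periodizedBernoulli 1 z - ∑ j ∈ s, sawCoeff j * fourier j z

theorem measurable_sawError (s : Finset ℤ) : Measurable (sawError s) :=
  (Complex.measurable_ofReal.comp measurable_periodizedBernoulli_one).sub
    (Finset.measurable_sum _ fun j _ => ((fourier j).continuous.measurable).const_mul _)

/-- The Fourier series converges in L², hence in L¹. Stating this along finite sets of frequencies
allows one such set to be chosen for several requirements. -/
theorem eventually_integral_sawError_le {η : ℝ} (hη : 0 < η) :
    ∀ᶠ s : Finset ℤ in atTop, Integrable (sawError s) AddCircle.haarAddCircle ∧
      ∫ z, ‖sawError s z‖ ∂AddCircle.haarAddCircle ≤ η := by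
  have h := hasSum_fourier_series_L2 memLp_periodizedBernoulli_one.toLp
  simp only [fourierCoeff_toLp_periodizedBernoulli] at h
  have h' := Metric.tendsto_nhds.1 h η hη
  filter_upwards [h'] with s hs
  refine integral_norm_le_of_eLpNorm_two_le (measurable_sawError s) hη.le ?_
  rw [dist_comm, dist_eq_norm] at hs
  refine le_trans (le_of_eq ?_) (ENNReal.ofReal_le_ofReal hs.le)
  rw [Lp.norm_def, ENNReal.ofReal_toReal (Lp.eLpNorm_ne_top _)]
  refine eLpNorm_congr_ae ?_
  have h2 : ∀ᵐ z ∂(AddCircle.haarAddCircle (T := (1 : ℝ))),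
      (∑ j ∈ s, sawCoeff j • fourierLp (T := (1 : ℝ)) 2 j : Lp ℂ 2 AddCircle.haarAddCircle) z =
        ∑ j ∈ s, sawCoeff j * fourier j z := by
    have h3 : ∀ᵐ z ∂(AddCircle.haarAddCircle (T := (1 : ℝ))), ∀ j : ℤ,
        (sawCoeff j • fourierLp (T := (1 : ℝ)) 2 j : Lp ℂ 2 AddCircle.haarAddCircle) z =
          sawCoeff j * fourier j z := ae_all_iff.2 fun j => by
      filter_upwards [Lp.coeFn_smul (sawCoeff j) (fourierLp (T := (1 : ℝ)) 2 j),
        coeFn_fourierLp (T := (1 : ℝ)) 2 j] with z h1 h2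
      rw [h1, Pi.smul_apply, h2, smul_eq_mul]
    filter_upwards [h3, Lp.coeFn_finsetSum s fun j => sawCoeff j • fourierLp (T := (1 : ℝ)) 2 j]
      with z h4 h5
    rw [h5, Finset.sum_apply]
    exact Finset.sum_congr rfl fun j _ => h4 j
  filter_upwards [h2, Lp.coeFn_sub memLp_periodizedBernoulli_one.toLp
    (∑ j ∈ s, sawCoeff j • fourierLp (T := (1 : ℝ)) 2 j),
    memLp_periodizedBernoulli_one.coeFn_toLp] with z h3 h4 h5
  rw [h4, Pi.sub_apply, h3, h5, sawError]

/-- The only discontinuity is at 0, where the second factor vanishes and the first stays bounded. -/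
theorem continuous_mul_one_sub_circleBump {δ : ℝ} (hδ : 0 < δ) :
    Continuous fun z => periodizedBernoulli 1 z * (1 - circleBump δ z) := by
  rw [continuous_iff_continuousAt]
  intro z
  rcases eq_or_ne z 0 with rfl | hz
  · have h0 : circleBump δ 0 = 1 := by simp [circleBump]
    rw [ContinuousAt, h0, sub_self, mul_zero]
    have h1 : Tendsto (fun z => 1 - circleBump δ z) (𝓝 0) (𝓝 0) := by
      have := tendsto_const_nhds (x := (1 : ℝ)).sub ((continuous_circleBump δ).tendsto 0)
      rwa [h0, sub_self] at this
    refine squeeze_zero_norm (fun z => ?_) h1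
    have h2 := circleBump_le_one hδ z
    rw [norm_mul, Real.norm_of_nonneg (sub_nonneg.2 h2), Real.norm_eq_abs]
    exact mul_le_of_le_one_left (sub_nonneg.2 h2)
      ((abs_periodizedBernoulli_one_le z).trans (by norm_num))
  · exact (continuousAt_periodizedBernoulli_one hz).mul
      (continuousAt_const.sub (continuous_circleBump δ).continuousAt)

/-- Equidistribution is available for continuous functions, while the error jumps at 0. Splitting
off the sawtooth times a bump leaves a continuous function of small L¹ norm and a term dominated by
the bump. The set of frequencies does not depend on `y`. -/
theorem eventually_cesaroLE_sawError {θ : ℝ} (hθ : Irrational θ) {η : ℝ} (hη : 0 < η) :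
    ∀ᶠ s : Finset ℤ in atTop, ∀ y : ℝ,
      CesaroLE (fun m : ℕ => sawError s ((y + m * θ : ℝ) : AddCircle (1 : ℝ))) η := by
  filter_upwards [eventually_integral_sawError_le (show 0 < η / 4 by positivity)] with s hs y
  obtain ⟨hsi, hs⟩ := hs
  -- The bump has integral at most 2δ = η/8, so the L¹ norms are at most η/4 + η/8 and η/8, both
  -- below η/2.
  set δ := η / 16 with hδ'
  have hδ : 0 < δ := by positivity
  let ψ₁ : C(AddCircle (1 : ℝ), ℂ) :=
    ⟨fun z => ((periodizedBernoulli 1 z * (1 - circleBump δ z) : ℝ) : ℂ) -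
      ∑ j ∈ s, sawCoeff j * fourier j z,
      (Complex.continuous_ofReal.comp (continuous_mul_one_sub_circleBump hδ)).sub (by fun_prop)⟩
  let ψ₂ : C(AddCircle (1 : ℝ), ℂ) := ⟨fun z => (circleBump δ z : ℂ),
    Complex.continuous_ofReal.comp (continuous_circleBump δ)⟩
  have hb : Integrable (fun z => circleBump δ z) AddCircle.haarAddCircle :=
    (continuous_circleBump δ).integrable_of_hasCompactSupport (HasCompactSupport.of_compactSpace _)
  have e1 : ∀ z, sawError s z = ψ₁ z + (periodizedBernoulli 1 z : ℂ) * ψ₂ z := fun z => by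
    simp only [sawError, ψ₁, ψ₂, ContinuousMap.coe_mk]
    push_cast
    ring
  have hn : ∀ z, ‖(periodizedBernoulli 1 z : ℂ) * ψ₂ z‖ ≤ ‖ψ₂ z‖ := fun z => by
    rw [norm_mul, Complex.norm_real]
    exact mul_le_of_le_one_left (norm_nonneg _)
      ((abs_periodizedBernoulli_one_le z).trans (by norm_num))
  have hψ₂ : ∀ z, ‖ψ₂ z‖ = circleBump δ z := fun z => by
    simp only [ψ₂, ContinuousMap.coe_mk, Complex.norm_real]
    exact Real.norm_of_nonneg (circleBump_nonneg δ z)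
  have h2 : ∫ z, ‖ψ₂ z‖ ∂AddCircle.haarAddCircle ≤ 2 * δ := by
    simp only [hψ₂]; exact integral_circleBump_le hδ
  have h1 : ∫ z, ‖ψ₁ z‖ ∂AddCircle.haarAddCircle ≤ η / 4 + 2 * δ := by
    have : ∫ z, ‖ψ₁ z‖ ∂AddCircle.haarAddCircle ≤
        ∫ z, (‖sawError s z‖ + circleBump δ z) ∂AddCircle.haarAddCircle := by
      refine integral_mono (ψ₁.continuous.norm.integrable_of_hasCompactSupport
        (HasCompactSupport.of_compactSpace _)) (hsi.norm.add hb) fun z => ?_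
      have e2 : ψ₁ z = sawError s z - (periodizedBernoulli 1 z : ℂ) * ψ₂ z := by rw [e1]; ring
      change ‖ψ₁ z‖ ≤ ‖sawError s z‖ + circleBump δ z
      rw [e2, ← hψ₂ z]
      exact (norm_sub_le _ _).trans (add_le_add le_rfl (hn z))
    rw [integral_add hsi.norm hb] at this
    linarith [integral_circleBump_le hδ]
  have c1 := cesaroLE_rotation hθ y ψ₁ (η := η / 2) (by linarith)
  have c2 := cesaroLE_rotation hθ y ψ₂ (η := η / 2) (by linarith)
  have c3 := c1.add (c2.of_norm_le (v' := fun m : ℕ =>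
    (periodizedBernoulli 1 ((y + m * θ : ℝ) : AddCircle (1 : ℝ)) : ℂ) *
      ψ₂ ((y + m * θ : ℝ) : AddCircle (1 : ℝ))) fun m => hn _)
  simp only [← e1] at c3
  exact c3.mono (by linarith)

theorem cesaroLE_const {c : ℂ} {η : ℝ} (h : ‖c‖ ≤ η) : CesaroLE (fun _ => c) η :=
  ⟨0, le_rfl, fun N => by simp; nlinarith [(Nat.cast_nonneg N : (0 : ℝ) ≤ N)]⟩

/-- Averages weighted by a sawtooth along an irrational rotation are given by its Fourier series. -/
theorem bnull_sawtooth_mul {θ : ℝ} (hθ : Irrational θ) {g : ℕ → ℂ} {R : ℝ} (hR : ∀ m, ‖g m‖ ≤ R)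
    {L : ℤ → ℂ} (hL : ∀ j : ℤ, BNull fun m : ℕ => eTwoPi (j * (m * θ)) * g m - L j) (y : ℝ)
    (hsum : Summable fun j : ℤ => sawCoeff j * eTwoPi (j * y) * L j) :
    BNull fun m : ℕ => (periodizedBernoulli 1 ((y + m * θ : ℝ) : AddCircle (1 : ℝ)) : ℂ) * g m -
      ∑' j : ℤ, sawCoeff j * eTwoPi (j * y) * L j := by
  have hR0 : 0 ≤ R := (norm_nonneg _).trans (hR 0)
  refine BNull.of_approx fun ε hε => ?_
  set η := ε / (2 * (R + 1)) with hη'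
  have hη : 0 < η := by positivity
  have h1 := Metric.tendsto_nhds.1 hsum.hasSum (ε / 2) (by positivity)
  -- A single finite set serves both the mean error of the sawtooth and the tail of the limiting
  -- series.
  obtain ⟨s, hs1, hs2⟩ := ((eventually_cesaroLE_sawError hθ hη).and h1).exists
  rw [dist_eq_norm] at hs2
  refine ⟨fun m => ∑ j ∈ s, sawCoeff j * eTwoPi (j * y) * (eTwoPi (j * (m * θ)) * g m - L j),
    BNull.sum s fun j _ => (hL j).const_mul _, ?_⟩
  have h2 : CesaroLE (fun m : ℕ => sawError s ((y + m * θ : ℝ) : AddCircle (1 : ℝ)) * g m)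
      (ε / 2) := by
    obtain ⟨C, hC, h⟩ := hs1 y
    refine ⟨R * C, by positivity, fun N => ?_⟩
    calc _ ≤ ∑ m ∈ Finset.range N, R * ‖sawError s ((y + m * θ : ℝ) : AddCircle (1 : ℝ))‖ :=
          Finset.sum_le_sum fun m _ => by
            rw [norm_mul, mul_comm]
            exact mul_le_mul_of_nonneg_right (hR m) (norm_nonneg _)
      _ ≤ R * (η * N + C) := by
          rw [← Finset.mul_sum]; exact mul_le_mul_of_nonneg_left (h N) hR0
      _ = R * η * N + R * C := by ring
      _ ≤ _ := by
          gcongr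
          rw [hη', mul_div_assoc', div_le_iff₀ (by positivity)]
          nlinarith
  have h3 := (h2.add (cesaroLE_const hs2.le)).mono (by linarith : ε / 2 + ε / 2 ≤ ε)
  refine h3.of_norm_le fun m => le_of_eq (congrArg norm ?_)
  simp only [sawError, mul_sub, Finset.sum_sub_distrib, sub_mul, Finset.sum_mul]
  have e : ∀ j : ℤ, sawCoeff j * eTwoPi (j * y) * (eTwoPi (j * (m * θ)) * g m) =
      sawCoeff j * fourier j ((y + m * θ : ℝ) : AddCircle (1 : ℝ)) * g m := fun j => by
    rw [fourier_coe_eq_eTwoPi, mul_add (j : ℝ), eTwoPi_add]; ring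
  simp only [e]
  ring

theorem exists_norm_le_of_forall_ge {S : ℕ → ℂ} {n₀ : ℕ} {K : ℝ} (h : ∀ N ≥ n₀, ‖S N‖ ≤ K) :
    ∃ K' : ℝ, ∀ N, ‖S N‖ ≤ K' := by
  have hK : 0 ≤ K := (norm_nonneg _).trans (h n₀ le_rfl)
  refine ⟨K + ∑ N ∈ Finset.range n₀, ‖S N‖, fun N => ?_⟩
  have h0 : 0 ≤ ∑ N ∈ Finset.range n₀, ‖S N‖ := by positivity
  rcases le_or_gt n₀ N with hN | hN
  · linarith [h N hN]
  · linarith [Finset.single_le_sum (f := fun N => ‖S N‖) (fun _ _ => norm_nonneg _)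
      (Finset.mem_range.2 hN)]

/-! ### Counting how often the floor takes each value. -/

section Floor

variable {γ ℓ : ℝ}

/-- Thus c(m) = ⌈(m - ℓ)/γ⌉ is the first integer time at which the floor reaches m, and c(m + 1) -
c(m) is the number of times at which it equals m. -/
theorem ceil_le_iff_le_floor (hγ : 0 < γ) (m n : ℤ) :
    ⌈((m : ℝ) - ℓ) / γ⌉ ≤ n ↔ m ≤ ⌊γ * n + ℓ⌋ := by
  rw [Int.ceil_le, div_le_iff₀ hγ, Int.le_floor]
  constructor <;> intro h <;> linarith

/-- The correction terms count the earlier visits to the current value. If the value M persists,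
this count grows by one. If it moves to M', then c(m) = n + 1 for M < m ≤ M': skipped values have
multiplicity zero and the multiplicity of M is complete. -/
theorem sum_range_floor_step (hγ : 0 < γ) (g : ℤ → ℂ) {n : ℕ} (hn : 0 ≤ ⌊γ * n + ℓ⌋) :
    ∑ m ∈ Finset.Ico ⌊γ * n + ℓ⌋.toNat ⌊γ * (n + 1 : ℕ) + ℓ⌋.toNat,
        ((⌈((m : ℝ) + 1 - ℓ) / γ⌉ - ⌈((m : ℝ) - ℓ) / γ⌉ : ℤ) : ℂ) * g m +
      (((n + 1 : ℕ) : ℂ) - (⌈((⌊γ * (n + 1 : ℕ) + ℓ⌋ : ℝ) - ℓ) / γ⌉ : ℤ)) *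
        g ⌊γ * (n + 1 : ℕ) + ℓ⌋ -
      ((n : ℂ) - (⌈((⌊γ * n + ℓ⌋ : ℝ) - ℓ) / γ⌉ : ℤ)) * g ⌊γ * n + ℓ⌋ = g ⌊γ * n + ℓ⌋ := by
  have hgc := ceil_le_iff_le_floor (ℓ := ℓ) hγ
  set M := ⌊γ * n + ℓ⌋ with hM
  set M' := ⌊γ * (n + 1 : ℕ) + ℓ⌋ with hM'
  have hMM' : M ≤ M' := by
    rw [hM, hM']
    apply Int.floor_le_floor
    push_cast
    nlinarith
  have hc : ∀ m : ℤ, M < m → m ≤ M' → ⌈((m : ℝ) - ℓ) / γ⌉ = n + 1 := by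
    intro m h1 h2
    have h3 := hgc m n
    have h4 := hgc m (n + 1 : ℕ)
    rw [Int.cast_natCast] at h3 h4
    rw [← hM] at h3
    rw [← hM'] at h4
    have h5 := h4.2 h2
    have h6 := mt h3.1 (by omega)
    push_cast at h5
    omega
  rcases hMM'.eq_or_lt with e | hlt
  · rw [← e]
    simp only [Finset.Ico_self, Finset.sum_empty]
    push_cast
    ring
  · have h1 : M.toNat < M'.toNat := by omega
    have hMc : ((M.toNat : ℕ) : ℤ) = M := Int.toNat_of_nonneg hn
    have hMr : ((M.toNat : ℕ) : ℝ) = M := by exact_mod_cast hMc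
    rw [Finset.sum_eq_sum_Ico_succ_bot h1, Finset.sum_eq_zero (s := Finset.Ico (M.toNat + 1) _)]
    · have h2 := hc (M + 1) (by omega) (by omega)
      have h3 := hc M' hlt le_rfl
      push_cast at h2
      rw [hMr, hMc, h2, h3]
      push_cast
      ring
    · intro m hm
      rw [Finset.mem_Ico] at hm
      have h2 := hc m (by omega) (by omega)
      have h3 := hc (m + 1) (by omega) (by omega)
      push_cast at h2 h3
      rw [h2, h3]
      simp

/-- Averages along `⌊γ n + ℓ⌋` are weighted averages over all integers. -/
theorem bnull_floor_of_bnull_weighted (hγ : 0 < γ) {g : ℤ → ℂ} {R : ℝ} (hR : ∀ m, ‖g m‖ ≤ R)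
    {L : ℂ} (h : BNull fun m : ℕ =>
      ((⌈((m : ℝ) + 1 - ℓ) / γ⌉ - ⌈((m : ℝ) - ℓ) / γ⌉ : ℤ) : ℂ) * g m - L / γ) :
    BNull fun n : ℕ => g ⌊γ * n + ℓ⌋ - L := by
  have hR0 : 0 ≤ R := (norm_nonneg _).trans (hR 0)
  set φ : ℕ → ℂ := fun m => ((⌈((m : ℝ) + 1 - ℓ) / γ⌉ - ⌈((m : ℝ) - ℓ) / γ⌉ : ℤ) : ℂ) with hφ
  let s : ℕ → ℤ := fun n => ⌊γ * n + ℓ⌋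
  let r : ℕ → ℕ := fun n => (s n).toNat
  -- The boundary term for the unfinished current value; it is bounded because a value is held for a
  -- time of at most 1/γ.
  let b : ℕ → ℂ := fun n => ((n : ℂ) - (⌈((s n : ℝ) - ℓ) / γ⌉ : ℤ)) * g (s n)
  have hsmono : Monotone s := fun n n' hnn' => Int.floor_le_floor (by gcongr)
  have hrmono : Monotone r := fun n n' hnn' => Int.toNat_le_toNat (hsmono hnn')
  obtain ⟨n₀, hn₀⟩ : ∃ n₀ : ℕ, ∀ n ≥ n₀, 0 ≤ s n := by
    obtain ⟨n₀, hn₀⟩ := exists_nat_ge (|ℓ| / γ)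
    refine ⟨n₀, fun n hn => Int.floor_nonneg.2 ?_⟩
    rw [div_le_iff₀ hγ] at hn₀
    have : (n₀ : ℝ) ≤ n := by exact_mod_cast hn
    nlinarith [neg_abs_le ℓ]
  have hr : ∀ n ≥ n₀, |(r n : ℝ) - γ * n| ≤ |ℓ| + 1 := fun n hn => by
    have h1 : ((r n : ℕ) : ℤ) = s n := Int.toNat_of_nonneg (hn₀ n hn)
    have h2 : (r n : ℝ) = s n := by exact_mod_cast h1
    have h3 := Int.floor_le (γ * n + ℓ)
    have h4 := Int.lt_floor_add_one (γ * n + ℓ)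
    rw [h2, abs_le]
    simp only [s]
    constructor <;> linarith [neg_abs_le ℓ, le_abs_self ℓ]
  have hrle : ∀ n, (r n : ℝ) ≤ γ * n + |ℓ| := fun n => by
    have h0 : 0 ≤ γ * n + |ℓ| := by positivity
    rcases le_total 0 (s n) with h1 | h1
    · have h2 : (r n : ℝ) = s n := by exact_mod_cast Int.toNat_of_nonneg h1
      rw [h2]
      exact (Int.floor_le _).trans (by linarith [le_abs_self ℓ])
    · have h2 : r n = 0 := Int.toNat_of_nonpos h1
      rw [h2]; simpa using h0
  have hb : ∀ n, ‖b n‖ ≤ 1 / γ * R := fun n => by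
    rw [norm_mul]
    refine mul_le_mul ?_ (hR _) (norm_nonneg _) (by positivity)
    have h1 := (ceil_le_iff_le_floor (ℓ := ℓ) hγ (s n) n).2 (by rw [Int.cast_natCast])
    have h2 : (⌈((s n : ℝ) - ℓ) / γ⌉ : ℝ) ≤ n := by exact_mod_cast h1
    have h3 := Int.le_ceil (((s n : ℝ) - ℓ) / γ)
    have h4 := Int.lt_floor_add_one (γ * n + ℓ)
    have h5 : (n : ℝ) - 1 / γ ≤ ((s n : ℝ) - ℓ) / γ := by
      rw [le_div_iff₀ hγ, sub_mul, one_div_mul_cancel hγ.ne']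
      simp only [s]; linarith
    have e : (n : ℂ) - (⌈((s n : ℝ) - ℓ) / γ⌉ : ℤ) =
        (((n : ℝ) - (⌈((s n : ℝ) - ℓ) / γ⌉ : ℤ) : ℝ) : ℂ) := by push_cast; rfl
    rw [e, Complex.norm_real, Real.norm_of_nonneg (by linarith)]
    linarith
  have hconst : ∀ N ≥ n₀, ∑ n ∈ Finset.range N, g (s n) - ∑ m ∈ Finset.range (r N), φ m * g m - b N =
      ∑ n ∈ Finset.range n₀, g (s n) - ∑ m ∈ Finset.range (r n₀), φ m * g m - b n₀ := by
    intro N hN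
    induction N, hN using Nat.le_induction with
    | base => rfl
    | succ N hN ih =>
      rw [← ih, Finset.sum_range_succ,
        ← Finset.sum_range_add_sum_Ico (fun m => φ m * g m) (hrmono (Nat.le_succ N))]
      have h1 : ∑ m ∈ Finset.Ico (r N) (r (N + 1)), φ m * g m + b (N + 1) - b N = g (s N) :=
        sum_range_floor_step hγ g (hn₀ N hN)
      rw [← h1]
      ring
  intro ε hε
  -- The first N times reach about γN values, so an error ε/γ per value costs ε per time.
  obtain ⟨e, ⟨C, hC, he⟩, K, hK⟩ := h (ε / γ) (by positivity)
  have hK0 : 0 ≤ K := (norm_nonneg _).trans (hK 0)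
  -- The errors of all values passed between the times n and n + 1 are charged to n.
  refine ⟨fun n => ∑ m ∈ Finset.Ico (r n) (r (n + 1)), e m,
    ⟨ε / γ * |ℓ| + C, by positivity, fun N => ?_⟩, ?_⟩
  · calc ∑ n ∈ Finset.range N, ‖∑ m ∈ Finset.Ico (r n) (r (n + 1)), e m‖
        ≤ ∑ n ∈ Finset.range N, (∑ m ∈ Finset.range (r (n + 1)), ‖e m‖ -
            ∑ m ∈ Finset.range (r n), ‖e m‖) := Finset.sum_le_sum fun n _ => by
          rw [← Finset.sum_Ico_eq_sub _ (hrmono (Nat.le_succ n))]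
          exact norm_sum_le _ _
      _ = ∑ m ∈ Finset.range (r N), ‖e m‖ - ∑ m ∈ Finset.range (r 0), ‖e m‖ :=
          Finset.sum_range_sub (fun n => ∑ m ∈ Finset.range (r n), ‖e m‖) N
      _ ≤ ∑ m ∈ Finset.range (r N), ‖e m‖ := sub_le_self _ (by positivity)
      _ ≤ ε / γ * (γ * N + |ℓ|) + C := (he _).trans (by gcongr; exact hrle N)
      _ = ε * N + (ε / γ * |ℓ| + C) := by field_simp; ring
  · set K₀ := ∑ n ∈ Finset.range n₀, g (s n) - ∑ m ∈ Finset.range (r n₀), φ m * g m - b n₀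
    refine exists_norm_le_of_forall_ge (n₀ := n₀) (K := ‖K₀‖ +
      ‖∑ m ∈ Finset.range (r 0), e m‖ + K + ‖L‖ / γ * (|ℓ| + 1) + 1 / γ * R) fun N hN => ?_
    have h1 : ∑ n ∈ Finset.range N, ∑ m ∈ Finset.Ico (r n) (r (n + 1)), e m =
        ∑ m ∈ Finset.range (r N), e m - ∑ m ∈ Finset.range (r 0), e m := by
      rw [← Finset.sum_range_sub (fun n => ∑ m ∈ Finset.range (r n), e m)]
      exact Finset.sum_congr rfl fun n _ => Finset.sum_Ico_eq_sub _ (hrmono (Nat.le_succ n))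
    have h2 := hconst N hN
    have hγ' : (γ : ℂ) ≠ 0 := by exact_mod_cast hγ.ne'
    have h3 : ∑ n ∈ Finset.range N, (g ⌊γ * n + ℓ⌋ - L - ∑ m ∈ Finset.Ico (r n) (r (n + 1)), e m) =
        K₀ + ∑ m ∈ Finset.range (r 0), e m +
          ∑ m ∈ Finset.range (r N), (φ m * g m - L / γ - e m) +
          L / γ * (((r N : ℝ) - γ * N : ℝ) : ℂ) + b N := by
      have h4 : ∑ n ∈ Finset.range N, g ⌊γ * n + ℓ⌋ =
          K₀ + ∑ m ∈ Finset.range (r N), φ m * g m + b N := by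
        rw [← h2]; ring
      simp only [Finset.sum_sub_distrib, h1, h4, Finset.sum_const, Finset.card_range, nsmul_eq_mul]
      push_cast
      field_simp
      ring
    rw [h3]
    have h5 : ‖L / γ * (((r N : ℝ) - γ * N : ℝ) : ℂ)‖ ≤ ‖L‖ / γ * (|ℓ| + 1) := by
      rw [norm_mul, norm_div, Complex.norm_real, Complex.norm_real, Real.norm_of_nonneg hγ.le]
      gcongr
      exact hr N hN
    refine (norm_add_le _ _).trans (add_le_add ((norm_add_le _ _).trans (add_le_add
      ((norm_add_le _ _).trans (add_le_add (norm_add_le _ _) (hK _))) h5)) (hb N))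

end Floor

/-- ⌈y⌉ = y + fract(-y); the constants -1/2 of the two sawtooths cancel. -/
theorem ceil_sub_ceil_eq (γ ℓ : ℝ) (m : ℕ) :
    ((⌈((m : ℝ) + 1 - ℓ) / γ⌉ - ⌈((m : ℝ) - ℓ) / γ⌉ : ℤ) : ℝ) = 1 / γ +
      periodizedBernoulli 1 (((ℓ / γ - 1 / γ) + m * (-(1 / γ)) : ℝ) : AddCircle (1 : ℝ)) -
      periodizedBernoulli 1 ((ℓ / γ + m * (-(1 / γ)) : ℝ) : AddCircle (1 : ℝ)) := by
  have h : ∀ y : ℝ, (⌈y⌉ : ℝ) = y + Int.fract (-y) := fun y => by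
    have := Int.fract_add_floor (-y)
    rw [Int.floor_neg] at this
    push_cast at this
    linarith
  rw [periodizedBernoulli_one_coe, periodizedBernoulli_one_coe]
  push_cast
  rw [h, h]
  have e1 : -(((m : ℝ) + 1 - ℓ) / γ) = ℓ / γ - 1 / γ + m * (-(1 / γ)) := by ring
  have e2 : -(((m : ℝ) - ℓ) / γ) = ℓ / γ + m * (-(1 / γ)) := by ring
  rw [e1, e2]
  ring

/-- `sawCoeff 0 = 0` by the convention for division by zero, so the value at j = 0 comes from the
mean multiplicity 1/γ alone. -/
theorem eigenCoeff_eq {γ : ℝ} (hγ : γ ≠ 0) (ℓ : ℝ) (j : ℤ) :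
    eigenCoeff γ ℓ j = γ * (sawCoeff j * eTwoPi (j * (ℓ / γ - 1 / γ)) -
      sawCoeff j * eTwoPi (j * (ℓ / γ))) + if j = 0 then 1 else 0 := by
  have hγ' : (γ : ℂ) ≠ 0 := by exact_mod_cast hγ
  rcases eq_or_ne j 0 with rfl | hj
  · simp [eigenCoeff, sawCoeff]
  · have hj' : (j : ℂ) ≠ 0 := by exact_mod_cast hj
    have hπ : (Real.pi : ℂ) ≠ 0 := by exact_mod_cast Real.pi_ne_zero
    have e : eTwoPi (j * (ℓ / γ - 1 / γ)) = eTwoPi (j * (ℓ / γ)) * eTwoPi (-(j / γ)) := by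
      rw [← eTwoPi_add]; congr 1; ring
    have e1 : Complex.exp (2 * Real.pi * Complex.I * (j * ℓ / γ)) = eTwoPi (j * (ℓ / γ)) := by
      rw [eTwoPi]; congr 1; push_cast; ring
    have e2 : Complex.exp (-2 * Real.pi * Complex.I * (j / γ)) = eTwoPi (-(j / γ)) := by
      rw [eTwoPi]; congr 1; push_cast; ring
    rw [eigenCoeff, if_neg hj, if_neg hj, e, e1, e2, sawCoeff]
    have hI := Complex.I_ne_zero
    field_simp
    ring

theorem summable_sawCoeff_mul {L : ℤ → ℂ} (hL : Summable fun j => ‖L j‖ ^ 2) (y : ℝ) :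
    Summable fun j : ℤ => sawCoeff j * eTwoPi (j * y) * L j := by
  refine Summable.of_norm_bounded (summable_sq_sawCoeff.add hL) fun j => ?_
  rw [norm_mul, norm_mul, norm_eTwoPi, mul_one]
  nlinarith [sq_nonneg (‖sawCoeff j‖ - ‖L j‖), sq_nonneg ‖sawCoeff j‖, sq_nonneg ‖L j‖]

theorem hasSum_eigenCoeff_mul {γ : ℝ} (hγ : γ ≠ 0) (ℓ : ℝ) {L : ℤ → ℂ}
    (hL : Summable fun j => ‖L j‖ ^ 2) :
    HasSum (fun j : ℤ => eigenCoeff γ ℓ j * L j)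
      (γ * (∑' j : ℤ, sawCoeff j * eTwoPi (j * (ℓ / γ - 1 / γ)) * L j -
        ∑' j : ℤ, sawCoeff j * eTwoPi (j * (ℓ / γ)) * L j) + L 0) := by
  have h1 := ((summable_sawCoeff_mul hL (ℓ / γ - 1 / γ)).hasSum.sub
    (summable_sawCoeff_mul hL (ℓ / γ)).hasSum).mul_left (γ : ℂ)
  have h2 := h1.add (hasSum_ite_eq (0 : ℤ) (L 0))
  refine h2.congr_fun fun j => ?_
  rw [eigenCoeff_eq hγ]
  split_ifs with hj
  · rw [hj]; ring
  · ring

/-- Each part of the multiplicity is averaged separately: 1/γ against frequency 0, and the two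
sawtooths by their Fourier series. -/
theorem bnull_floor_irrational {γ : ℝ} (hγ : 0 < γ) (hirr : Irrational γ) (ℓ : ℝ) {g : ℤ → ℂ}
    {R : ℝ} (hR : ∀ m, ‖g m‖ ≤ R) {L : ℤ → ℂ}
    (hL : ∀ j : ℤ, BNull fun m : ℕ => eTwoPi (-(m * (j / γ))) * g m - L j)
    (hsq : Summable fun j => ‖L j‖ ^ 2) :
    BNull fun n : ℕ => g ⌊γ * n + ℓ⌋ - ∑' j : ℤ, eigenCoeff γ ℓ j * L j := by
  have hγ' : (γ : ℂ) ≠ 0 := by exact_mod_cast hγ.ne'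
  have hθ : Irrational (-(1 / γ)) := by simpa using hirr.inv.neg
  have hL' : ∀ j : ℤ, BNull fun m : ℕ => eTwoPi (j * (m * (-(1 / γ)))) * g m - L j := fun j => by
    convert hL j using 5
    ring
  have h1 := fun y => bnull_sawtooth_mul hθ (g := fun m : ℕ => g m) (fun m => hR m) hL' y
    (summable_sawCoeff_mul hsq y)
  refine bnull_floor_of_bnull_weighted hγ hR ?_
  rw [(hasSum_eigenCoeff_mul hγ.ne' ℓ hsq).tsum_eq]
  have h2 := (((h1 (ℓ / γ - 1 / γ)).add ((h1 (ℓ / γ)).const_mul (-1))).add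
    ((hL 0).const_mul (1 / γ : ℂ)))
  refine h2.of_eventuallyEq (Eventually.of_forall fun m => ?_)
  have h3 : (((⌈((m : ℝ) + 1 - ℓ) / γ⌉ - ⌈((m : ℝ) - ℓ) / γ⌉ : ℤ) : ℝ) : ℂ) = _ :=
    congrArg Complex.ofReal (ceil_sub_ceil_eq γ ℓ m)
  rw [Complex.ofReal_intCast] at h3
  rw [h3]
  simp only [Int.cast_zero, zero_div, mul_zero, neg_zero, eTwoPi_zero, one_mul]
  push_cast
  field_simp
  ring

/-! ### Orthogonality of eigenspaces and square summability. -/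

section Bessel

variable {X : Type*} [MeasurableSpace X] {μ : Measure X} {T : X ≃ᵐ X}

theorem inner_koopman (hT : MeasurePreserving T μ μ) (g h : Lp ℂ 2 μ) :
    inner ℂ (koopman T hT g) (koopman T hT h) = inner ℂ g h :=
  (Lp.compMeasurePreservingₗᵢ ℂ (T : X → X) hT).inner_map_map g h

theorem star_eTwoPi (θ : ℝ) : (starRingEnd ℂ) (eTwoPi θ) = eTwoPi (-θ) := by
  rw [eTwoPi, eTwoPi, ← Complex.exp_conj]
  congr 1
  simp [map_ofNat]

theorem inner_eigenSub_eq_zero (hT : MeasurePreserving T μ μ) {θ θ' : ℝ}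
    (hne : eTwoPi (θ' - θ) ≠ 1) {g h : Lp ℂ 2 μ} (hg : g ∈ eigenSub T hT θ)
    (hh : h ∈ eigenSub T hT θ') : inner ℂ g h = 0 := by
  have h1 := inner_koopman hT g h
  rw [(mem_eigenSub hT θ g).1 hg, (mem_eigenSub hT θ' h).1 hh, inner_smul_left, inner_smul_right,
    star_eTwoPi, ← mul_assoc, ← eTwoPi_add, neg_add_eq_sub] at h1
  by_contra h0
  exact hne (mul_right_cancel₀ h0 (h1.trans (one_mul _).symm))

/-- With v the sum of the projections, orthogonality gives ‖v‖² = Σ ‖P_i‖² = ⟨v, F⟩ ≤ ‖v‖ ‖F‖. -/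
theorem sum_sq_norm_projection_le (hT : MeasurePreserving T μ μ) {ι : Type*} {θ : ι → ℝ}
    (hθ : ∀ i j, i ≠ j → eTwoPi (θ j - θ i) ≠ 1) (F : Lp ℂ 2 μ) (s : Finset ι) :
    ∑ i ∈ s, ‖(eigenSub T hT (θ i)).starProjection F‖ ^ 2 ≤ ‖F‖ ^ 2 := by
  classical
  set P : ι → Lp ℂ 2 μ := fun i => (eigenSub T hT (θ i)).starProjection F
  set v := ∑ i ∈ s, P i
  have hP : ∀ i, P i ∈ eigenSub T hT (θ i) := fun i => Submodule.starProjection_apply_mem _ _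
  have hPF : ∀ i, inner ℂ (P i) F = ((‖P i‖ ^ 2 : ℝ) : ℂ) := fun i => by
    have h1 := (Submodule.mem_orthogonal _ _).1
      ((eigenSub T hT (θ i)).sub_starProjection_mem_orthogonal F) _ (hP i)
    rw [inner_sub_right, sub_eq_zero] at h1
    rw [h1, inner_self_eq_norm_sq_to_K]
    simp
  have hvF : inner ℂ v F = ((∑ i ∈ s, ‖P i‖ ^ 2 : ℝ) : ℂ) := by
    rw [sum_inner, Complex.ofReal_sum]
    exact Finset.sum_congr rfl fun i _ => hPF i
  have hvv : inner ℂ v v = ((∑ i ∈ s, ‖P i‖ ^ 2 : ℝ) : ℂ) := by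
    rw [sum_inner, Complex.ofReal_sum]
    refine Finset.sum_congr rfl fun i hi => ?_
    rw [inner_sum, Finset.sum_eq_single i]
    · rw [inner_self_eq_norm_sq_to_K]; simp
    · exact fun j _ hj => inner_eigenSub_eq_zero hT (hθ i j hj.symm) (hP i) (hP j)
    · exact fun h => absurd hi h
  have hv : ‖v‖ ^ 2 = ∑ i ∈ s, ‖P i‖ ^ 2 := by
    rw [inner_self_eq_norm_sq_to_K] at hvv
    exact Complex.ofReal_injective (by rw [Complex.ofReal_pow]; exact hvv)
  have hle : ∑ i ∈ s, ‖P i‖ ^ 2 ≤ ‖v‖ * ‖F‖ := by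
    have h1 := norm_inner_le_norm (𝕜 := ℂ) v F
    rw [hvF, Complex.norm_real] at h1
    exact (le_abs_self _).trans h1
  rw [← hv] at hle ⊢
  rcases eq_or_lt_of_le (norm_nonneg v) with h0 | h0
  · rw [← h0, zero_pow two_ne_zero]; positivity
  · have : ‖v‖ ≤ ‖F‖ := le_of_mul_le_mul_left (by rwa [pow_two] at hle) h0
    gcongr

/-- Tonelli turns the summability of the squared norms into finiteness of the pointwise sum almost
everywhere. -/
theorem ae_summable_sq_eigenExp (hT : MeasurePreserving T μ μ) {θ : ℤ → ℝ}
    (hθ : ∀ i j, i ≠ j → eTwoPi (θ j - θ i) ≠ 1) {f : X → ℂ} (hf : MemLp f 2 μ) :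
    ∀ᵐ x ∂μ, Summable fun j => ‖eigenExp T hT (θ j) f hf x‖ ^ 2 := by
  set P : ℤ → Lp ℂ 2 μ := fun i => (eigenSub T hT (θ i)).starProjection (hf.toLp f)
  have h1 : Summable fun j => ‖P j‖ ^ 2 := summable_of_sum_le (fun j => by positivity)
    (sum_sq_norm_projection_le hT hθ (hf.toLp f))
  have h2 : ∀ j, ∫⁻ x, ‖P j x‖ₑ ^ (2 : ℝ) ∂μ = ENNReal.ofReal (‖P j‖ ^ 2) := fun j => by
    have h3 := eLpNorm_nnreal_pow_eq_lintegral (f := P j) (μ := μ) (p := 2) two_ne_zero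
    rw [NNReal.coe_ofNat] at h3
    rw [← h3, Lp.norm_def, ← ENNReal.toReal_pow, ENNReal.ofReal_toReal]
    · norm_cast
    · exact ENNReal.pow_ne_top (Lp.eLpNorm_ne_top _)
  have hm : ∀ j, Measurable fun x => ‖P j x‖ₑ ^ (2 : ℝ) := fun j =>
    ((Lp.stronglyMeasurable (P j)).measurable.enorm).pow_const _
  have h4 : ∫⁻ x, ∑' j, ‖P j x‖ₑ ^ (2 : ℝ) ∂μ ≠ ⊤ := by
    rw [lintegral_tsum fun j => (hm j).aemeasurable]
    simp only [h2]
    exact h1.tsum_ofReal_ne_top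
  filter_upwards [ae_lt_top (Measurable.tsum hm) h4] with x hx
  refine (ENNReal.summable_toReal hx.ne).congr fun j => ?_
  rw [← ENNReal.toReal_rpow, toReal_enorm]
  norm_cast

theorem eigenSub_symm (hT : MeasurePreserving T μ μ) (hS : MeasurePreserving T.symm μ μ) (θ : ℝ) :
    eigenSub T.symm hS θ = eigenSub T hT (-θ) := by
  ext g
  rw [mem_eigenSub_iff_ae, mem_eigenSub_iff_ae]
  constructor
  · intro h
    filter_upwards [hT.quasiMeasurePreserving.ae h] with x hx
    rw [T.symm_apply_apply] at hx
    rw [hx, ← mul_assoc, eTwoPi_neg_mul, one_mul]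
  · intro h
    filter_upwards [hS.quasiMeasurePreserving.ae h] with x hx
    rw [T.apply_symm_apply] at hx
    rw [hx, ← mul_assoc, mul_comm (eTwoPi θ), eTwoPi_neg_mul, one_mul]

theorem eigenExp_symm (hT : MeasurePreserving T μ μ) (hS : MeasurePreserving T.symm μ μ) (θ : ℝ)
    {f : X → ℂ} (hf : MemLp f 2 μ) :
    eigenExp T.symm hS θ f hf = eigenExp T hT (-θ) f hf := by
  have key : ∀ (S₁ S₂ : Submodule ℂ (Lp ℂ 2 μ)) [S₁.HasOrthogonalProjection]
      [S₂.HasOrthogonalProjection], S₁ = S₂ → S₁.starProjection = S₂.starProjection := by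
    intro S₁ S₂ _ _ h
    subst h
    rfl
  rw [eigenExp, eigenExp, key _ _ (eigenSub_symm hT hS θ)]

end Bessel

/-! ### Irrational slope of either sign. -/

/-- The identity fails only where γn + ℓ is an integer. Two such n would make γ rational. -/
theorem eventually_floor_neg_eq {γ : ℝ} (hirr : Irrational γ) (ℓ : ℝ) :
    ∀ᶠ n : ℕ in atTop, ⌊γ * n + ℓ⌋ = -⌊-γ * n + -ℓ⌋ - 1 := by
  have h1 : ∀ n : ℕ, (∀ k : ℤ, γ * n + ℓ ≠ k) → ⌊γ * n + ℓ⌋ = -⌊-γ * n + -ℓ⌋ - 1 := by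
    intro n hn
    rw [Int.floor_eq_iff]
    have h2 := Int.floor_le (-γ * n + -ℓ)
    have h3 := Int.lt_floor_add_one (-γ * n + -ℓ)
    have h4 := hn (-⌊-γ * n + -ℓ⌋)
    push_cast at h4 ⊢
    have h5 : γ * n + ℓ < -(⌊-γ * n + -ℓ⌋ : ℝ) := lt_of_le_of_ne (by linarith) h4
    constructor <;> linarith
  by_cases h : ∃ n₀ : ℕ, ∃ k : ℤ, γ * n₀ + ℓ = k
  · obtain ⟨n₀, k₀, h0⟩ := h
    filter_upwards [eventually_gt_atTop n₀] with n hn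
    refine h1 n fun k hk => ?_
    have hne : ((n : ℤ) - n₀) ≠ 0 := by omega
    refine (hirr.intCast_mul hne).ne_int (k - k₀) ?_
    push_cast
    linarith
  · push Not at h
    exact Eventually.of_forall fun n => h1 n (h n)

/-- The extra phase, due to the -1 in the reflected floor, interchanges the two sawtooth phases;
this undoes the change of sign of γ. -/
theorem eigenCoeff_neg_mul {γ : ℝ} (hγ : γ ≠ 0) (ℓ : ℝ) (j : ℤ) :
    eigenCoeff (-γ) (-ℓ) j * eTwoPi (j / -γ) = eigenCoeff γ ℓ j := by
  rw [eigenCoeff_eq (neg_ne_zero.2 hγ), eigenCoeff_eq hγ]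
  rcases eq_or_ne j 0 with rfl | hj
  · simp [sawCoeff, eTwoPi_zero]
  · rw [if_neg hj]
    have e1 : eTwoPi (j * (-ℓ / -γ - 1 / -γ)) * eTwoPi (j / -γ) = eTwoPi (j * (ℓ / γ)) := by
      rw [← eTwoPi_add]; congr 1; field_simp; ring
    have e2 : eTwoPi (j * (-ℓ / -γ)) * eTwoPi (j / -γ) = eTwoPi (j * (ℓ / γ - 1 / γ)) := by
      rw [← eTwoPi_add]; congr 1; field_simp; ring
    rw [← e1, ← e2]
    push_cast
    ring

/-- The averages along `⌊γ n + ℓ⌋`, for `γ` irrational. -/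
theorem ae_bnull_irrational {X : Type*} [MeasurableSpace X] {μ : Measure X}
    [IsProbabilityMeasure μ] {T : X ≃ᵐ X} (hT : MeasurePreserving T μ μ) {f : X → ℂ}
    (hfm : Measurable f) {R : ℝ} (hR : ∀ x, ‖f x‖ ≤ R) (hf : MemLp f 2 μ) {γ : ℝ}
    (hirr : Irrational γ) (ℓ : ℝ) :
    ∀ᵐ x ∂μ, Summable (fun j : ℤ => eigenCoeff γ ℓ j * eigenExp T hT (j / γ) f hf x) ∧
      BNull fun n : ℕ => f (zIter T ⌊γ * n + ℓ⌋ x) -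
        ∑' j : ℤ, eigenCoeff γ ℓ j * eigenExp T hT (j / γ) f hf x := by
  have hγ : γ ≠ 0 := hirr.ne_zero
  have hθ : ∀ i j : ℤ, i ≠ j → eTwoPi ((j : ℝ) / γ - i / γ) ≠ 1 := fun i j hij => by
    have := eTwoPi_ne_one hirr.inv (sub_ne_zero.2 hij.symm)
    convert this using 2
    push_cast
    ring
  have hsum := ae_summable_sq_eigenExp hT hθ hf
  rcases lt_or_gt_of_ne hγ with hneg | hpos
  · have hS : MeasurePreserving T.symm μ μ := hT.symm T
    have htw := ae_all_iff.2 fun j : ℤ => ae_bnull_twisted hS ((j : ℝ) / -γ) hfm hf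
    filter_upwards [hsum, htw] with x h1 h2
    refine ⟨(hasSum_eigenCoeff_mul hγ ℓ h1).summable, ?_⟩
    -- With s = ⌊-γn - ℓ⌋ the exponent is eventually -s - 1. The twisted averages of the inverse
    -- map, shifted by one, produce the phase in `L`.
    have h3 := bnull_floor_irrational (neg_pos.2 hneg) hirr.neg (-ℓ)
      (g := fun m => f (zIter T (-m - 1) x)) (fun m => hR _)
      (L := fun j => eTwoPi (j / -γ) * eigenExp T hT (j / γ) f hf x) (fun j => by
        refine ((h2 j).shift.const_mul (eTwoPi (j / -γ))).of_eventuallyEq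
          (Eventually.of_forall fun m => ?_)
        rw [eigenExp_symm hT, zIter_symm, mul_sub, ← mul_assoc, ← eTwoPi_add]
        have e1 : -((j : ℝ) / -γ) = j / γ := by rw [div_neg, neg_neg]
        have e2 : (j : ℝ) / -γ + -((m + 1 : ℕ) * (j / -γ)) = -(m * (j / -γ)) := by
          push_cast; ring
        have e3 : -((m + 1 : ℕ) : ℤ) = -(m : ℤ) - 1 := by push_cast; ring
        rw [e1, e2, e3])
      (by simpa only [norm_mul, norm_eTwoPi, one_mul] using h1)
    simp only [← mul_assoc, eigenCoeff_neg_mul hγ] at h3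
    refine h3.of_eventuallyEq ?_
    filter_upwards [eventually_floor_neg_eq hirr ℓ] with n hn
    rw [hn]
  · have htw := ae_all_iff.2 fun j : ℤ => ae_bnull_twisted hT ((j : ℝ) / γ) hfm hf
    filter_upwards [hsum, htw] with x h1 h2
    exact ⟨(hasSum_eigenCoeff_mul hγ ℓ h1).summable,
      bnull_floor_irrational hpos hirr ℓ (g := fun m => f (zIter T m x)) (fun m => hR _) h2 h1⟩

/-! ### Comparison of weights and the product of all averages. -/

theorem Prec.trans {a b c : ℝ → ℝ} (hab : Prec a b) (hbc : Prec b c) (hb : ∀ᶠ x in atTop, b x ≠ 0) :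
    Prec a c := by
  have := hab.mul hbc
  rw [mul_zero] at this
  refine this.congr' ?_
  filter_upwards [hb] with x hx
  field_simp

theorem tendsto_weighted_variation_div {w w' x : ℕ → ℝ} (hw : ∀ n, 0 ≤ w n) (hw' : ∀ n, 0 ≤ w' n)
    (hx : ∀ n, 0 ≤ x n) (hww' : ∀ ε : ℝ, 0 < ε → ∀ᶠ n in atTop, w n ≤ ε * w' n) {A C : ℝ}
    (hA : 0 ≤ A) (hsum : ∀ N : ℕ, ∑ n ∈ Finset.range N, w' n * x n ≤ A * N + C) :
    Tendsto (fun N : ℕ => (∑ n ∈ Finset.range N, w n * x n) / N) atTop (𝓝 0) := by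
  have hC : 0 ≤ C := by simpa using hsum 0
  refine tendsto_order.2 ⟨fun b hb => Eventually.of_forall fun N => hb.trans_le
    (div_nonneg (Finset.sum_nonneg fun n _ => mul_nonneg (hw n) (hx n)) (Nat.cast_nonneg N)),
    fun ε hε => ?_⟩
  set η := ε / (2 * (A + 1)) with hη'
  have hη : 0 < η := by positivity
  obtain ⟨n₀, hn₀⟩ := eventually_atTop.1 (hww' η hη)
  set D := ∑ n ∈ Finset.range n₀, w n * x n + η * C with hD
  have hbound : ∀ N : ℕ, ∑ n ∈ Finset.range N, w n * x n ≤ η * A * N + D := fun N => by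
    have h1 : ∀ n, w n * x n ≤ η * (w' n * x n) + if n < n₀ then w n * x n else 0 := fun n => by
      split_ifs with h
      · exact le_add_of_nonneg_left (mul_nonneg hη.le (mul_nonneg (hw' n) (hx n)))
      · rw [add_zero, ← mul_assoc]
        exact mul_le_mul_of_nonneg_right (hn₀ n (not_lt.1 h)) (hx n)
    have h2 : ∑ n ∈ Finset.range N, (if n < n₀ then w n * x n else 0) ≤
        ∑ n ∈ Finset.range n₀, w n * x n := by
      rw [← Finset.sum_filter]
      exact Finset.sum_le_sum_of_subset_of_nonneg (fun n hn => by simp at hn ⊢; exact hn.2)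
        fun n _ _ => mul_nonneg (hw n) (hx n)
    refine (Finset.sum_le_sum fun n _ => h1 n).trans ?_
    rw [Finset.sum_add_distrib, ← Finset.mul_sum]
    have := mul_le_mul_of_nonneg_left (hsum N) hη.le
    linarith
  have hlim : Tendsto (fun N : ℕ => D * (1 / (N : ℝ))) atTop (𝓝 0) := by
    simpa using (tendsto_one_div_atTop_nhds_zero_nat (𝕜 := ℝ)).const_mul D
  filter_upwards [hlim.eventually (gt_mem_nhds (half_pos hε)), eventually_gt_atTop 0] with N hN hN0
  have hN0 : (0 : ℝ) < N := by exact_mod_cast hN0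
  have h3 : η * A ≤ ε / 2 := by
    rw [hη', div_mul_eq_mul_div, div_le_iff₀ (by positivity)]
    nlinarith
  calc _ ≤ (η * A * N + D) / N := by gcongr; exact hbound N
    _ = η * A + D * (1 / (N : ℝ)) := by field_simp
    _ < ε := by linarith

section Main

variable {d : ℕ} {a : Fin (d + 1) → ℝ → ℝ}

theorem deriv_tendsto_and_ne_zero {k ℓ : ℝ} (hk : k ≠ 0) (ha_lin : ∀ x, a 0 x = k * x + ℓ)
    (haS : ∀ i : Fin d, MemS (a i.succ))
    (ha_deriv : ∀ i : Fin d, Prec (deriv (a i.succ)) (deriv (a i.castSucc))) (i : Fin (d + 1)) :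
    (∃ c : ℝ, Tendsto (deriv (a i)) atTop (𝓝 c) ∧ (i ≠ 0 → c = 0)) ∧
      ∀ᶠ x in atTop, deriv (a i) x ≠ 0 := by
  induction i using Fin.induction with
  | zero =>
    have h1 : deriv (a 0) = fun _ => k := by
      have : a 0 = fun x => k * x + ℓ := funext ha_lin
      rw [this]
      ext x
      simp
    rw [h1]
    exact ⟨⟨k, tendsto_const_nhds, fun h => absurd rfl h⟩, Eventually.of_forall fun _ => hk⟩
  | succ i ih =>
    obtain ⟨⟨c, hc, -⟩, hne⟩ := ih
    refine ⟨⟨0, ?_, fun _ => rfl⟩, (haS i).2.2.1⟩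
    have h1 := (ha_deriv i).mul hc
    rw [zero_mul] at h1
    refine h1.congr' ?_
    filter_upwards [hne] with x hx
    field_simp

theorem prec_deriv_of_lt (hne : ∀ i, ∀ᶠ x in atTop, deriv (a i) x ≠ 0)
    (ha_deriv : ∀ i : Fin d, Prec (deriv (a i.succ)) (deriv (a i.castSucc))) (j : Fin (d + 1)) :
    ∀ i < j, Prec (deriv (a j)) (deriv (a i)) := by
  induction j using Fin.induction with
  | zero => exact fun i hi => absurd hi (Fin.not_lt_zero i)
  | succ j ih =>
    intro i hi
    rcases (Fin.le_castSucc_iff.2 hi).eq_or_lt with rfl | hlt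
    · exact ha_deriv j
    · exact (ha_deriv j).trans (ih i hlt) (hne _)

/-- Multiplied by |b'|, the left weight becomes |b'| + |b'/a'|, which tends to 0. -/
theorem weight_le_of_prec {a b : ℝ → ℝ} (h : Prec (deriv b) (deriv a))
    (hb : Tendsto (deriv b) atTop (𝓝 0)) (hb0 : ∀ᶠ x in atTop, deriv b x ≠ 0) {ε : ℝ} (hε : 0 < ε) :
    ∀ᶠ n : ℕ in atTop, 1 + |1 / deriv a n| ≤ ε * (1 + |1 / deriv b n|) := by
  refine tendsto_natCast_atTop_atTop.eventually (p := fun x : ℝ =>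
    1 + |1 / deriv a x| ≤ ε * (1 + |1 / deriv b x|)) ?_
  have h1 : Tendsto (fun x => |deriv b x| + |deriv b x / deriv a x|) atTop (𝓝 0) := by
    simpa using hb.abs.add (Tendsto.abs h)
  filter_upwards [h1.eventually (gt_mem_nhds hε), hb0] with x h2 h3
  have h4 : 0 < |deriv b x| := abs_pos.2 h3
  have h5 : (1 + |1 / deriv a x|) * |deriv b x| ≤ ε := by
    refine le_trans (le_of_eq ?_) h2.le
    rw [abs_div, abs_div, abs_one]
    ring
  have h6 : 1 + |1 / deriv a x| ≤ ε * |1 / deriv b x| := by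
    rw [abs_div _ (deriv b x), abs_one, mul_one_div, le_div_iff₀ h4]
    exact h5
  linarith

theorem weight_div_tendsto_zero {a : ℝ → ℝ}
    (h : Tendsto (fun x => 1 / deriv a x / x) atTop (𝓝 0)) :
    Tendsto (fun n : ℕ => (1 + |1 / deriv a n|) / n) atTop (𝓝 0) := by
  have h1 := (tendsto_one_div_atTop_nhds_zero_nat (𝕜 := ℝ)).add
    (h.comp tendsto_natCast_atTop_atTop).abs
  rw [abs_zero, add_zero] at h1
  refine h1.congr fun n => ?_
  rw [Function.comp_apply, abs_div _ (n : ℝ), Nat.abs_cast, add_div]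

/-- Multiple averages along functions of different growth converge to the product of the limits of
the single averages. -/
theorem ae_tendsto_multAvg {X : Fin (d + 1) → Type u}
    [∀ i, MetricSpace (X i)] [∀ i, CompactSpace (X i)]
    [∀ i, MeasurableSpace (X i)] [∀ i, BorelSpace (X i)]
    (μ : ∀ i, Measure (X i)) [∀ i, IsProbabilityMeasure (μ i)]
    (T : ∀ i, X i ≃ᵐ X i) (hT : ∀ i, MeasurePreserving (T i) (μ i) (μ i))
    {k ℓ : ℝ} (hk : k ≠ 0) (ha_lin : ∀ x, a 0 x = k * x + ℓ)
    (ha_star : ∀ i : Fin d, MemSStar.{u} (a i.succ))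
    (ha_deriv : ∀ i : Fin d, Prec (deriv (a i.succ)) (deriv (a i.castSucc)))
    (ν : Measure (∀ i, X i)) (hν : IsCoupling μ ν)
    (f : ∀ i, X i → ℂ) (hfm : ∀ i, Measurable (f i)) {R : Fin (d + 1) → ℝ}
    (hR : ∀ i x, ‖f i x‖ ≤ R i) {L₀ : X 0 → ℂ}
    (hL₀ : ∀ᵐ x ∂μ 0, BNull fun n : ℕ => f 0 (zIter (T 0) ⌊k * n + ℓ⌋ x) - L₀ x) :
    ∀ᵐ x ∂ν, Tendsto (multAvg T a f x) atTop (𝓝 (L₀ (x 0) * ∏ i : Fin d,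
      ((μ i.succ)[f i.succ | MeasurableSpace.invariants (T i.succ)]) (x i.succ))) := by
  have haS : ∀ i : Fin d, MemS (a i.succ) := fun i => (ha_star i).1
  have hder := deriv_tendsto_and_ne_zero hk ha_lin haS ha_deriv
  have hder0 : ∀ i : Fin d, Tendsto (deriv (a i.succ)) atTop (𝓝 0) := fun i => by
    obtain ⟨⟨c, hc, h0⟩, -⟩ := hder i.succ
    rwa [h0 (Fin.succ_ne_zero i)] at hc
  have hprec := prec_deriv_of_lt (fun i => (hder i).2) ha_deriv
  -- Only the marginals of ν are used: each full-measure statement concerns a single coordinate.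
  have hev : ∀ i {p : X i → Prop}, (∀ᵐ x ∂μ i, p x) → ∀ᵐ x ∂ν, p (x i) := fun i p hp =>
    ae_of_ae_map (measurable_pi_apply i).aemeasurable (by rw [hν i]; exact hp)
  have hsucc : ∀ᵐ x ∂ν, ∀ i : Fin d, WNull (fun n : ℕ => 1 + |1 / deriv (a i.succ) n|)
      (fun n : ℕ => f i.succ (zIter (T i.succ) ⌊a i.succ n⌋ (x i.succ)) -
        ((μ i.succ)[f i.succ | MeasurableSpace.invariants (T i.succ)]) (x i.succ)) :=
    ae_all_iff.2 fun i => hev i.succ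
      ((ha_star i).ae_wnull (hder0 i) (hT i.succ) (hfm i.succ) (hR i.succ))
  filter_upwards [hsucc, hev 0 hL₀] with x h1 h2
  let u : Fin (d + 1) → ℕ → ℂ := fun i n => f i (zIter (T i) ⌊a i n⌋ (x i))
  set K := 1 + ∑ i, |R i|
  have hK : 1 ≤ K := le_add_of_nonneg_right (Finset.sum_nonneg fun i _ => abs_nonneg _)
  have hu : ∀ i n, ‖u i n‖ ≤ K := fun i n => by
    have h3 := Finset.single_le_sum (f := fun i => |R i|) (fun i _ => abs_nonneg _)
      (Finset.mem_univ i)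
    have h4 := hR i (zIter (T i) ⌊a i n⌋ (x i))
    have h5 := le_abs_self (R i)
    show ‖f i (zIter (T i) ⌊a i n⌋ (x i))‖ ≤ K
    linarith
  have h3 := tendsto_avg_prod u (Fin.cons (L₀ (x 0)) fun i : Fin d =>
    ((μ i.succ)[f i.succ | MeasurableSpace.invariants (T i.succ)]) (x i.succ))
    (fun i n => 1 + |1 / deriv (a i) n|) hK hu (fun i n => by positivity) ?_ ?_ ?_
  · rw [Fin.prod_univ_succ] at h3
    exact h3
  · intro i
    refine weight_div_tendsto_zero ?_
    induction i using Fin.cases with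
    | zero =>
      have e : deriv (a 0) = fun _ => k := by
        have : a 0 = fun x => k * x + ℓ := funext ha_lin
        rw [this]
        ext x
        simp
      rw [e]
      exact tendsto_const_nhds.div_atTop tendsto_id
    | succ i => exact (haS i).2.2.2.1
  · intro i
    induction i using Fin.cases with
    | zero =>
      refine BNull.wnull ?_ fun n => by simp
      simpa only [u, ha_lin, Fin.cons_zero] using h2
    | succ i => exact h1 i
  · intro i j hij
    obtain ⟨j, rfl⟩ := Fin.exists_succ_eq.2 (Fin.ne_zero_of_lt hij)
    obtain ⟨A, C, hA, hC, hs⟩ := (haS j).sum_jumps_le (hder0 j)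
    have hK0 : 0 ≤ K := zero_le_one.trans hK
    refine tendsto_weighted_variation_div (w' := fun n : ℕ => 1 + |1 / deriv (a j.succ) n|)
      (A := 2 * K * A) (C := 2 * K * C) (fun n => by positivity)
      (fun n => by positivity) (fun n => norm_nonneg _)
      (fun ε hε => weight_le_of_prec (hprec _ _ hij) (hder0 j) (hder _).2 hε) (by positivity)
      fun N => ?_
    -- The factor `u j.succ` changes only when its floor changes, and then by at most 2K.
    calc _ ≤ ∑ n ∈ Finset.range N, 2 * K * ((1 + |1 / deriv (a j.succ) n|) *
          (if ⌊a j.succ (n + 1 : ℕ)⌋ = ⌊a j.succ n⌋ then 0 else 1)) := by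
          refine Finset.sum_le_sum fun n _ => ?_
          rw [mul_left_comm]
          gcongr
          split_ifs with h
          · have h6 : u j.succ (n + 1) = u j.succ n := by
              simp only [u]
              rw [h]
            rw [h6, sub_self, norm_zero, mul_zero]
          · rw [mul_one]
            refine (norm_sub_le _ _).trans ?_
            linarith [hu j.succ (n + 1), hu j.succ n]
      _ ≤ 2 * K * (A * N + C) := by
          rw [← Finset.mul_sum]
          exact mul_le_mul_of_nonneg_left (hs N) (by positivity)
      _ = _ := by ring

end Main

/-! ### The theorem. -/

theorem theorem1p2 {d : ℕ} {X : Fin (d + 1) → Type u}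
    [∀ i, MetricSpace (X i)] [∀ i, CompactSpace (X i)]
    [∀ i, MeasurableSpace (X i)] [∀ i, BorelSpace (X i)]
    (μ : ∀ i, Measure (X i)) [∀ i, IsProbabilityMeasure (μ i)]
    (T : ∀ i, X i ≃ᵐ X i) (hT : ∀ i, MeasurePreserving (T i) (μ i) (μ i))
    (a : Fin (d + 1) → ℝ → ℝ) (k ℓ : ℝ) (hk : k ≠ 0) (ha_lin : ∀ x, a 0 x = k * x + ℓ)
    (ha_star : ∀ i : Fin d, MemSStar.{u} (a i.succ))
    (ha_growth : ∀ i : Fin d, Prec (a i.succ) (a i.castSucc))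
    (ha_deriv : ∀ i : Fin d, Prec (deriv (a i.succ)) (deriv (a i.castSucc)))
    (ν : Measure (∀ i, X i)) (hν : IsCoupling μ ν)
    (f : ∀ i, X i → ℂ) (hf : ∀ i, MemLp (f i) ⊤ (μ i)) :
    (∀ᵐ x ∂ν, ∃ L : ℂ, Tendsto (multAvg T a f x) atTop (𝓝 L)) ∧
    (∀ (p : ℤ) (q : ℕ), p ≠ 0 → 0 < q → k = (p : ℝ) / (q : ℝ) →
      ∀ᵐ x ∂ν, Tendsto (multAvg T a f x) atTop
        (𝓝 ((1 / (q : ℂ)) *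
          (∑ j ∈ Finset.range q,
            ((μ 0)[fun y => f 0 (zIter (T 0) ⌊(p : ℝ) * j / q + ℓ⌋ y) |
              MeasurableSpace.invariants (zIter (T 0) p)]) (x 0)) *
          ∏ i : Fin d,
            ((μ i.succ)[f i.succ | MeasurableSpace.invariants (T i.succ)]) (x i.succ)))) ∧
    (Irrational k →
      ∀ᵐ x ∂ν,
        Summable (fun m : ℤ => eigenCoeff k ℓ m *
          eigenExp (T 0) (hT 0) (m / k) (f 0) ((hf 0).mono_exponent le_top) (x 0)) ∧
        Tendsto (multAvg T a f x) atTop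
          (𝓝 ((∑' m : ℤ, eigenCoeff k ℓ m *
            eigenExp (T 0) (hT 0) (m / k) (f 0) ((hf 0).mono_exponent le_top) (x 0)) *
          ∏ i : Fin d,
            ((μ i.succ)[f i.succ | MeasurableSpace.invariants (T i.succ)]) (x i.succ)))) := by
  -- Pointwise bounds along orbits require everywhere bounded measurable versions. They agree with
  -- `f` at all iterates almost everywhere, so neither the averages nor the limits change.
  choose g hgm hfg R hR0 hgR using fun i => exists_bounded_version (hf i)
  have hev : ∀ i {p : X i → Prop}, (∀ᵐ x ∂μ i, p x) → ∀ᵐ x ∂ν, p (x i) := fun i p hp =>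
    ae_of_ae_map (measurable_pi_apply i).aemeasurable (by rw [hν i]; exact hp)
  have havg : ∀ᵐ x ∂ν, multAvg T a f x = multAvg T a g x := by
    have h1 : ∀ᵐ x ∂ν, ∀ i, ∀ m : ℤ, f i (zIter (T i) m (x i)) = g i (zIter (T i) m (x i)) :=
      ae_all_iff.2 fun i => hev i (ae_forall_zIter (hT i) (hfg i))
    filter_upwards [h1] with x hx
    ext N
    simp only [multAvg, hx]
  have hcond : ∀ᵐ x ∂ν, ∀ i : Fin d,
      ((μ i.succ)[f i.succ | MeasurableSpace.invariants (T i.succ)]) (x i.succ) =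
        ((μ i.succ)[g i.succ | MeasurableSpace.invariants (T i.succ)]) (x i.succ) :=
    ae_all_iff.2 fun i => hev i.succ (condExp_congr_ae (hfg i.succ))
  have hg2 : MemLp (g 0) 2 (μ 0) := ((memLp_congr_ae (hfg 0)).1 (hf 0)).mono_exponent le_top
  have hmain := fun {L₀ : X 0 → ℂ} => ae_tendsto_multAvg μ T hT hk ha_lin ha_star ha_deriv ν hν g
    hgm hgR (L₀ := L₀)
  have hrat : ∀ (p : ℤ) (q : ℕ), p ≠ 0 → 0 < q → k = (p : ℝ) / (q : ℝ) →
      ∀ᵐ x ∂ν, Tendsto (multAvg T a f x) atTop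
        (𝓝 ((1 / (q : ℂ)) *
          (∑ j ∈ Finset.range q,
            ((μ 0)[fun y => f 0 (zIter (T 0) ⌊(p : ℝ) * j / q + ℓ⌋ y) |
              MeasurableSpace.invariants (zIter (T 0) p)]) (x 0)) *
          ∏ i : Fin d,
            ((μ i.succ)[f i.succ | MeasurableSpace.invariants (T i.succ)]) (x i.succ))) := by
    rintro p q - hq rfl
    have h1 := hmain (ae_bnull_rational (hT 0) (hgm 0) hg2 p hq ℓ)
    have h2 : ∀ᵐ x ∂ν, ∀ j : ℕ, ((μ 0)[fun y => f 0 (zIter (T 0) ⌊(p : ℝ) * j / q + ℓ⌋ y) |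
        MeasurableSpace.invariants (zIter (T 0) p)]) (x 0) =
        ((μ 0)[fun y => g 0 (zIter (T 0) ⌊(p : ℝ) * j / q + ℓ⌋ y) |
        MeasurableSpace.invariants (zIter (T 0) p)]) (x 0) :=
      ae_all_iff.2 fun j => hev 0 (condExp_congr_ae
        ((measurePreserving_zIter (hT 0) _).quasiMeasurePreserving.ae_eq_comp (hfg 0)))
    filter_upwards [h1, h2, havg, hcond] with x h1 h2 h3 h4
    simp only [h2, h3, h4]
    exact h1
  have hirr : Irrational k →
      ∀ᵐ x ∂ν,
        Summable (fun m : ℤ => eigenCoeff k ℓ m *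
          eigenExp (T 0) (hT 0) (m / k) (f 0) ((hf 0).mono_exponent le_top) (x 0)) ∧
        Tendsto (multAvg T a f x) atTop
          (𝓝 ((∑' m : ℤ, eigenCoeff k ℓ m *
            eigenExp (T 0) (hT 0) (m / k) (f 0) ((hf 0).mono_exponent le_top) (x 0)) *
          ∏ i : Fin d,
            ((μ i.succ)[f i.succ | MeasurableSpace.invariants (T i.succ)]) (x i.succ))) := by
    intro hk_irr
    have h0 := ae_bnull_irrational (hT 0) (hgm 0) (hgR 0) hg2 hk_irr ℓ
    have h1 := hmain (h0.mono fun x hx => hx.2)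
    have e : ∀ θ : ℝ, eigenExp (T 0) (hT 0) θ (f 0) ((hf 0).mono_exponent le_top) =
        eigenExp (T 0) (hT 0) θ (g 0) hg2 := fun θ => eigenExp_congr _ _ _ _ (hfg 0)
    filter_upwards [h1, hev 0 h0, havg, hcond] with x h1 h2 h3 h4
    simp only [e, h3, h4]
    exact ⟨h2.1, h1⟩
  refine ⟨?_, hrat, hirr⟩
  -- A rational slope is written in lowest terms, so bare convergence follows from the two formulas.
  by_cases hk_irr : Irrational k
  · exact (hirr hk_irr).mono fun x hx => ⟨_, hx.2⟩
  · obtain ⟨r, hr⟩ : ∃ r : ℚ, (r : ℝ) = k := by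
      simpa [Irrational] using hk_irr
    have hr0 : r.num ≠ 0 := by
      rw [Rat.num_ne_zero]
      rintro rfl
      exact hk (by rw [← hr, Rat.cast_zero])
    exact (hrat r.num r.den hr0 r.den_pos (by rw [← hr, Rat.cast_def])).mono fun x hx => ⟨_, hx⟩
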